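/- **Setting.** Let $X$ be a covariate vector with values in a Borel set $\mathcal X\subset\mathbb R^d$, $T$ a treatment with values in a Borel set $\mathcal T\subset\mathbb R$, $Y(t)$, $t\in\mathcal T$, (jointly measurable) potential outcomes, $Y=Y(T)$ and $Z=(Y,T,X)$. Let $dt$ denote a fixed $\sigma$-finite measure on $\mathcal T$ and let $f(t|x)$ be the conditional density of $T$ given $X$ with respect to $dt$. For $\theta\in\Theta\subset\mathbb R^p$ let $\Pi_\theta(dt|x)=\pi_\theta(t|x)\,dt$ be a randomized policy, with $\pi_\theta(t|x)$ jointly measurable in $(\theta,t,x)$. Put $$W(\theta)=\mathbb E\Big[\int Y(t)\,\Pi_\theta(dt|X)\Big],\quad R(\theta)=W(\theta^*)-W(\theta),\quad m(t,x)=\mathbb E[Y|T=t,X=x],\quad \omega(t,x)=1/f(t|x).$$ **Assumptions.** 1. *Unconfoundedness:* $Y(t)\perp T\mid X$ for all $t\in\mathcal T$, in the sense that for almost every $(s,x)$ the conditional law of $Y(t)$ given $(T,X)=(s,x)$ equals the conditional law of $Y(t)$ given $X=x$, simultaneously for all $t\in\mathcal T$. 2. $\Theta$ is compact and convex; $W$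 is concave on $\Theta$ and twice differentiable on a neighborhood of $\theta^*\in\operatorname{int}(\Theta)$; $\theta^*$ is the unique maximizer of $W$ on $\Theta$; $\nabla W(\theta^*)=0$ and $H=-\nabla^2W(\theta^*)\succ0$. 3. For almost every $(t,x)$, $\theta\mapsto\pi_\theta(t|x)$ is continuous on $\Theta$ and differentiable on a neighborhood $\mathcal N$ of $\theta^*$ (the same for all $(t,x)$), with $\|\partial_\theta\pi_\theta(t|x)\|$ bounded by a constant for all $\theta\in\mathcal N$; moreover $\sup_{\theta\in\Theta}\sup_{t,x}\pi_\theta(t|x)<\infty$. 4. $|Y(t)|\le M<\infty$ for all $t\in\mathcal T$, and $f(t|x)\ge\underline f>0$ for all $(t,x)\in\mathcal T\times\mathcal X$. 5. The data $Z_1,Z_2,\dots$, $Z_i=(Y_i,T_i,X_i)$, are i.i.d. copies of $Z$. For each $n$, $\{1,\dots,n\}$ is partitioned into $L\ge2$ folds $\mathcal I_1,\dots,\mathcal I_L$ of equal size (up to one index if $L\nmid n$). For each fold, $\hat\omega^{(-\ell)}$ and $\hat m^{(-\ell)}$ are measurable functions computed from the data outside $\mathcal I_\ell$, and there are $\rho_\omega,\rho_m>0$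 with $\rho_\omega+\rho_m\ge\frac12$ such that, for every $\ell$, $$\|\hat\omega^{(-\ell)}-\omega\|_{L_2}=o_p(n^{-\rho_\omega}),\qquad \|\hat m^{(-\ell)}-m\|_{L_2}=o_p(n^{-\rho_m}),$$ where $\|\cdot\|_{L_2}$ is the $L_2$-norm under the law of $(T,X)$. With probability tending to one, $\hat m^{(-\ell)}$ is bounded on $\mathcal T\times\mathcal X$ by a fixed constant. Let $$\widehat W^{dr}(\theta)=\frac1n\sum_{\ell=1}^L\sum_{i\in\mathcal I_\ell}\Big(\hat\omega^{(-\ell)}(T_i,X_i)\,\pi_\theta(T_i|X_i)\,\big(Y_i-\hat m^{(-\ell)}(T_i,X_i)\big)+\int\hat m^{(-\ell)}(t,X_i)\,\pi_\theta(t|X_i)\,dt\Big)$$ and let $\hat\theta^{dr}$ be a random variable such that $\hat\theta^{dr}\in\arg\max_{\theta\in\Theta}\widehat W^{dr}(\theta)$ with probability tending to one. **Conclusion.** With $$\dot\varphi(Z)=\int\partial_\theta\pi_{\theta^*}(t|X)\,m(t,X)\,dt+\frac{\partial_\theta\pi_{\theta^*}(T|X)}{f(T|X)}\,(Y-m(T,X)),\qquad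 V_{\mathrm{eff}}=H^{-1}\operatorname{Var}(\dot\varphi(Z))H^{-1},$$ and $G\sim\mathcal N(0,V_{\mathrm{eff}})$, as $n\to\infty$, $$\sqrt n\,(\hat\theta^{dr}-\theta^*)\Rightarrow G\qquad\text{and}\qquad n\,R(\hat\theta^{dr})\Rightarrow\tfrac12\,G'HG ,$$ that is, the policy estimator attains the efficient limiting distribution of the regret. -/

import Mathlib

open MeasureTheory ProbabilityTheory Filter Topology Matrix
open scoped ENNReal Gradient

noncomputable section

/-- The covariate space `ℝ^d` that contains `𝒳`. -/
abbrev Cov (d : ℕ) : Type := EuclideanSpace ℝ (Fin d)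

/-- The parameter space `ℝ^p` that contains `Θ`. -/
abbrev Par (p : ℕ) : Type := EuclideanSpace ℝ (Fin p)

/-- An observation `z = (y, t, x)`. -/
abbrev Obs (d : ℕ) : Type := ℝ × ℝ × Cov d

/-- The population of the policy learning problem: treatment, covariates and potential outcomes of
one unit, as random elements on `Ω₀`, the conditional treatment density `f(t | x)`, and a class of
randomized policies, given by their densities `π_θ(t | x)`. Both densities are taken with respect to
a fixed `σ`-finite measure `ν` ("`dt`") carried by the treatment set `𝒯`. Functions of `(t, x)` are
total; only their values on `𝒯 × 𝒳` (and, for the policies, `θ ∈ Θ`) matter. -/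
structure PolicyModel (d p : ℕ) (Ω₀ : Type*) [MeasurableSpace Ω₀] where
  /-- treatment levels -/
  𝒯 : Set ℝ
  measurableSet_𝒯 : MeasurableSet 𝒯
  /-- covariate values -/
  𝒳 : Set (Cov d)
  measurableSet_𝒳 : MeasurableSet 𝒳
  /-- policy parameters -/
  Θ : Set (Par p)
  /-- law of the population -/
  law : Measure Ω₀
  isProbabilityMeasure_law : IsProbabilityMeasure law
  /-- covariates -/
  X : Ω₀ → Cov d
  measurable_X : Measurable X
  X_mem : ∀ u, X u ∈ 𝒳
  /-- observed treatment -/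
  T : Ω₀ → ℝ
  measurable_T : Measurable T
  T_mem : ∀ u, T u ∈ 𝒯
  /-- potential outcomes, `Y t u` is the outcome of `u` under treatment level `t` -/
  Y : ℝ → Ω₀ → ℝ
  measurable_Y : Measurable fun q : ℝ × Ω₀ => Y q.1 q.2
  /-- the measure `dt` on `𝒯` -/
  ν : Measure ℝ
  sigmaFinite_ν : SigmaFinite ν
  ν_compl : ν 𝒯ᶜ = 0
  /-- the conditional density of `T` given `X` -/
  f : ℝ → Cov d → ℝ
  measurable_f : Measurable fun z : ℝ × Cov d => f z.1 z.2
  law_TX_eq : law.map (fun u => (T u, X u)) =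
    (ν.prod (law.map X)).withDensity fun z => ENNReal.ofReal (f z.1 z.2)
  /-- the policy densities, `pol θ t x = π_θ(t | x)` -/
  pol : Par p → ℝ → Cov d → ℝ
  measurable_pol : Measurable fun q : Par p × ℝ × Cov d => pol q.1 q.2.1 q.2.2
  pol_nonneg : ∀ θ ∈ Θ, ∀ t ∈ 𝒯, ∀ x ∈ 𝒳, 0 ≤ pol θ t x
  lintegral_pol : ∀ θ ∈ Θ, ∀ x ∈ 𝒳, ∫⁻ t, ENNReal.ofReal (pol θ t x) ∂ν = 1

attribute [instance] PolicyModel.isProbabilityMeasure_law PolicyModel.sigmaFinite_ν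

namespace PolicyModel

variable {d p : ℕ} {Ω₀ : Type*} [MeasurableSpace Ω₀] (M : PolicyModel d p Ω₀)

/-- The pair `(T, X)`. -/
def TX (u : Ω₀) : ℝ × Cov d := (M.T u, M.X u)

/-- The observed outcome `Y = Y(T)`. -/
def Yobs (u : Ω₀) : ℝ := M.Y (M.T u) u

/-- The observed vector `Z = (Y, T, X)`. -/
def Z (u : Ω₀) : Obs d := (M.Yobs u, M.T u, M.X u)

/-- The law of `X`. -/
def lawX : Measure (Cov d) := M.law.map M.X

/-- The law of `(T, X)`. -/
def lawTX : Measure (ℝ × Cov d) := M.law.map M.TX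

/-- The policy `Π_θ(dt | x) = π_θ(t | x) dt`. -/
def policy (θ : Par p) (x : Cov d) : Measure ℝ :=
  M.ν.withDensity fun t => ENNReal.ofReal (M.pol θ t x)

/-- The welfare `W(θ) = E[∫ Y(t) Π_θ(dt | X)]`. -/
def welfare (θ : Par p) : ℝ := ∫ u, ∫ t, M.Y t u ∂(M.policy θ (M.X u)) ∂M.law

/-- The regret `R(θ) = W(θ*) - W(θ)`. -/
def regret (θs θ : Par p) : ℝ := M.welfare θs - M.welfare θ

/-- The regression function `m(t, x) = E[Y | T = t, X = x]`. -/
def m (t : ℝ) (x : Cov d) : ℝ := ∫ y, y ∂(condDistrib M.Yobs M.TX M.law (t, x))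

/-- The weight `ω(t, x) = 1 / f(t | x)`. -/
def ω (t : ℝ) (x : Cov d) : ℝ := 1 / M.f t x

/-- The gradient `∂_θ π_θ(t | x)`. -/
def dpol (θ : Par p) (t : ℝ) (x : Cov d) : Par p := ∇ (fun θ' => M.pol θ' t x) θ

/-- The function `φ̇(z) = ∫ ∂_θ π_θ*(t | x) m(t, x) dt + ∂_θ π_θ*(t | x) / f(t | x) (y - m(t, x))`
at `z = (y, t, x)`. -/
def phiDot (θs : Par p) (z : Obs d) : Par p :=
  (∫ t, M.m t z.2.2 • M.dpol θs t z.2.2 ∂M.ν)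
    + ((z.1 - M.m z.2.1 z.2.2) / M.f z.2.1 z.2.2) • M.dpol θs z.2.1 z.2.2

/-- The matrix `H = -∇² W(θ*)`. -/
def H (θs : Par p) : Matrix (Fin p) (Fin p) ℝ :=
  Matrix.of fun i j => -(fderiv ℝ (fderiv ℝ M.welfare) θs
    (EuclideanSpace.single i (1 : ℝ)) (EuclideanSpace.single j (1 : ℝ)))

/-- The covariance matrix `Var(φ̇(Z))`. -/
def varPhiDot (θs : Par p) : Matrix (Fin p) (Fin p) ℝ :=
  Matrix.of fun i j => covariance (fun u => M.phiDot θs (M.Z u) i)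
    (fun u => M.phiDot θs (M.Z u) j) M.law

/-- The efficiency bound `V_eff = H⁻¹ Var(φ̇(Z)) H⁻¹`. -/
def Veff (θs : Par p) : Matrix (Fin p) (Fin p) ℝ :=
  (M.H θs)⁻¹ * M.varPhiDot θs * (M.H θs)⁻¹

/-- Unconfoundedness, `Y(t) ⊥ T | X` for all `t ∈ 𝒯`, in terms of regular conditional
distributions: for almost every `(s, x)`, the law of `Y(t)` given `(T, X) = (s, x)` is the law of
`Y(t)` given `X = x`, for all `t ∈ 𝒯` simultaneously. For countable `𝒯` this is the same as
conditional independence for each `t` separately; for uncountable `𝒯` the exceptional null set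
is not allowed to depend on `t`. -/
def Unconfounded [StandardBorelSpace Ω₀] [Nonempty Ω₀] : Prop :=
  ∀ᵐ z ∂M.lawTX, ∀ t ∈ M.𝒯,
    (condDistrib (fun u : Ω₀ => u) M.TX M.law z).map (M.Y t)
      = (condDistrib (fun u : Ω₀ => u) M.X M.law z.2).map (M.Y t)

/-- Shape of the welfare: `Θ` is compact and convex, `W` is concave on `Θ` and twice differentiable
near the interior point `θ*`, which is its unique maximizer, and `H` is positive definite. -/
structure ConcaveUnique (θs : Par p) : Prop where
  isCompact : IsCompact M.Θ
  convex : Convex ℝ M.Θ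
  concave : ConcaveOn ℝ M.Θ M.welfare
  mem_interior : θs ∈ interior M.Θ
  twice_differentiable : ∀ᶠ θ in 𝓝 θs,
    DifferentiableAt ℝ M.welfare θ ∧ DifferentiableAt ℝ (fderiv ℝ M.welfare) θ
  unique_max : ∀ θ ∈ M.Θ, θ ≠ θs → M.welfare θ < M.welfare θs
  gradient_eq_zero : ∇ M.welfare θs = 0
  posDef : (M.H θs).PosDef

/-- Smoothness of the policy class: for almost every `(t, x)`, `θ ↦ π_θ(t | x)` is continuous on `Θ`
and differentiable on a neighbourhood of `θ*`, with uniformly bounded gradient; and the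
policy densities are uniformly bounded. -/
structure PolicySmooth (θs : Par p) : Prop where
  continuous : ∀ᵐ z ∂(M.ν.prod M.lawX), ContinuousOn (fun θ => M.pol θ z.1 z.2) M.Θ
  differentiable : ∃ N ∈ 𝓝 θs, ∃ C : ℝ, ∀ᵐ z ∂(M.ν.prod M.lawX), ∀ θ ∈ N,
    DifferentiableAt ℝ (fun θ' => M.pol θ' z.1 z.2) θ ∧ ‖M.dpol θ z.1 z.2‖ ≤ C
  bounded : ∃ C : ℝ, ∀ θ ∈ M.Θ, ∀ t ∈ M.𝒯, ∀ x ∈ M.𝒳, M.pol θ t x ≤ C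

/-- Potential outcomes are bounded, and the treatment density is bounded away from zero. -/
structure BoundedOutcomesOverlap : Prop where
  outcome_bounded : ∃ C : ℝ, ∀ t ∈ M.𝒯, ∀ u, |M.Y t u| ≤ C
  density_bounded_below : ∃ c : ℝ, 0 < c ∧ ∀ t ∈ M.𝒯, ∀ x ∈ M.𝒳, c ≤ M.f t x

end PolicyModel

/-- A cross-fitting scheme with `L` folds. For each sample size `n`, the indices are partitioned into
`L` folds, of equal size (up to one index, when `L` does not divide `n`), and for each fold `ℓ` there
are nuisance estimators, which are measurable functions of the observations outside the fold. -/
structure CrossFitting (d L : ℕ) where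
  /-- `fold n i` is the fold of the index `i` in the sample of size `n` -/
  fold : (n : ℕ) → Fin n → Fin L
  card_fold : ∀ (n : ℕ) (ℓ : Fin L),
    n / L ≤ (Finset.univ.filter fun i => fold n i = ℓ).card ∧
      (Finset.univ.filter fun i => fold n i = ℓ).card ≤ n / L + 1
  /-- the estimator of the weight `ω` for fold `ℓ`, a function of the training data -/
  ωhat : (n : ℕ) → (ℓ : Fin L) → ({i : Fin n // fold n i ≠ ℓ} → Obs d) → ℝ × Cov d → ℝ
  measurable_ωhat : ∀ n ℓ, Measurable (Function.uncurry (ωhat n ℓ))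
  /-- the estimator of the regression function `m` for fold `ℓ`, a function of the training data -/
  mhat : (n : ℕ) → (ℓ : Fin L) → ({i : Fin n // fold n i ≠ ℓ} → Obs d) → ℝ × Cov d → ℝ
  measurable_mhat : ∀ n ℓ, Measurable (Function.uncurry (mhat n ℓ))

namespace CrossFitting

variable {d L : ℕ} (A : CrossFitting d L)

/-- The training data of fold `ℓ`: the observations with index outside the fold. -/
def train {n : ℕ} (s : Fin n → Obs d) (ℓ : Fin L) : {i : Fin n // A.fold n i ≠ ℓ} → Obs d :=
  fun i => s i.1

/-- The weight estimator of fold `ℓ` on the sample `s`. -/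
def ωhatOn {n : ℕ} (s : Fin n → Obs d) (ℓ : Fin L) : ℝ × Cov d → ℝ := A.ωhat n ℓ (A.train s ℓ)

/-- The regression estimator of fold `ℓ` on the sample `s`. -/
def mhatOn {n : ℕ} (s : Fin n → Obs d) (ℓ : Fin L) : ℝ × Cov d → ℝ := A.mhat n ℓ (A.train s ℓ)

/-- The cross-fitted doubly robust welfare estimator
`(1/n) ∑_ℓ ∑_{i ∈ I_ℓ} (ω̂(T_i, X_i) π_θ(T_i | X_i) (Y_i - m̂(T_i, X_i)) + ∫ m̂(t, X_i) Π_θ(dt | X_i))`,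
where `ω̂` and `m̂` are the estimators of fold `ℓ`. -/
def drWelfare {p : ℕ} {Ω₀ : Type*} [MeasurableSpace Ω₀] (M : PolicyModel d p Ω₀) {n : ℕ}
    (s : Fin n → Obs d) (θ : Par p) : ℝ :=
  (1 / (n : ℝ)) * ∑ ℓ : Fin L, ∑ i ∈ Finset.univ.filter (fun i => A.fold n i = ℓ),
    (A.ωhatOn s ℓ (s i).2 * M.pol θ (s i).2.1 (s i).2.2 * ((s i).1 - A.mhatOn s ℓ (s i).2)
      + ∫ t, A.mhatOn s ℓ (t, (s i).2.2) ∂(M.policy θ (s i).2.2))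

end CrossFitting

/-- `R_n = o_P(a_n)`, for nonnegative (possibly infinite) `R_n` and positive numbers `a_n`. -/
def IsLittleOInProb {Ω : Type*} [MeasurableSpace Ω] (P : Measure Ω) (R : ℕ → Ω → ℝ≥0∞)
    (a : ℕ → ℝ) : Prop :=
  ∀ ε : ℝ, 0 < ε → Tendsto (fun n => P {w | ENNReal.ofReal (ε * a n) < R n w}) atTop (𝓝 0)

/-- The first `n` members of a sequence of random observations. -/
def sample {d : ℕ} {Ω : Type*} (Z : ℕ → Ω → Obs d) (n : ℕ) (w : Ω) : Fin n → Obs d :=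
  fun i => Z i w

/-- Conditions on the nuisance estimators: `‖ω̂ - ω‖_{L²(T,X)} = o_P(n^{-ρω})` and
`‖m̂ - m‖_{L²(T,X)} = o_P(n^{-ρm})` for some `ρω, ρm > 0` with `ρω + ρm ≥ 1/2`, for each fold;
and, with probability tending to one, `m̂` is bounded (by a constant). -/
structure NuisanceRates {d p L : ℕ} {Ω₀ Ω : Type*} [MeasurableSpace Ω₀] [MeasurableSpace Ω]
    (M : PolicyModel d p Ω₀) (A : CrossFitting d L) (P : Measure Ω) (Z : ℕ → Ω → Obs d) :
    Prop where
  rates : ∃ ρω ρm : ℝ, 0 < ρω ∧ 0 < ρm ∧ 1 / 2 ≤ ρω + ρm ∧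
    (∀ ℓ : Fin L, IsLittleOInProb P
      (fun n w => eLpNorm (fun z => A.ωhatOn (sample Z n w) ℓ z - M.ω z.1 z.2) 2 M.lawTX)
      (fun n => (n : ℝ) ^ (-ρω))) ∧
    (∀ ℓ : Fin L, IsLittleOInProb P
      (fun n w => eLpNorm (fun z => A.mhatOn (sample Z n w) ℓ z - M.m z.1 z.2) 2 M.lawTX)
      (fun n => (n : ℝ) ^ (-ρm)))
  bounded : ∃ C : ℝ, ∀ ℓ : Fin L, Tendsto (fun n => P {w | ∃ t ∈ M.𝒯, ∃ x ∈ M.𝒳,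
    C < |A.mhatOn (sample Z n w) ℓ (t, x)|}) atTop (𝓝 0)

end

/-!
The doubly robust criterion is asymptotically equivalent to the quadratic `⟪S_n, h⟫ - ⟪H h, h⟫ / 2` in
the local parameter `h = √n (θ - θ*)`, where `S_n` is the normalized sum of the influence functions
`φ̇(Z_i)`. Its maximizer is therefore `√n (θ̂ - θ*) = H⁻¹ S_n + o_P(1)`, which is asymptotically
`N(0, V_eff)` by the central limit theorem, and the regret is half the quadratic form of `H` at this
vector, by the second-order expansion of the welfare.

Write `score w q b` for the doubly robust score with weight `w`, regression function `q` and policy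
density `b`. The mean of the score with estimated nuisance functions is that with the true ones, up to
the product of the two estimation errors (`PolicyModel.Regular.integral_score`,
`PolicyModel.Regular.abs_integral_remainder_le`), and the product rate `ρω + ρm ≥ 1/2` makes this bias
negligible at scale `1 / √n`. What remains is the empirical process of the remainders
`score w q (π_θ - π_θ*) - ⟪φ̇, θ - θ*⟫`, which has to be `o_P(‖θ - θ*‖ / √n)` uniformly near `θ*`
(`StochDiff`, `CrossFitting.stochDiff_drWelfare`). Conditionally on the training data of a fold it is
a normalized sum of i.i.d. variables that is Lipschitz in `θ` and has small second moments
at each fixed direction (`PolicyModel.Regular.integral_scoreCtr_sq_le`), so that a chaining argument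
with moments of order `2p + 2` gives the uniform bound (`exists_chaining_bound`,
`PolicyModel.Regular.exists_fold_bound`).

The weight estimator is consistent in `L²` only, and need not be bounded, whereas the high moments of
the increments have to exist. The estimator is therefore replaced by the truth at all points at which
its error exceeds `√n`: a normalized sum tolerates summands of size `√n`
(`lintegral_pow_sum_pi_le`), and by Chebyshev's inequality, with probability tending to one, the error
at no observation exceeds `√n` (`CrossFitting.tendsto_measure_drWelfare_ne`). After truncation, the
bounds on the nuisance errors hold for every realization of the training data.

Consistency of the estimator comes from uniform consistency of the criterion
(`CrossFitting.tendsto_measure_drWelfare_sub`) and concavity of the welfare; a peeling argument gives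
the rate `√n` (`QuadraticMax.rate`), and comparison with the maximizer of the quadratic gives
asymptotic linearity (`QuadraticMax.asymptotically_linear`).
-/

noncomputable section

/-! ### Moments of normalized sums of independent bounded variables -/

/-- A normalized sum of independent centred variables that are bounded by `r * a`, have second
moment at most `a ^ 2` and are at most `r ^ 2` in number has a bounded exponential moment at scale
`a`. Typically `r = √n`: boundedness by a multiple of `√n` is all that is needed. -/
lemma integral_exp_sum_pi_le {ι 𝒵 : Type*} [Fintype ι] [MeasurableSpace 𝒵] (μ : Measure 𝒵)
    [IsProbabilityMeasure μ] {ξ : 𝒵 → ℝ} (hξ : AEStronglyMeasurable ξ μ) {a r : ℝ} (ha : 0 < a)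
    (hr : 0 < r) (hb : ∀ᵐ z ∂μ, |ξ z| ≤ r * a) (h0 : ∫ z, ξ z ∂μ = 0)
    (h2 : ∫ z, ξ z ^ 2 ∂μ ≤ a ^ 2) (hcard : (Fintype.card ι : ℝ) ≤ r ^ 2) :
    Integrable (fun s : ι → 𝒵 => Real.exp (∑ i, ξ (s i) / (r * a))) (Measure.pi fun _ => μ) ∧
    ∫ s : ι → 𝒵, Real.exp (∑ i, ξ (s i) / (r * a)) ∂(Measure.pi fun _ => μ) ≤ Real.exp 1 := by
  have hra : 0 < r * a := mul_pos hr ha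
  have hyb : ∀ᵐ z ∂μ, |ξ z / (r * a)| ≤ 1 := by
    filter_upwards [hb] with z hz
    rw [abs_div, abs_of_pos hra, div_le_one hra]
    exact hz
  have hexpint : Integrable (fun z => Real.exp (ξ z / (r * a))) μ := by
    refine Integrable.of_bound
      (Real.continuous_exp.comp_aestronglyMeasurable ((hξ.aemeasurable.div_const _).aestronglyMeasurable))
      (Real.exp 1) ?_
    filter_upwards [hyb] with z hz
    rw [Real.norm_eq_abs, Real.abs_exp]
    exact Real.exp_le_exp.2 (le_of_abs_le hz)
  have hint : Integrable ξ μ := Integrable.of_bound hξ (r * a) (by simpa using hb)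
  have hint2 : Integrable (fun z => ξ z ^ 2) μ := by
    refine Integrable.of_bound (hξ.pow 2) ((r * a) ^ 2) ?_
    filter_upwards [hb] with z hz
    rw [norm_pow, Real.norm_eq_abs]
    exact pow_le_pow_left₀ (abs_nonneg _) hz 2
  have hi1 : Integrable (fun z => 1 + ξ z / (r * a)) μ := (integrable_const 1).add (hint.div_const _)
  have hone : ∫ z, Real.exp (ξ z / (r * a)) ∂μ ≤ Real.exp (1 / r ^ 2) := by
    -- `exp y ≤ 1 + y + y ^ 2` for `|y| ≤ 1`, and the linear term has mean zero
    have h1 : ∫ z, Real.exp (ξ z / (r * a)) ∂μ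
        ≤ ∫ z, (1 + ξ z / (r * a) + ξ z ^ 2 / (r * a) ^ 2) ∂μ := by
      refine integral_mono_ae hexpint (hi1.add (hint2.div_const _)) ?_
      filter_upwards [hyb] with z hz
      have := le_of_abs_le (Real.abs_exp_sub_one_sub_id_le hz)
      rw [div_pow] at this
      linarith
    have h3 : ∫ z, (1 + ξ z / (r * a) + ξ z ^ 2 / (r * a) ^ 2) ∂μ
        = 1 + (∫ z, ξ z ^ 2 ∂μ) / (r * a) ^ 2 := by
      rw [integral_add hi1 (hint2.div_const _),
        integral_add (integrable_const 1) (hint.div_const _), integral_div, integral_div, h0]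
      simp
    have h4 : (∫ z, ξ z ^ 2 ∂μ) / (r * a) ^ 2 ≤ 1 / r ^ 2 := by
      rw [mul_pow, div_le_div_iff₀ (by positivity) (by positivity)]
      nlinarith [sq_nonneg r]
    have h5 := Real.add_one_le_exp (1 / r ^ 2)
    linarith
  have hprod : (fun s : ι → 𝒵 => Real.exp (∑ i, ξ (s i) / (r * a)))
      = fun s => ∏ i, Real.exp (ξ (s i) / (r * a)) := by
    funext s
    rw [Real.exp_sum]
  rw [hprod]
  constructor
  · exact Integrable.fintype_prod (f := fun _ z => Real.exp (ξ z / (r * a))) fun _ => hexpint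
  · rw [integral_fintype_prod_eq_prod (fun _ z => Real.exp (ξ z / (r * a)))]
    calc ∏ _i : ι, ∫ z, Real.exp (ξ z / (r * a)) ∂μ
        ≤ ∏ _i : ι, Real.exp (1 / r ^ 2) :=
          Finset.prod_le_prod (fun _ _ => integral_nonneg fun _ => (Real.exp_pos _).le)
            fun _ _ => hone
      _ = Real.exp ((Fintype.card ι : ℝ) * (1 / r ^ 2)) := by
          rw [Finset.prod_const, Real.exp_nat_mul, Finset.card_univ]
      _ ≤ Real.exp 1 := by
          apply Real.exp_le_exp.2
          rw [mul_one_div, div_le_one (by positivity)]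
          exact hcard

/-- Even moments of a normalized sum at scale `a`, from its exponential moments. -/
lemma lintegral_pow_sum_pi_le {ι 𝒵 : Type*} [Fintype ι] [MeasurableSpace 𝒵] (μ : Measure 𝒵)
    [IsProbabilityMeasure μ] {ξ : 𝒵 → ℝ} (hξ : AEStronglyMeasurable ξ μ) {a r : ℝ} (ha : 0 < a)
    (hr : 0 < r) (hb : ∀ᵐ z ∂μ, |ξ z| ≤ r * a) (h0 : ∫ z, ξ z ∂μ = 0)
    (h2 : ∫ z, ξ z ^ 2 ∂μ ≤ a ^ 2) (hcard : (Fintype.card ι : ℝ) ≤ r ^ 2) {q : ℕ} (hq : Even q) :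
    ∫⁻ s : ι → 𝒵, ENNReal.ofReal ((r⁻¹ * ∑ i, ξ (s i)) ^ q) ∂(Measure.pi fun _ => μ)
      ≤ ENNReal.ofReal (2 * Real.exp 1 * q.factorial * a ^ q) := by
  obtain ⟨hi1, hl1⟩ := integral_exp_sum_pi_le (ι := ι) μ hξ ha hr hb h0 h2 hcard
  obtain ⟨hi2, hl2⟩ := integral_exp_sum_pi_le (ι := ι) μ (ξ := fun z => -ξ z) hξ.neg ha hr
    (by simpa using hb) (by rw [integral_neg, h0, neg_zero]) (by simpa using h2) hcard
  set c : ℝ := q.factorial * a ^ q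
  have hc : 0 ≤ c := by positivity
  have hpt : ∀ s : ι → 𝒵, (r⁻¹ * ∑ i, ξ (s i)) ^ q
      ≤ c * (Real.exp (∑ i, ξ (s i) / (r * a)) + Real.exp (∑ i, -ξ (s i) / (r * a))) := by
    intro s
    set x := r⁻¹ * ∑ i, ξ (s i)
    have e1 : ∑ i, ξ (s i) / (r * a) = x / a := by
      rw [← Finset.sum_div]; simp only [x]; field_simp
    have e2 : ∑ i, -ξ (s i) / (r * a) = -(x / a) := by
      rw [← e1, ← Finset.sum_neg_distrib]; exact Finset.sum_congr rfl fun _ _ => neg_div _ _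
    rw [e1, e2, ← hq.pow_abs x]
    have h3 := Real.pow_div_factorial_le_exp (|x| / a) (by positivity) q
    have h4 : Real.exp (|x| / a) ≤ Real.exp (x / a) + Real.exp (-(x / a)) := by
      rcases abs_cases x with ⟨h, _⟩ | ⟨h, _⟩
      · rw [h]; linarith [Real.exp_pos (-(x / a))]
      · rw [h, neg_div]; linarith [Real.exp_pos (x / a)]
    have h5 : |x| ^ q = c * ((|x| / a) ^ q / q.factorial) := by
      simp only [c]
      rw [div_pow]
      field_simp
    rw [h5]
    exact mul_le_mul_of_nonneg_left (h3.trans h4) hc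
  calc ∫⁻ s : ι → 𝒵, ENNReal.ofReal ((r⁻¹ * ∑ i, ξ (s i)) ^ q) ∂(Measure.pi fun _ => μ)
      ≤ ∫⁻ s : ι → 𝒵, ENNReal.ofReal
          (c * (Real.exp (∑ i, ξ (s i) / (r * a)) + Real.exp (∑ i, -ξ (s i) / (r * a))))
          ∂(Measure.pi fun _ => μ) := lintegral_mono fun s => ENNReal.ofReal_le_ofReal (hpt s)
    _ = ENNReal.ofReal (∫ s : ι → 𝒵,
          (c * (Real.exp (∑ i, ξ (s i) / (r * a)) + Real.exp (∑ i, -ξ (s i) / (r * a))))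
          ∂(Measure.pi fun _ => μ)) := by
        have hi3 : Integrable (fun s : ι → 𝒵 => c * (Real.exp (∑ i, ξ (s i) / (r * a))
            + Real.exp (∑ i, -ξ (s i) / (r * a)))) (Measure.pi fun _ => μ) :=
          (hi1.add hi2).const_mul c
        rw [ofReal_integral_eq_lintegral_ofReal hi3]
        exact Eventually.of_forall fun s => by positivity
    _ ≤ _ := by
        apply ENNReal.ofReal_le_ofReal
        rw [integral_const_mul, integral_add hi1 hi2]
        have : c * (∫ s : ι → 𝒵, Real.exp (∑ i, ξ (s i) / (r * a)) ∂(Measure.pi fun _ => μ)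
          + ∫ s : ι → 𝒵, Real.exp (∑ i, -ξ (s i) / (r * a)) ∂(Measure.pi fun _ => μ))
            ≤ c * (Real.exp 1 + Real.exp 1) := mul_le_mul_of_nonneg_left (add_le_add hl1 hl2) hc
        refine this.trans (le_of_eq ?_)
        simp only [c]; ring

lemma lintegral_sq_sum_pi_le {ι 𝒵 : Type*} [Fintype ι] [MeasurableSpace 𝒵] (μ : Measure 𝒵)
    [IsProbabilityMeasure μ] {ξ : 𝒵 → ℝ} (hξ : MemLp ξ 2 μ) {v r : ℝ} (hr : 0 < r)
    (h0 : ∫ z, ξ z ∂μ = 0) (h2 : ∫ z, ξ z ^ 2 ∂μ ≤ v) (hcard : (Fintype.card ι : ℝ) ≤ r ^ 2) :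
    ∫⁻ s : ι → 𝒵, ENNReal.ofReal ((r⁻¹ * ∑ i, ξ (s i)) ^ 2) ∂(Measure.pi fun _ => μ)
      ≤ ENNReal.ofReal v := by
  have hmem : ∀ i : ι, MemLp (fun s : ι → 𝒵 => ξ (s i)) 2 (Measure.pi fun _ => μ) := fun i =>
    hξ.comp_measurePreserving (measurePreserving_eval (fun _ : ι => μ) i)
  have hsum : MemLp (∑ i, fun s : ι → 𝒵 => ξ (s i)) 2 (Measure.pi fun _ => μ) :=
    memLp_finsetSum' _ fun i _ => hmem i
  have hmean : ∫ s : ι → 𝒵, (∑ i, fun s : ι → 𝒵 => ξ (s i)) s ∂(Measure.pi fun _ => μ) = 0 := by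
    simp only [Finset.sum_apply]
    rw [integral_finsetSum _ fun i _ => (hmem i).integrable one_le_two]
    refine Finset.sum_eq_zero fun i _ => ?_
    have := integral_comp_eval (μ := fun _ : ι => μ) (i := i) hξ.1
    rw [this, h0]
  have hvar := variance_sum_pi (ι := ι) (μ := fun _ => μ) (X := fun _ => ξ) fun _ => hξ
  rw [variance_of_integral_eq_zero hsum.1.aemeasurable hmean] at hvar
  rw [variance_of_integral_eq_zero hξ.1.aemeasurable h0] at hvar
  have hint : Integrable (fun s : ι → 𝒵 => (r⁻¹ * ∑ i, ξ (s i)) ^ 2) (Measure.pi fun _ => μ) := by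
    have := (hsum.const_mul r⁻¹).integrable_sq
    simpa only [Finset.sum_apply] using this
  rw [← ofReal_integral_eq_lintegral_ofReal hint (Eventually.of_forall fun s => by positivity)]
  apply ENNReal.ofReal_le_ofReal
  have h3 : ∫ s : ι → 𝒵, (r⁻¹ * ∑ i, ξ (s i)) ^ 2 ∂(Measure.pi fun _ => μ)
      = r⁻¹ ^ 2 * ((Fintype.card ι : ℝ) * ∫ z, ξ z ^ 2 ∂μ) := by
    simp_rw [mul_pow]
    rw [integral_const_mul]
    simp only [Finset.sum_apply, Finset.sum_const, Finset.card_univ, nsmul_eq_mul] at hvar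
    rw [hvar]
  rw [h3]
  have h4 : 0 ≤ ∫ z, ξ z ^ 2 ∂μ := integral_nonneg fun _ => sq_nonneg _
  calc r⁻¹ ^ 2 * ((Fintype.card ι : ℝ) * ∫ z, ξ z ^ 2 ∂μ)
      ≤ r⁻¹ ^ 2 * (r ^ 2 * ∫ z, ξ z ^ 2 ∂μ) := by gcongr
    _ = ∫ z, ξ z ^ 2 ∂μ := by field_simp
    _ ≤ v := h2

/-- A bound on conditional expectations given an independent variable `D` integrates to a bound on
the expectation. -/
lemma lintegral_le_of_indep {Ω 𝒟 𝒮 : Type*} [MeasurableSpace Ω] [MeasurableSpace 𝒟]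
    [MeasurableSpace 𝒮] {P : Measure Ω} [IsProbabilityMeasure P] {D : Ω → 𝒟} {S : Ω → 𝒮}
    (hD : Measurable D) (hS : Measurable S) (hDS : IndepFun D S P) {F : 𝒟 → 𝒮 → ℝ≥0∞}
    (hF : Measurable (Function.uncurry F)) {c : ℝ≥0∞} (hc : ∀ x, ∫⁻ s, F x s ∂(P.map S) ≤ c) :
    ∫⁻ w, F (D w) (S w) ∂P ≤ c := by
  have h := (indepFun_iff_map_prod_eq_prod_map_map hD.aemeasurable hS.aemeasurable).1 hDS
  have : IsProbabilityMeasure (P.map D) := Measure.isProbabilityMeasure_map hD.aemeasurable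
  have : IsProbabilityMeasure (P.map S) := Measure.isProbabilityMeasure_map hS.aemeasurable
  calc ∫⁻ w, F (D w) (S w) ∂P
      = ∫⁻ x, Function.uncurry F x ∂(P.map fun w => (D w, S w)) := by
        rw [lintegral_map hF (hD.prodMk hS)]; rfl
    _ = ∫⁻ x, ∫⁻ s, F x s ∂(P.map S) ∂(P.map D) := by
        rw [h, lintegral_prod _ hF.aemeasurable]; rfl
    _ ≤ ∫⁻ _x, c ∂(P.map D) := lintegral_mono hc
    _ = c := by simp

/-! ### A chaining bound for processes indexed by a cube -/

/-- The multi-indices `k` of the points `k / 2 ^ j` of the dyadic grid in `[-1, 1]^p`. -/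
def dyadicIdx (p j : ℕ) : Finset (Fin p → ℤ) :=
  Fintype.piFinset fun _ => Finset.Icc (-(2 ^ j : ℤ)) (2 ^ j)

/-- The grid point `k / 2 ^ j`. -/
def dyadicPt {p : ℕ} (j : ℕ) (k : Fin p → ℤ) : Fin p → ℝ := fun i => (k i : ℝ) / 2 ^ j

/-- The multi-index of the grid point of level `j` that is below the grid point of level `j + 1`
with multi-index `k`. -/
def dyadicParent {p : ℕ} (k : Fin p → ℤ) : Fin p → ℤ := fun i => k i / 2

lemma norm_dyadicPt_le {p j : ℕ} {k : Fin p → ℤ} (hk : k ∈ dyadicIdx p j) :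
    ‖dyadicPt j k‖ ≤ 1 := by
  refine (pi_norm_le_iff_of_nonneg zero_le_one).2 fun i => ?_
  have h := Fintype.mem_piFinset.1 hk i
  rw [Finset.mem_Icc] at h
  have h1 : (-(2 ^ j : ℝ)) ≤ k i := by exact_mod_cast h.1
  have h2 : (k i : ℝ) ≤ 2 ^ j := by exact_mod_cast h.2
  rw [dyadicPt, norm_div, Real.norm_eq_abs, norm_pow, Real.norm_two, div_le_one (by positivity)]
  exact abs_le.2 ⟨h1, h2⟩

lemma card_dyadicIdx_le (p j : ℕ) : ((dyadicIdx p j).card : ℝ) ≤ (3 * 2 ^ j) ^ p := by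
  rw [dyadicIdx, Fintype.card_piFinset]
  simp only [Int.card_Icc, Finset.prod_const, Finset.card_univ, Fintype.card_fin]
  push_cast
  have h1 : (2 ^ j + 1 - -(2 ^ j : ℤ)).toNat = 2 * 2 ^ j + 1 := by
    have : (2 ^ j + 1 - -(2 ^ j : ℤ)) = ((2 * 2 ^ j + 1 : ℕ) : ℤ) := by push_cast; ring
    rw [this, Int.toNat_natCast]
  rw [h1]
  push_cast
  have : (1 : ℝ) ≤ 2 ^ j := one_le_pow₀ one_le_two
  gcongr
  linarith

lemma dyadicParent_mem {p j : ℕ} {k : Fin p → ℤ} (hk : k ∈ dyadicIdx p (j + 1)) :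
    dyadicParent k ∈ dyadicIdx p j := by
  refine Fintype.mem_piFinset.2 fun i => ?_
  have h := Fintype.mem_piFinset.1 hk i
  rw [Finset.mem_Icc, pow_succ] at h
  rw [Finset.mem_Icc, dyadicParent]
  generalize (2 : ℤ) ^ j = c at *
  omega

lemma norm_dyadicPt_sub_parent_le {p j : ℕ} (k : Fin p → ℤ) :
    ‖dyadicPt (j + 1) k - dyadicPt j (dyadicParent k)‖ ≤ (1 / 2) ^ (j + 1) := by
  refine (pi_norm_le_iff_of_nonneg (by positivity)).2 fun i => ?_
  have h1 : k i = 2 * (k i / 2) + k i % 2 := (Int.mul_ediv_add_emod _ _).symm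
  have h2 : (dyadicPt (j + 1) k - dyadicPt j (dyadicParent k)) i
      = ((k i % 2 : ℤ) : ℝ) * (1 / 2) ^ (j + 1) := by
    have h3 : (k i : ℝ) = 2 * ((k i / 2 : ℤ) : ℝ) + ((k i % 2 : ℤ) : ℝ) := by exact_mod_cast h1
    simp only [dyadicPt, dyadicParent, Pi.sub_apply]
    rw [h3, pow_succ, one_div, inv_pow, pow_succ]
    field_simp
    ring
  rw [h2, norm_mul, Real.norm_of_nonneg (by positivity : (0:ℝ) ≤ (1 / 2) ^ (j + 1))]
  have h4 : |((k i % 2 : ℤ) : ℝ)| ≤ 1 := by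
    have h5 := Int.emod_nonneg (k i) (two_ne_zero)
    have h6 := Int.emod_lt_of_pos (k i) two_pos
    rw [← Int.cast_abs]
    exact_mod_cast (by rw [abs_of_nonneg h5]; omega : |k i % 2| ≤ 1)
  rw [Real.norm_eq_abs]
  exact mul_le_of_le_one_left (by positivity) h4

/-- The multi-index of the grid point of level `j` below `u`. -/
def dyadicFloor {p : ℕ} (j : ℕ) (u : Fin p → ℝ) : Fin p → ℤ := fun i => ⌊2 ^ j * u i⌋

lemma dyadicFloor_mem {p : ℕ} (j : ℕ) {u : Fin p → ℝ} (hu : ‖u‖ ≤ 1) :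
    dyadicFloor j u ∈ dyadicIdx p j := by
  refine Fintype.mem_piFinset.2 fun i => ?_
  have h := abs_le.1 ((norm_le_pi_norm u i).trans hu)
  have hj : (0 : ℝ) < 2 ^ j := by positivity
  rw [Finset.mem_Icc, dyadicFloor]
  constructor
  · rw [Int.le_floor]; push_cast; nlinarith
  · have : ((⌊2 ^ j * u i⌋ : ℤ) : ℝ) ≤ 2 ^ j := (Int.floor_le _).trans (by nlinarith)
    exact_mod_cast this

lemma dyadicParent_floor {p : ℕ} (j : ℕ) (u : Fin p → ℝ) :
    dyadicParent (dyadicFloor (j + 1) u) = dyadicFloor j u := by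
  funext i
  simp only [dyadicParent, dyadicFloor]
  have h := Int.floor_div_natCast (2 ^ (j + 1) * u i) 2
  have h2 : 2 ^ (j + 1) * u i / ((2 : ℕ) : ℝ) = 2 ^ j * u i := by
    rw [pow_succ]; push_cast; ring
  rw [h2] at h
  rw [h]; rfl

lemma tendsto_dyadicPt_floor {p : ℕ} (u : Fin p → ℝ) :
    Tendsto (fun j => dyadicPt j (dyadicFloor j u)) atTop (𝓝 u) := by
  refine tendsto_pi_nhds.2 fun i => ?_
  have h0 : Tendsto (fun j : ℕ => u i - (1 / 2 : ℝ) ^ j) atTop (𝓝 (u i)) := by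
    simpa using tendsto_const_nhds.sub
      (tendsto_pow_atTop_nhds_zero_of_lt_one (by norm_num : (0:ℝ) ≤ 1 / 2) (by norm_num))
  refine tendsto_of_tendsto_of_tendsto_of_le_of_le h0 tendsto_const_nhds (fun j => ?_) fun j => ?_
  · simp only [dyadicPt, dyadicFloor]
    have := Int.lt_floor_add_one (2 ^ j * u i)
    have hj : (0 : ℝ) < 2 ^ j := by positivity
    rw [le_div_iff₀ hj, one_div, inv_pow, sub_mul, inv_mul_cancel₀ hj.ne']
    linarith
  · simp only [dyadicPt, dyadicFloor]
    have := Int.floor_le (2 ^ j * u i)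
    rw [div_le_iff₀ (by positivity)]
    linarith

lemma le_add_pow_div {q : ℕ} {b c : ℝ} (hb : 0 ≤ b) (hc : 0 < c) :
    b ≤ c + b ^ (q + 1) / c ^ q := by
  rcases le_total b c with h | h
  · exact h.trans (le_add_of_nonneg_right (by positivity))
  · have : b ≤ b ^ (q + 1) / c ^ q := by
      rw [le_div_iff₀ (by positivity), pow_succ, mul_comm]
      gcongr
    linarith

/-- **Chaining.** A process on `[-1, 1]^p` with continuous paths, whose increments have moments of
order `2 p + 2` bounded by those of a Lipschitz process with constant `K`, has a measurable upper
bound `S` whose expectation is at most the sum of the absolute first moments on the dyadic grid of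
level `J`, plus a multiple of `K (3/4) ^ J`.

The grid of level `j` has of order `2 ^ (j p)` points, and a union bound over increments of size `2 ^ (-j)`
needs moments of order above `p`; the order `2 p + 2` is even, and leaves room for the thresholds
`K (3/4) ^ j`. -/
lemma exists_chaining_bound {p : ℕ} {Ω : Type*} [MeasurableSpace Ω] {P : Measure Ω}
    [IsProbabilityMeasure P] {X : (Fin p → ℝ) → Ω → ℝ} (hX : ∀ u, ‖u‖ ≤ 1 → AEMeasurable (X u) P)
    (hcont : ∀ᵐ w ∂P, ContinuousOn (fun u => X u w) {u | ‖u‖ ≤ 1}) {K C : ℝ} (hK : 0 < K)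
    (hC : 0 ≤ C)
    (hmom : ∀ u v, ‖u‖ ≤ 1 → ‖v‖ ≤ 1 → ∀ b : ℝ, 0 < b → ‖u - v‖ ≤ b →
      ∫⁻ w, ENNReal.ofReal ((X u w - X v w) ^ (2 * p + 2)) ∂P
        ≤ ENNReal.ofReal (C * (K * b) ^ (2 * p + 2)))
    (J : ℕ) :
    ∃ S : Ω → ℝ≥0∞, AEMeasurable S P ∧
      (∀ᵐ w ∂P, ∀ u, ‖u‖ ≤ 1 → ENNReal.ofReal |X u w| ≤ S w) ∧
      ∫⁻ w, S w ∂P ≤ ∑ k ∈ dyadicIdx p J, ∫⁻ w, ENNReal.ofReal |X (dyadicPt J k) w| ∂P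
        + ENNReal.ofReal (4 * (1 + 6 ^ p * C) * K * (3 / 4) ^ J) := by
  -- the increments of level `j` exceed `lam j` only on events that the moments control
  set lam : ℕ → ℝ := fun j => K * (3 / 4) ^ j with hlam
  have hlam0 : ∀ j, 0 < lam j := fun j => by positivity
  set inc : ℕ → (Fin p → ℤ) → Ω → ℝ := fun j k w =>
    X (dyadicPt (j + 1) k) w - X (dyadicPt j (dyadicParent k)) w with hinc
  set E : ℕ → Ω → ℝ≥0∞ := fun j w => ENNReal.ofReal (lam j) + ∑ k ∈ dyadicIdx p (j + 1),
    ENNReal.ofReal (inc j k w ^ (2 * p + 2)) * ENNReal.ofReal (1 / lam j ^ (2 * p + 1)) with hE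
  have hincm : ∀ j, ∀ k ∈ dyadicIdx p (j + 1), AEMeasurable (inc j k) P := fun j k hk =>
    (hX _ (norm_dyadicPt_le hk)).sub (hX _ (norm_dyadicPt_le (dyadicParent_mem hk)))
  have hEm : ∀ j, AEMeasurable (E j) P := by
    intro j
    refine (aemeasurable_const (b := ENNReal.ofReal (lam j))).add (Finset.aemeasurable_fun_sum _ fun k hk => ?_)
    exact ((hincm j k hk).pow_const _).ennreal_ofReal.mul_const _
  have hEle : ∀ j w, ∀ k ∈ dyadicIdx p (j + 1), ENNReal.ofReal |inc j k w| ≤ E j w := by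
    intro j w k hk
    have h1 := le_add_pow_div (q := 2 * p + 1) (abs_nonneg (inc j k w)) (hlam0 j)
    have hev : Even (2 * p + 1 + 1) := ⟨p + 1, by ring⟩
    rw [hev.pow_abs] at h1
    refine (ENNReal.ofReal_le_ofReal h1).trans ?_
    rw [ENNReal.ofReal_add (hlam0 j).le (div_nonneg (hev.pow_nonneg _) (pow_pos (hlam0 j) _).le),
      div_eq_mul_one_div, ENNReal.ofReal_mul (hev.pow_nonneg _)]
    simp only [hE]
    gcongr
    exact Finset.single_le_sum (f := fun k => ENNReal.ofReal (inc j k w ^ (2 * p + 2)) *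
      ENNReal.ofReal (1 / lam j ^ (2 * p + 1))) (fun _ _ => zero_le) hk
  have hEint : ∀ j, ∫⁻ w, E j w ∂P ≤ ENNReal.ofReal ((1 + 6 ^ p * C) * lam j) := by
    intro j
    simp only [hE]
    rw [lintegral_add_left' aemeasurable_const, lintegral_const, measure_univ, mul_one,
      lintegral_finsetSum' _ fun k hk => ((hincm j k hk).pow_const _).ennreal_ofReal.mul_const _]
    have h1 : ∀ k ∈ dyadicIdx p (j + 1),
        ∫⁻ w, ENNReal.ofReal (inc j k w ^ (2 * p + 2)) * ENNReal.ofReal (1 / lam j ^ (2 * p + 1)) ∂P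
        ≤ ENNReal.ofReal (C * (K * (1 / 2) ^ (j + 1)) ^ (2 * p + 2) * (1 / lam j ^ (2 * p + 1))) := by
      intro k hk
      rw [lintegral_mul_const'' _ ((hincm j k hk).pow_const _).ennreal_ofReal,
        ENNReal.ofReal_mul (by positivity)]
      gcongr
      exact hmom _ _ (norm_dyadicPt_le hk) (norm_dyadicPt_le (dyadicParent_mem hk)) _
        (by positivity) (norm_dyadicPt_sub_parent_le k)
    refine (add_le_add le_rfl (Finset.sum_le_sum h1)).trans ?_
    rw [Finset.sum_const, nsmul_eq_mul, ← ENNReal.ofReal_natCast,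
      ← ENNReal.ofReal_mul (Nat.cast_nonneg _), ← ENNReal.ofReal_add (hlam0 j).le (by positivity)]
    apply ENNReal.ofReal_le_ofReal
    have h2 : C * (K * (1 / 2) ^ (j + 1)) ^ (2 * p + 2) * (1 / lam j ^ (2 * p + 1))
        = C * lam j * ((2 / 3) ^ j * (1 / 2)) ^ (2 * p + 2) := by
      have e1 : K * (1 / 2 : ℝ) ^ (j + 1) = lam j * ((2 / 3) ^ j * (1 / 2)) := by
        simp only [hlam]
        rw [pow_succ, show (1 / 2 : ℝ) = 3 / 4 * (2 / 3) by norm_num, mul_pow]; ring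
      rw [e1, mul_pow (lam j)]
      have := (hlam0 j).ne'
      field_simp
      ring
    -- against `(3 * 2 ^ (j + 1)) ^ p` grid points, since `2 * 4 / 9 ≤ 1`
    have h3 : ((2 / 3 : ℝ) ^ j * (1 / 2)) ^ (2 * p + 2) ≤ ((4 / 9) ^ j) ^ p := by
      have e1 : ((2 / 3 : ℝ) ^ j * (1 / 2)) ^ (2 * p + 2)
          = ((4 / 9) ^ j) ^ p * (((1 / 4) ^ p) * ((4 / 9) ^ j * (1 / 4))) := by
        rw [show 2 * p + 2 = 2 * (p + 1) by ring, pow_mul, mul_pow, ← pow_mul, mul_comm j 2, pow_mul,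
          pow_succ, mul_pow]
        norm_num
        ring
      rw [e1]
      refine mul_le_of_le_one_right (by positivity) ?_
      have e2 : (1 / 4 : ℝ) ^ p ≤ 1 := pow_le_one₀ (by norm_num) (by norm_num)
      have e3 : (4 / 9 : ℝ) ^ j ≤ 1 := pow_le_one₀ (by norm_num) (by norm_num)
      have e4 : 0 ≤ (4 / 9 : ℝ) ^ j := by positivity
      have e5 : (4 / 9 : ℝ) ^ j * (1 / 4) ≤ 1 := by linarith
      exact mul_le_one₀ e2 (by positivity) e5
    have h4 : (3 * 2 ^ (j + 1) : ℝ) ^ p * ((4 / 9) ^ j) ^ p ≤ 6 ^ p := by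
      rw [← mul_pow]
      apply pow_le_pow_left₀ (by positivity)
      have e1 : (3 * 2 ^ (j + 1) : ℝ) * (4 / 9) ^ j = 6 * (8 / 9) ^ j := by
        rw [show (8 / 9 : ℝ) = 2 * (4 / 9) by norm_num, mul_pow]; ring
      rw [e1]
      have e3 : (8 / 9 : ℝ) ^ j ≤ 1 := pow_le_one₀ (by norm_num) (by norm_num)
      linarith
    rw [h2]
    have h5 : ((dyadicIdx p (j + 1)).card : ℝ) * ((2 / 3 : ℝ) ^ j * (1 / 2)) ^ (2 * p + 2) ≤ 6 ^ p :=
      (mul_le_mul (card_dyadicIdx_le p (j + 1)) h3 (by positivity) (by positivity)).trans h4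
    have h6 : 0 ≤ C * lam j := mul_nonneg hC (hlam0 j).le
    nlinarith [mul_le_mul_of_nonneg_left h5 h6]
  have hXm : ∀ k ∈ dyadicIdx p J, AEMeasurable (fun w => ENNReal.ofReal |X (dyadicPt J k) w|) P :=
    fun k hk =>
      (continuous_abs.measurable.comp_aemeasurable (hX _ (norm_dyadicPt_le hk))).ennreal_ofReal
  refine ⟨fun w => ∑ k ∈ dyadicIdx p J, ENNReal.ofReal |X (dyadicPt J k) w| + ∑' j, E (J + j) w,
    ?_, ?_, ?_⟩
  · exact AEMeasurable.add (Finset.aemeasurable_fun_sum _ hXm) (AEMeasurable.tsum fun j => hEm _)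
  · filter_upwards [hcont] with w hw u hu
    -- the bound holds at the grid points below `u`, which converge to `u`
    have hN : ∀ N : ℕ, ENNReal.ofReal |X (dyadicPt (J + N) (dyadicFloor (J + N) u)) w|
        ≤ ∑ k ∈ dyadicIdx p J, ENNReal.ofReal |X (dyadicPt J k) w|
          + ∑ j ∈ Finset.range N, E (J + j) w := by
      intro N
      induction N with
      | zero =>
        simp only [add_zero, Finset.range_zero, Finset.sum_empty]
        exact Finset.single_le_sum (f := fun k => ENNReal.ofReal |X (dyadicPt J k) w|)
          (fun _ _ => zero_le) (dyadicFloor_mem J hu)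
      | succ N ih =>
        rw [Finset.sum_range_succ]
        have h1 := hEle (J + N) w _ (dyadicFloor_mem (J + N + 1) hu)
        simp only [hinc, dyadicParent_floor] at h1
        refine le_trans ?_ ((add_le_add ih h1).trans_eq (add_assoc _ _ _))
        rw [← ENNReal.ofReal_add (abs_nonneg _) (abs_nonneg _)]
        apply ENNReal.ofReal_le_ofReal
        have := abs_add_le (X (dyadicPt (J + N) (dyadicFloor (J + N) u)) w)
          (X (dyadicPt (J + N + 1) (dyadicFloor (J + N + 1) u)) w
            - X (dyadicPt (J + N) (dyadicFloor (J + N) u)) w)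
        rw [add_sub_cancel] at this
        exact this
    have hN' : ∀ N : ℕ, ENNReal.ofReal |X (dyadicPt (J + N) (dyadicFloor (J + N) u)) w|
        ≤ ∑ k ∈ dyadicIdx p J, ENNReal.ofReal |X (dyadicPt J k) w| + ∑' j, E (J + j) w :=
      fun N => (hN N).trans (add_le_add le_rfl (ENNReal.sum_le_tsum _))
    have hlim : Tendsto (fun N => dyadicPt (J + N) (dyadicFloor (J + N) u)) atTop (𝓝 u) :=
      (tendsto_dyadicPt_floor u).comp (tendsto_add_atTop_nat J |>.congr fun n => by ring)
    have hlim2 : Tendsto (fun N => dyadicPt (J + N) (dyadicFloor (J + N) u)) atTop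
        (𝓝[{u | ‖u‖ ≤ 1}] u) :=
      tendsto_nhdsWithin_iff.2 ⟨hlim, Eventually.of_forall fun N =>
        norm_dyadicPt_le (dyadicFloor_mem _ hu)⟩
    have hlim3 := (hw u hu).tendsto.comp hlim2
    exact le_of_tendsto (ENNReal.tendsto_ofReal hlim3.abs) (Eventually.of_forall hN')
  · rw [lintegral_add_right' _ (AEMeasurable.tsum fun j => hEm _),
      lintegral_finsetSum' _ hXm,
      lintegral_tsum fun j => hEm _]
    gcongr
    refine (ENNReal.tsum_le_tsum fun j => hEint (J + j)).trans ?_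
    have hs : HasSum (fun j => (1 + 6 ^ p * C) * lam (J + j))
        (4 * (1 + 6 ^ p * C) * K * (3 / 4) ^ J) := by
      have h1 := (hasSum_geometric_of_lt_one (by norm_num : (0:ℝ) ≤ 3 / 4) (by norm_num)).mul_left
        ((1 + 6 ^ p * C) * K * (3 / 4) ^ J)
      have e1 : (1 + 6 ^ p * C) * K * (3 / 4) ^ J * (1 - 3 / 4)⁻¹
          = 4 * (1 + 6 ^ p * C) * K * (3 / 4) ^ J := by norm_num; ring
      rw [e1] at h1
      refine h1.congr_fun fun j => ?_
      simp only [hlam, pow_add]; ring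
    rw [← ENNReal.ofReal_tsum_of_nonneg (fun j => mul_nonneg (by positivity) (hlam0 _).le)
      hs.summable, hs.tsum_eq]

/-! ### Limit theorems in finite dimension and in spaces of continuous functions -/

lemma identDistrib_comp_of_map_eq {Ω 𝒵 E : Type*} [MeasurableSpace Ω] [MeasurableSpace 𝒵]
    [MeasurableSpace E] {P : Measure Ω} {μ : Measure 𝒵} {Z : ℕ → Ω → 𝒵}
    (hZ : ∀ i, Measurable (Z i)) (hlaw : ∀ i, P.map (Z i) = μ) {g : 𝒵 → E} (hg : Measurable g)
    (i j : ℕ) : IdentDistrib (fun w => g (Z i w)) (fun w => g (Z j w)) P P := by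
  refine IdentDistrib.comp (u := g) ⟨(hZ i).aemeasurable, (hZ j).aemeasurable, ?_⟩ hg
  rw [hlaw i, hlaw j]

/-- The multivariate central limit theorem, by the Cramér-Wold device. -/
lemma tendstoInDistribution_multivariate {p : ℕ} {Ω 𝒵 : Type*} [MeasurableSpace Ω]
    [MeasurableSpace 𝒵] {P : Measure Ω} [IsProbabilityMeasure P] {μ : Measure 𝒵}
    {Z : ℕ → Ω → 𝒵} (hZ : ∀ i, Measurable (Z i)) (hind : iIndepFun Z P)
    (hlaw : ∀ i, P.map (Z i) = μ) {ψ : 𝒵 → Par p} (hψ : Measurable ψ) (hψ2 : MemLp ψ 2 μ)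
    (h0 : ∀ t : Par p, ∫ z, inner ℝ (ψ z) t ∂μ = 0) {V : Matrix (Fin p) (Fin p) ℝ}
    (hV : V.PosSemidef)
    (hvar : ∀ t : Par p, Var[fun z => inner ℝ (ψ z) t; μ] = t.ofLp ⬝ᵥ V *ᵥ t.ofLp) :
    TendstoInDistribution (fun (n : ℕ) w => (√(n : ℝ))⁻¹ • ∑ k ∈ Finset.range n, ψ (Z k w)) atTop
      (fun g : Par p => g) (fun _ => P) (multivariateGaussian 0 V) := by
  have hm : ∀ n : ℕ, Measurable
      (fun w => (√(n : ℝ))⁻¹ • ∑ k ∈ Finset.range n, ψ (Z k w)) := fun n =>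
    (Finset.measurable_fun_sum (Finset.range n) fun k _ => hψ.comp (hZ k)).const_smul (√(n : ℝ))⁻¹
  refine ⟨fun n => (hm n).aemeasurable, by fun_prop, ?_⟩
  refine ProbabilityMeasure.tendsto_iff_tendsto_charFun.2 fun t => ?_
  have hμ : IsProbabilityMeasure μ := by
    rw [← hlaw 0]; exact Measure.isProbabilityMeasure_map (hZ 0).aemeasurable
  have hgm : Measurable fun z => inner ℝ (ψ z) t := by fun_prop
  have hg2 : MemLp (fun z => inner ℝ (ψ z) t) 2 μ := hψ2.inner_const t
  have hX2 : MemLp (fun w => inner ℝ (ψ (Z 0 w)) t) 2 P := by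
    rw [← hlaw 0] at hg2
    exact hg2.comp_of_map (hZ 0).aemeasurable
  have hmean : ∫ w, inner ℝ (ψ (Z 0 w)) t ∂P = 0 := by
    rw [← h0 t, ← hlaw 0, integral_map (hZ 0).aemeasurable]
    exact hgm.aestronglyMeasurable
  have hvar0 : Var[fun w => inner ℝ (ψ (Z 0 w)) t; P] = t.ofLp ⬝ᵥ V *ᵥ t.ofLp := by
    rw [← hvar t, ← hlaw 0, variance_map (by fun_prop) (hZ 0).aemeasurable]
    rfl
  have hclt := tendstoInDistribution_inv_sqrt_mul_sum_sub (P := P)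
    (P' := gaussianReal 0 (t.ofLp ⬝ᵥ V *ᵥ t.ofLp).toNNReal)
    (X := fun k w => inner ℝ (ψ (Z k w)) t) (Y := id) (by rw [hvar0]; exact HasLaw.id) hX2
    (hind.comp (fun _ z => inner ℝ (ψ z) t) fun _ => hgm)
    (fun i => identDistrib_comp_of_map_eq hZ hlaw hgm i 0)
  have hc := ProbabilityMeasure.tendsto_iff_tendsto_charFun.1 hclt.tendsto 1
  have hnn : 0 ≤ t.ofLp ⬝ᵥ V *ᵥ t.ofLp := by rw [← hvar t]; exact variance_nonneg _ _
  convert! hc using 2 with n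
  · simp only [ProbabilityMeasure.coe_mk]
    rw [charFun_apply, charFun_apply, integral_map (hm n).aemeasurable (by fun_prop),
      integral_map (hclt.forall_aemeasurable n) (by fun_prop)]
    refine integral_congr_ae (Eventually.of_forall fun w => ?_)
    simp only
    rw [hmean]
    simp [inner_smul_left, sum_inner]
  · simp only [ProbabilityMeasure.coe_mk]
    rw [Measure.map_id', Measure.map_id, charFun_multivariateGaussian hV, charFun_gaussianReal]
    simp [Real.coe_toNNReal _ hnn]

open ContinuousMap in
/-- A uniform law of large numbers on a compact parameter space, as the strong law in a space of
continuous functions. -/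
lemma tendsto_average_continuousMap {Ω 𝒵 S : Type*} [MeasurableSpace Ω] [MeasurableSpace 𝒵]
    [TopologicalSpace S] [CompactSpace S] [SecondCountableTopology S] [T2Space S]
    {P : Measure Ω} [IsProbabilityMeasure P] {μ : Measure 𝒵} {Z : ℕ → Ω → 𝒵}
    (hZ : ∀ i, Measurable (Z i)) (hind : iIndepFun Z P) (hlaw : ∀ i, P.map (Z i) = μ)
    {Φ : 𝒵 → C(S, ℝ)} (hΦ : ∀ s, Measurable fun z => Φ z s) {c : ℝ} (hc : ∀ z, ‖Φ z‖ ≤ c) :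
    ∃ m : C(S, ℝ), (∀ s, m s = ∫ z, Φ z s ∂μ) ∧
    TendstoInMeasure P (fun (n : ℕ) w => (n : ℝ)⁻¹ • ∑ i ∈ Finset.range n, Φ (Z i w)) atTop
      (fun _ => m) := by
  let _ : MeasurableSpace C(S, ℝ) := borel _
  have : BorelSpace C(S, ℝ) := ⟨rfl⟩
  have hsep : SecondCountableTopology C(S, ℝ) := inferInstance
  have hΦm : Measurable Φ := by
    obtain ⟨D, hDc, hDd⟩ := TopologicalSpace.exists_countable_dense S
    have hball : ∀ (g : C(S, ℝ)) (r : ℝ), 0 ≤ r →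
        MeasurableSet (Φ ⁻¹' Metric.closedBall g r) := by
      intro g r hr
      have : Φ ⁻¹' Metric.closedBall g r = ⋂ s ∈ D, {z | |Φ z s - g s| ≤ r} := by
        ext z
        simp only [Set.mem_preimage, Metric.mem_closedBall, Set.mem_iInter, Set.mem_ofPred_eq]
        rw [ContinuousMap.dist_le hr]
        refine ⟨fun h s _ => h s, fun h s => ?_⟩
        have hcl : IsClosed {s | dist (Φ z s) (g s) ≤ r} :=
          isClosed_le (by fun_prop) continuous_const
        have : closure D ⊆ {s | dist (Φ z s) (g s) ≤ r} := hcl.closure_subset_iff.2 fun s hs => h s hs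
        exact this (hDd s)
      rw [this]
      refine MeasurableSet.biInter hDc fun s _ => ?_
      exact measurableSet_le ((hΦ s).sub_const _).abs measurable_const
    refine measurable_of_isOpen fun U hU => ?_
    -- an open set is a countable union of closed balls
    have hnb : ∀ g : U, ∃ r : ℝ, 0 < r ∧ Metric.closedBall (g : C(S, ℝ)) r ⊆ U := fun g =>
      Metric.nhds_basis_closedBall.mem_iff.1 (hU.mem_nhds g.2)
    choose r hr0 hrU using hnb
    obtain ⟨T, hTc, hTU⟩ := TopologicalSpace.isOpen_iUnion_countable
      (fun g : U => Metric.ball (g : C(S, ℝ)) (r g)) fun _ => Metric.isOpen_ball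
    have hUeq : U = ⋃ g ∈ T, Metric.closedBall (g : C(S, ℝ)) (r g) := by
      apply Set.Subset.antisymm
      · intro g hg
        have h1 : g ∈ ⋃ g ∈ T, Metric.ball (g : C(S, ℝ)) (r g) := by
          rw [hTU]
          exact Set.mem_iUnion.2 ⟨⟨g, hg⟩, Metric.mem_ball_self (hr0 _)⟩
        obtain ⟨g', hg', h2⟩ := Set.mem_iUnion₂.1 h1
        exact Set.mem_iUnion₂.2 ⟨g', hg', Metric.ball_subset_closedBall h2⟩
      · exact Set.iUnion₂_subset fun g _ => hrU g
    rw [hUeq, Set.preimage_iUnion₂]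
    exact MeasurableSet.biUnion hTc fun g _ => hball _ _ (hr0 g).le
  have hμ : IsProbabilityMeasure μ := by
    rw [← hlaw 0]; exact Measure.isProbabilityMeasure_map (hZ 0).aemeasurable
  have hint : Integrable Φ μ :=
    Integrable.of_bound hΦm.aestronglyMeasurable c (Eventually.of_forall hc)
  have hint0 : Integrable (fun w => Φ (Z 0 w)) P := by
    rw [← hlaw 0] at hint
    exact hint.comp_measurable (hZ 0)
  refine ⟨∫ z, Φ z ∂μ, fun s => ?_, ?_⟩
  · exact ((evalCLM ℝ s).integral_comp_comm hint).symm
  · have h := strong_law_ae (μ := P) (fun i w => Φ (Z i w)) hint0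
      (fun i j hij => (hind.indepFun hij).comp hΦm hΦm)
      (fun i => identDistrib_comp_of_map_eq hZ hlaw hΦm i 0)
    have hm : ∫ w, Φ (Z 0 w) ∂P = ∫ z, Φ z ∂μ := by
      rw [← hlaw 0, integral_map (hZ 0).aemeasurable hΦm.aestronglyMeasurable]
    rw [hm] at h
    refine tendstoInMeasure_of_tendsto_ae (fun n => Measurable.aestronglyMeasurable ?_) h
    have h1 : Measurable fun w => ∑ i ∈ Finset.range n, Φ (Z i w) :=
      Finset.measurable_fun_sum _ fun i _ => hΦm.comp (hZ i)
    exact h1.const_smul (n : ℝ)⁻¹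

/-! ### The population: base measure, regression function and welfare -/

namespace PolicyModel

variable {d p : ℕ} {Ω₀ : Type*} [MeasurableSpace Ω₀] (M : PolicyModel d p Ω₀)

/-- The measure `dt ⊗ law(X)`, with respect to which `(T, X)` has density `f`. -/
def base : Measure (ℝ × Cov d) := M.ν.prod M.lawX

/-- The law of one observation. -/
def obsLaw : Measure (Obs d) := M.law.map M.Z

lemma measurable_TX : Measurable M.TX := M.measurable_T.prodMk M.measurable_X

lemma measurable_Yobs : Measurable M.Yobs := M.measurable_Y.comp (M.measurable_T.prodMk measurable_id)

lemma measurable_Z : Measurable M.Z :=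
  M.measurable_Yobs.prodMk (M.measurable_T.prodMk M.measurable_X)

instance : IsProbabilityMeasure M.lawX := Measure.isProbabilityMeasure_map M.measurable_X.aemeasurable
instance : IsProbabilityMeasure M.lawTX :=
  Measure.isProbabilityMeasure_map M.measurable_TX.aemeasurable
instance : IsProbabilityMeasure M.obsLaw :=
  Measure.isProbabilityMeasure_map M.measurable_Z.aemeasurable

lemma lawTX_eq : M.lawTX = M.base.withDensity fun z => ENNReal.ofReal (M.f z.1 z.2) := M.law_TX_eq

lemma lawTX_ac : M.lawTX ≪ M.base := by
  rw [lawTX_eq]; exact withDensity_absolutelyContinuous _ _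

lemma map_snd_obsLaw : M.obsLaw.map Prod.snd = M.lawTX := by
  rw [obsLaw, Measure.map_map measurable_snd M.measurable_Z]; rfl

lemma map_snd_snd_obsLaw : M.obsLaw.map (fun z => z.2.2) = M.lawX := by
  rw [obsLaw, Measure.map_map measurable_snd.snd M.measurable_Z]; rfl

lemma ae_lawX_mem : ∀ᵐ x ∂M.lawX, x ∈ M.𝒳 :=
  (ae_map_iff M.measurable_X.aemeasurable M.measurableSet_𝒳).2 (Eventually.of_forall M.X_mem)

lemma ae_ν_mem : ∀ᵐ t ∂M.ν, t ∈ M.𝒯 := by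
  rw [ae_iff]; exact M.ν_compl

lemma ae_base_mem : ∀ᵐ z ∂M.base, z.1 ∈ M.𝒯 ∧ z.2 ∈ M.𝒳 := by
  have hm : MeasurableSet {z : ℝ × Cov d | z.1 ∈ M.𝒯 ∧ z.2 ∈ M.𝒳} :=
    M.measurableSet_𝒯.prod M.measurableSet_𝒳
  refine (Measure.ae_prod_iff_ae_ae hm).2 ?_
  filter_upwards [M.ae_ν_mem] with t ht
  filter_upwards [M.ae_lawX_mem] with x hx using ⟨ht, hx⟩

lemma ae_ae_of_ae_base {Q : ℝ × Cov d → Prop} (h : ∀ᵐ z ∂M.base, Q z) :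
    ∀ᵐ x ∂M.lawX, ∀ᵐ t ∂M.ν, Q (t, x) := by
  rw [base, ← Measure.prod_swap] at h
  exact Measure.ae_ae_of_ae_prod (ae_of_ae_map measurable_swap.aemeasurable h)

/-- A property that holds almost everywhere for the base measure holds, for almost every observation
`(y, t, x)`, at `(t, x)` and at `(t', x)` for almost every treatment `t'`. -/
lemma ae_obsLaw {Q : ℝ × Cov d → Prop} (h : ∀ᵐ z ∂M.base, Q z) :
    ∀ᵐ z ∂M.obsLaw, Q z.2 ∧ ∀ᵐ t ∂M.ν, Q (t, z.2.2) := by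
  have h1 : ∀ᵐ z ∂M.obsLaw, Q z.2 := by
    have : ∀ᵐ z ∂(M.obsLaw.map Prod.snd), Q z := by rw [map_snd_obsLaw]; exact M.lawTX_ac.ae_le h
    exact ae_of_ae_map measurable_snd.aemeasurable this
  have h2 : ∀ᵐ x ∂M.lawX, ∀ᵐ t ∂M.ν, Q (t, x) :=
    M.ae_ae_of_ae_base h
  have h3 : ∀ᵐ z ∂M.obsLaw, ∀ᵐ t ∂M.ν, Q (t, z.2.2) := by
    rw [← map_snd_snd_obsLaw] at h2
    exact ae_of_ae_map measurable_snd.snd.aemeasurable h2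
  exact h1.and h3

lemma stronglyMeasurable_m : StronglyMeasurable fun z : ℝ × Cov d => M.m z.1 z.2 := by
  have := ((measurable_snd : Measurable fun q : (ℝ × Cov d) × ℝ => q.2).stronglyMeasurable).integral_condDistrib
    (Y := M.Yobs) (X := M.TX) (μ := M.law)
  exact this

lemma measurable_m : Measurable fun z : ℝ × Cov d => M.m z.1 z.2 := M.stronglyMeasurable_m.measurable

lemma measurable_ω : Measurable fun z : ℝ × Cov d => M.ω z.1 z.2 :=
  measurable_const.div M.measurable_f

lemma measurable_pol_θ (θ : Par p) : Measurable fun z : ℝ × Cov d => M.pol θ z.1 z.2 :=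
  M.measurable_pol.comp (measurable_const.prodMk measurable_id)

lemma integral_policy {θ : Par p} (hθ : θ ∈ M.Θ) {x : Cov d} (hx : x ∈ M.𝒳) (F : ℝ → ℝ) :
    ∫ t, F t ∂(M.policy θ x) = ∫ t, F t * M.pol θ t x ∂M.ν := by
  have hm : Measurable fun t => ENNReal.ofReal (M.pol θ t x) :=
    ((M.measurable_pol_θ θ).comp (measurable_id.prodMk measurable_const)).ennreal_ofReal
  rw [policy, integral_withDensity_eq_integral_toReal_smul hm (Eventually.of_forall fun _ => by simp)]
  refine integral_congr_ae ?_
  filter_upwards [M.ae_ν_mem] with t ht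
  rw [ENNReal.toReal_ofReal (M.pol_nonneg θ hθ t ht x hx), smul_eq_mul, mul_comm]

lemma measurable_welfare : Measurable M.welfare := by
  have h : M.welfare = fun θ => ∫ u, ∫ t, max (M.pol θ t (M.X u)) 0 * M.Y t u ∂M.ν ∂M.law := by
    funext θ
    refine integral_congr_ae (Eventually.of_forall fun u => ?_)
    have hm : Measurable fun t => ENNReal.ofReal (M.pol θ t (M.X u)) :=
      ((M.measurable_pol_θ θ).comp (measurable_id.prodMk measurable_const)).ennreal_ofReal
    simp only [policy]
    rw [integral_withDensity_eq_integral_toReal_smul hm (Eventually.of_forall fun _ => by simp)]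
    simp [ENNReal.ofReal, smul_eq_mul, Real.coe_toNNReal']
  rw [h]
  have hjoint : Measurable fun q : (Par p × Ω₀) × ℝ =>
      max (M.pol q.1.1 q.2 (M.X q.1.2)) 0 * M.Y q.2 q.1.2 := by
    refine Measurable.mul (Measurable.max ?_ measurable_const) ?_
    · exact M.measurable_pol.comp (measurable_fst.fst.prodMk
        (measurable_snd.prodMk (M.measurable_X.comp measurable_fst.snd)))
    · exact M.measurable_Y.comp (measurable_snd.prodMk measurable_fst.snd)
  have h1 := hjoint.stronglyMeasurable.integral_prod_right' (ν := M.ν)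
  exact (h1.integral_prod_right' (ν := M.law)).measurable

/-- Quantitative form of the regularity conditions near `θs`, with a single constant `C` for all
bounds and a radius `r` of a ball in which the policies are differentiable. -/
structure Regular (θs : Par p) (C r : ℝ) : Prop where
  one_le : 1 ≤ C
  r_pos : 0 < r
  outcome : ∀ t ∈ M.𝒯, ∀ u, |M.Y t u| ≤ C
  density : ∀ t ∈ M.𝒯, ∀ x ∈ M.𝒳, C⁻¹ ≤ M.f t x
  pol_le : ∀ θ ∈ M.Θ, ∀ t ∈ M.𝒯, ∀ x ∈ M.𝒳, M.pol θ t x ≤ C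
  ball_subset : Metric.ball θs r ⊆ M.Θ
  continuous : ∀ᵐ z ∂M.base, ContinuousOn (fun θ => M.pol θ z.1 z.2) M.Θ
  diff : ∀ᵐ z ∂M.base, ∀ θ ∈ Metric.ball θs r,
    DifferentiableAt ℝ (fun θ' => M.pol θ' z.1 z.2) θ ∧ ‖M.dpol θ z.1 z.2‖ ≤ C

variable {M} in
lemma exists_regular {θs : Par p} (h_int : θs ∈ interior M.Θ) (h_smooth : M.PolicySmooth θs)
    (h_bdd : M.BoundedOutcomesOverlap) : ∃ C r, M.Regular θs C r := by
  obtain ⟨C1, h1⟩ := h_bdd.outcome_bounded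
  obtain ⟨c, hc0, hc⟩ := h_bdd.density_bounded_below
  obtain ⟨N, hN, C2, h2⟩ := h_smooth.differentiable
  obtain ⟨C3, h3⟩ := h_smooth.bounded
  obtain ⟨r, hr, hrN⟩ := Metric.mem_nhds_iff.1 (inter_mem hN (mem_interior_iff_mem_nhds.1 h_int))
  set C := 1 + |C1| + |C2| + |C3| + c⁻¹
  have hc' : 0 < c⁻¹ := inv_pos.2 hc0
  have a1 := abs_nonneg C1
  have a2 := abs_nonneg C2
  have a3 := abs_nonneg C3
  refine ⟨C, r, ⟨by simp only [C]; linarith, hr, fun t ht u => ?_, fun t ht x hx => ?_,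
    fun θ hθ t ht x hx => ?_, fun θ hθ => (hrN hθ).2, h_smooth.continuous, ?_⟩⟩
  · have := h1 t ht u; simp only [C]; linarith [le_abs_self C1]
  · refine le_trans ?_ (hc t ht x hx)
    rw [inv_le_comm₀ (by simp only [C]; linarith) hc0]
    simp only [C]; linarith
  · have := h3 θ hθ t ht x hx; simp only [C]; linarith [le_abs_self C3]
  · refine Eventually.mono h2 fun z hz θ hθ => ⟨(hz θ (hrN hθ).1).1, ((hz θ (hrN hθ).1).2).trans ?_⟩
    simp only [C]; linarith [le_abs_self C2]

variable {M}

namespace Regular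

variable {θs : Par p} {C r : ℝ} (R : M.Regular θs C r)

include R

lemma C_pos : 0 < C := zero_lt_one.trans_le R.one_le

lemma base_le : M.base ≤ ENNReal.ofReal C • M.lawTX := by
  have hC := R.C_pos
  refine Measure.le_iff.2 fun s hs => ?_
  rw [Measure.smul_apply, smul_eq_mul, lawTX_eq, withDensity_apply _ hs]
  have h1 : ∫⁻ _ in s, ENNReal.ofReal C⁻¹ ∂M.base
      ≤ ∫⁻ z in s, ENNReal.ofReal (M.f z.1 z.2) ∂M.base := by
    refine lintegral_mono_ae (ae_restrict_of_ae ?_)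
    filter_upwards [M.ae_base_mem] with z hz
    exact ENNReal.ofReal_le_ofReal (R.density _ hz.1 _ hz.2)
  rw [setLIntegral_const] at h1
  calc M.base s = ENNReal.ofReal C * (ENNReal.ofReal C⁻¹ * M.base s) := by
        rw [← mul_assoc, ← ENNReal.ofReal_mul hC.le, mul_inv_cancel₀ hC.ne']; simp
    _ ≤ _ := by gcongr

lemma base_ac : M.base ≪ M.lawTX :=
  Measure.absolutelyContinuous_of_le_smul R.base_le

lemma ν_univ_le : M.ν Set.univ ≤ ENNReal.ofReal C := by
  have h := R.base_le Set.univ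
  rw [base, ← Set.univ_prod_univ, Measure.prod_prod] at h
  simpa using h

lemma isFiniteMeasure_ν : IsFiniteMeasure M.ν := ⟨R.ν_univ_le.trans_lt ENNReal.ofReal_lt_top⟩

lemma isFiniteMeasure_base : IsFiniteMeasure M.base := by
  have := R.isFiniteMeasure_ν
  rw [base]; infer_instance

lemma ν_real_le : M.ν.real Set.univ ≤ C :=
  ENNReal.toReal_le_of_le_ofReal R.C_pos.le R.ν_univ_le

lemma ae_f_nonneg : ∀ᵐ z ∂M.base, C⁻¹ ≤ M.f z.1 z.2 := by
  filter_upwards [M.ae_base_mem] with z hz using R.density _ hz.1 _ hz.2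

lemma integral_lawTX (F : ℝ × Cov d → ℝ) :
    ∫ z, F z ∂M.lawTX = ∫ z, M.f z.1 z.2 * F z ∂M.base := by
  rw [lawTX_eq, integral_withDensity_eq_integral_toReal_smul M.measurable_f.ennreal_ofReal
    (Eventually.of_forall fun _ => by simp)]
  refine integral_congr_ae ?_
  filter_upwards [R.ae_f_nonneg] with z hz
  rw [ENNReal.toReal_ofReal ((inv_pos.2 R.C_pos).le.trans hz), smul_eq_mul]

lemma ω_bounds {t : ℝ} (ht : t ∈ M.𝒯) {x : Cov d} (hx : x ∈ M.𝒳) :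
    0 ≤ M.ω t x ∧ M.ω t x ≤ C ∧ M.ω t x * M.f t x = 1 := by
  have h := R.density t ht x hx
  have hC := inv_pos.2 R.C_pos
  have hf : 0 < M.f t x := hC.trans_le h
  refine ⟨by rw [ω]; positivity, ?_, by rw [ω]; field_simp⟩
  rw [ω, one_div]
  exact inv_le_of_inv_le₀ R.C_pos h

/-- Integrating against `f ω = 1` turns the law of `(T, X)` into the base measure. -/
lemma integral_lawTX_ω (F : ℝ × Cov d → ℝ) :
    ∫ z, M.ω z.1 z.2 * F z ∂M.lawTX = ∫ z, F z ∂M.base := by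
  rw [R.integral_lawTX]
  refine integral_congr_ae ?_
  filter_upwards [M.ae_base_mem] with z hz
  rw [← mul_assoc, mul_comm (M.f z.1 z.2), (R.ω_bounds hz.1 hz.2).2.2, one_mul]

lemma abs_Yobs_le (u : Ω₀) : |M.Yobs u| ≤ C := R.outcome _ (M.T_mem u) u

lemma ae_obsLaw_abs_le : ∀ᵐ z ∂M.obsLaw, |z.1| ≤ C :=
  (ae_map_iff M.measurable_Z.aemeasurable
    (measurableSet_le measurable_fst.abs measurable_const)).2 (Eventually.of_forall R.abs_Yobs_le)

/-- The tower property for `m(T, X) = E[Y | T, X]`. -/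
lemma integral_Yobs_mul {h : ℝ × Cov d → ℝ} (hm : Measurable h) (hi : Integrable h M.lawTX) :
    ∫ z, z.1 * h z.2 ∂M.obsLaw = ∫ z, M.m z.1 z.2 * h z ∂M.lawTX := by
  have hcp := compProd_map_condDistrib (mβ := inferInstance) (μ := M.law) (X := M.TX) M.measurable_Yobs.aemeasurable
  have hmeas : Measurable fun q : (ℝ × Cov d) × ℝ => q.2 * h q.1 :=
    measurable_snd.mul (hm.comp measurable_fst)
  have hYm : Measurable fun u => (M.TX u, M.Yobs u) := M.measurable_TX.prodMk M.measurable_Yobs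
  have hint : Integrable (fun q : (ℝ × Cov d) × ℝ => q.2 * h q.1)
      (M.law.map fun u => (M.TX u, M.Yobs u)) := by
    rw [integrable_map_measure hmeas.aestronglyMeasurable hYm.aemeasurable]
    have h1 : Integrable (fun u => h (M.TX u)) M.law :=
      (integrable_map_measure hm.aestronglyMeasurable M.measurable_TX.aemeasurable).1 hi
    exact h1.bdd_mul (c := C) M.measurable_Yobs.aestronglyMeasurable
      (Eventually.of_forall R.abs_Yobs_le)
  calc ∫ z, z.1 * h z.2 ∂M.obsLaw = ∫ u, M.Yobs u * h (M.TX u) ∂M.law := by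
        have hz : Measurable fun z : Obs d => z.1 * h z.2 :=
          measurable_fst.mul (hm.comp measurable_snd)
        rw [obsLaw, integral_map M.measurable_Z.aemeasurable hz.aestronglyMeasurable]; rfl
    _ = ∫ q, q.2 * h q.1 ∂(M.law.map fun u => (M.TX u, M.Yobs u)) := by
        rw [integral_map hYm.aemeasurable hmeas.aestronglyMeasurable]
    _ = ∫ z, ∫ y, y * h z ∂(condDistrib M.Yobs M.TX M.law z) ∂M.lawTX := by
        rw [← hcp] at hint ⊢
        rw [Measure.integral_compProd hint]; rfl
    _ = _ := by
        refine integral_congr_ae (Eventually.of_forall fun z => ?_)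
        simp only
        rw [integral_mul_const]; rfl

lemma ae_abs_m_le : ∀ᵐ z ∂M.base, |M.m z.1 z.2| ≤ C := by
  refine R.base_ac.ae_le ?_
  have hcp := compProd_map_condDistrib (mβ := inferInstance) (μ := M.law) (X := M.TX) M.measurable_Yobs.aemeasurable
  have hYm : Measurable fun u => (M.TX u, M.Yobs u) := M.measurable_TX.prodMk M.measurable_Yobs
  have h1 : ∀ᵐ q ∂(M.law.map fun u => (M.TX u, M.Yobs u)), |q.2| ≤ C :=
    (ae_map_iff hYm.aemeasurable (measurableSet_le measurable_snd.abs measurable_const)).2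
      (Eventually.of_forall R.abs_Yobs_le)
  rw [← hcp] at h1
  filter_upwards [Measure.ae_ae_of_ae_compProd h1] with z hz
  have := norm_integral_le_of_norm_le_const (f := fun y : ℝ => y)
    (μ := condDistrib M.Yobs M.TX M.law z) hz
  simpa [m] using this

end Regular

/-- Under unconfoundedness, `m(t, x)` is the conditional mean of `Y(t)` given `X = x`. -/
lemma Unconfounded.m_eq [StandardBorelSpace Ω₀] [Nonempty Ω₀] {θs : Par p} {C r : ℝ}
    (h : M.Unconfounded) (R : M.Regular θs C r) :
    ∀ᵐ z ∂M.base, M.m z.1 z.2 = ∫ u, M.Y z.1 u ∂(condDistrib (fun u : Ω₀ => u) M.X M.law z.2) := by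
  have hYm : Measurable fun q : (ℝ × Cov d) × Ω₀ => M.Y q.1.1 q.2 :=
    M.measurable_Y.comp (measurable_fst.fst.prodMk measurable_snd)
  have hTm : Measurable fun u => (M.TX u, u) := M.measurable_TX.prodMk measurable_id
  have hYi : Integrable (fun q : (ℝ × Cov d) × Ω₀ => M.Y q.1.1 q.2)
      (M.law.map fun u => (M.TX u, u)) := by
    rw [integrable_map_measure hYm.aestronglyMeasurable
      hTm.aemeasurable]
    exact Integrable.of_bound (hYm.comp hTm).aestronglyMeasurable
      C (Eventually.of_forall R.abs_Yobs_le)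
  have h1 := condExp_ae_eq_integral_condDistrib' (μ := M.law) M.measurable_TX
    (Y := M.Yobs) (Integrable.of_bound M.measurable_Yobs.aestronglyMeasurable C
      (Eventually.of_forall R.abs_Yobs_le))
  have h2 := condExp_prod_ae_eq_integral_condDistrib' (μ := M.law) (Y := fun u : Ω₀ => u)
    M.measurable_TX aemeasurable_id hYi
  have h3 : ∀ᵐ u ∂M.law, M.m (M.TX u).1 (M.TX u).2
      = ∫ u', M.Y (M.TX u).1 u' ∂(condDistrib (fun u : Ω₀ => u) M.TX M.law (M.TX u)) := by
    filter_upwards [h1, h2] with u hu1 hu2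
    rw [← hu2]
    exact hu1.symm
  have h4 : ∀ᵐ z ∂M.lawTX, M.m z.1 z.2
      = ∫ u', M.Y z.1 u' ∂(condDistrib (fun u : Ω₀ => u) M.TX M.law z) := by
    refine (ae_map_iff M.measurable_TX.aemeasurable ?_).2 h3
    exact measurableSet_eq_fun M.measurable_m (hYm.stronglyMeasurable.integral_condDistrib).measurable
  filter_upwards [R.base_ac.ae_le h4, R.base_ac.ae_le h, M.ae_base_mem] with z hz1 hz2 hz3
  have hY : Measurable (M.Y z.1) := M.measurable_Y.comp (measurable_const.prodMk measurable_id)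
  have h5 : ∫ y, y ∂((condDistrib (fun u : Ω₀ => u) M.TX M.law z).map (M.Y z.1))
      = ∫ y, y ∂((condDistrib (fun u : Ω₀ => u) M.X M.law z.2).map (M.Y z.1)) := by
    rw [hz2 z.1 hz3.1]
  rw [integral_map hY.aemeasurable (by fun_prop), integral_map hY.aemeasurable (by fun_prop)] at h5
  rw [hz1, h5]

/-- Identification of the welfare: `W(θ) = ∫ m π_θ d(t, x)`. -/
lemma Unconfounded.welfare_eq [StandardBorelSpace Ω₀] [Nonempty Ω₀] {θs : Par p} {C r : ℝ}
    (h : M.Unconfounded) (R : M.Regular θs C r) {θ : Par p} (hθ : θ ∈ M.Θ) :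
    M.welfare θ = ∫ z, M.m z.1 z.2 * M.pol θ z.1 z.2 ∂M.base := by
  have hν := R.isFiniteMeasure_ν
  have hB := R.isFiniteMeasure_base
  have hC := R.C_pos
  set κ := condDistrib (fun u : Ω₀ => u) M.X M.law with hκ
  have hGm : Measurable fun q : (Cov d × Ω₀) × ℝ => M.Y q.2 q.1.2 * M.pol θ q.2 q.1.1 :=
    (M.measurable_Y.comp (measurable_snd.prodMk measurable_fst.snd)).mul
      ((M.measurable_pol_θ θ).comp (measurable_snd.prodMk measurable_fst.fst))
  have hG : StronglyMeasurable fun q : Cov d × Ω₀ => ∫ t, M.Y t q.2 * M.pol θ t q.1 ∂M.ν :=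
    hGm.stronglyMeasurable.integral_prod_right'
  have hXm : Measurable fun u => (M.X u, u) := M.measurable_X.prodMk measurable_id
  have hbound : ∀ x ∈ M.𝒳, ∀ u, ∀ᵐ t ∂M.ν, ‖M.Y t u * M.pol θ t x‖ ≤ C * C := by
    intro x hx u
    filter_upwards [M.ae_ν_mem] with t ht
    rw [norm_mul, Real.norm_eq_abs, Real.norm_of_nonneg (M.pol_nonneg θ hθ t ht x hx)]
    exact mul_le_mul (R.outcome t ht u) (R.pol_le θ hθ t ht x hx) (M.pol_nonneg θ hθ t ht x hx) hC.le
  have hGi : Integrable (fun q : Cov d × Ω₀ => ∫ t, M.Y t q.2 * M.pol θ t q.1 ∂M.ν)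
      (M.law.map fun u => (M.X u, u)) := by
    rw [integrable_map_measure hG.aestronglyMeasurable hXm.aemeasurable]
    refine Integrable.of_bound (hG.comp_measurable hXm).aestronglyMeasurable
      (C * C * M.ν.real Set.univ) (Eventually.of_forall fun u => ?_)
    exact norm_integral_le_of_norm_le_const (hbound _ (M.X_mem u) u)
  have hcp := compProd_map_condDistrib (mβ := inferInstance) (μ := M.law) (X := M.X) (Y := fun u : Ω₀ => u) aemeasurable_id
  have hmi : Integrable (fun z : ℝ × Cov d => M.m z.1 z.2 * M.pol θ z.1 z.2) M.base := by
    refine Integrable.of_bound (M.measurable_m.mul (M.measurable_pol_θ θ)).aestronglyMeasurable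
      (C * C) ?_
    filter_upwards [R.ae_abs_m_le, M.ae_base_mem] with z hz1 hz2
    rw [norm_mul, Real.norm_eq_abs,
      Real.norm_of_nonneg (M.pol_nonneg θ hθ _ hz2.1 _ hz2.2)]
    exact mul_le_mul hz1 (R.pol_le θ hθ _ hz2.1 _ hz2.2) (M.pol_nonneg θ hθ _ hz2.1 _ hz2.2) hC.le
  calc M.welfare θ = ∫ u, ∫ t, M.Y t u * M.pol θ t (M.X u) ∂M.ν ∂M.law := by
        refine integral_congr_ae (Eventually.of_forall fun u => ?_)
        exact M.integral_policy hθ (M.X_mem u) _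
    _ = ∫ q, ∫ t, M.Y t q.2 * M.pol θ t q.1 ∂M.ν ∂(M.law.map fun u => (M.X u, u)) := by
        rw [integral_map hXm.aemeasurable hG.aestronglyMeasurable]
    _ = ∫ x, ∫ u, ∫ t, M.Y t u * M.pol θ t x ∂M.ν ∂(κ x) ∂M.lawX := by
        rw [← hcp] at hGi ⊢
        rw [Measure.integral_compProd hGi]; rfl
    _ = ∫ x, ∫ t, M.m t x * M.pol θ t x ∂M.ν ∂M.lawX := by
        refine integral_congr_ae ?_
        filter_upwards [M.ae_lawX_mem, M.ae_ae_of_ae_base (h.m_eq R)] with x hx hmx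
        have hYx : Measurable fun q : Ω₀ × ℝ => M.Y q.2 q.1 * M.pol θ q.2 x :=
          hGm.comp ((measurable_const.prodMk measurable_fst).prodMk measurable_snd)
        rw [integral_integral_swap]
        · refine integral_congr_ae ?_
          filter_upwards [hmx] with t ht
          simp only at ht ⊢
          rw [integral_mul_const, ht]
        · refine Integrable.of_bound hYx.aestronglyMeasurable (C * C) ?_
          have hms : MeasurableSet {q : Ω₀ × ℝ | ‖M.Y q.2 q.1 * M.pol θ q.2 x‖ ≤ C * C} :=
            measurableSet_le hYx.norm measurable_const
          refine (Measure.ae_prod_iff_ae_ae hms).2 (Eventually.of_forall fun u => hbound x hx u)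
    _ = _ := by
        rw [base] at hmi ⊢
        rw [integral_prod_symm _ hmi]

end PolicyModel

/-! ### Doubly robust scores -/

lemma integral_abs_le_of_sq {α : Type*} [MeasurableSpace α] {μ : Measure α} [IsProbabilityMeasure μ]
    {g : α → ℝ} (hg : MemLp g 2 μ) {b : ℝ} (hb : 0 < b) (h : ∫ z, g z ^ 2 ∂μ ≤ b ^ 2) :
    ∫ z, |g z| ∂μ ≤ b := by
  have h1 : ∫ z, |g z| ∂μ ≤ ∫ z, (g z ^ 2 * (1 / (2 * b)) + b / 2) ∂μ := by
    refine integral_mono (hg.integrable one_le_two).abs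
      ((hg.integrable_sq.mul_const _).add (integrable_const _)) fun z => ?_
    simp only
    have h2 : 0 ≤ (|g z| - b) ^ 2 := sq_nonneg _
    rw [sub_sq, sq_abs] at h2
    rw [← sub_nonneg]
    have : g z ^ 2 * (1 / (2 * b)) + b / 2 - |g z|
        = (g z ^ 2 - 2 * |g z| * b + b ^ 2) * (1 / (2 * b)) := by field_simp; ring
    rw [this]
    positivity
  rw [integral_add (hg.integrable_sq.mul_const _) (integrable_const _), integral_mul_const,
    integral_const, probReal_univ, one_smul] at h1
  have h3 : (∫ z, g z ^ 2 ∂μ) * (1 / (2 * b)) ≤ b ^ 2 * (1 / (2 * b)) := by gcongr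
  have h4 : b ^ 2 * (1 / (2 * b)) = b / 2 := by field_simp
  linarith

lemma integral_abs_mul_le_of_sq {α : Type*} [MeasurableSpace α] {μ : Measure α}
    {f g : α → ℝ} (hf : MemLp f 2 μ) (hg : MemLp g 2 μ) {a b : ℝ} (ha : 0 < a) (hb : 0 < b)
    (h1 : ∫ z, f z ^ 2 ∂μ ≤ a ^ 2) (h2 : ∫ z, g z ^ 2 ∂μ ≤ b ^ 2) :
    ∫ z, |f z * g z| ∂μ ≤ a * b := by
  have h3 : ∫ z, |f z * g z| ∂μ ≤ ∫ z, (f z ^ 2 * (b / (2 * a)) + g z ^ 2 * (a / (2 * b))) ∂μ := by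
    refine integral_mono_of_nonneg (Eventually.of_forall fun _ => abs_nonneg _)
      ((hf.integrable_sq.mul_const _).add (hg.integrable_sq.mul_const _))
      (Eventually.of_forall fun z => ?_)
    simp only [abs_mul]
    have h2 : 0 ≤ (|f z| * b - |g z| * a) ^ 2 := sq_nonneg _
    rw [sub_sq, mul_pow, mul_pow, sq_abs, sq_abs] at h2
    rw [← sub_nonneg]
    have : f z ^ 2 * (b / (2 * a)) + g z ^ 2 * (a / (2 * b)) - |f z| * |g z|
        = (f z ^ 2 * b ^ 2 - 2 * (|f z| * b) * (|g z| * a) + g z ^ 2 * a ^ 2) * (1 / (2 * a * b)) := by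
      field_simp
      ring
    rw [this]
    positivity
  rw [integral_add (hf.integrable_sq.mul_const _) (hg.integrable_sq.mul_const _),
    integral_mul_const, integral_mul_const] at h3
  have h4 : (∫ z, f z ^ 2 ∂μ) * (b / (2 * a)) ≤ a ^ 2 * (b / (2 * a)) := by gcongr
  have h5 : (∫ z, g z ^ 2 ∂μ) * (a / (2 * b)) ≤ b ^ 2 * (a / (2 * b)) := by gcongr
  have h6 : a ^ 2 * (b / (2 * a)) + b ^ 2 * (a / (2 * b)) = a * b := by field_simp; ring
  linarith

namespace PolicyModel

variable {d p : ℕ} {Ω₀ : Type*} [MeasurableSpace Ω₀] (M : PolicyModel d p Ω₀)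

/-- The doubly robust score with weight `w` and regression function `q`, as a linear functional of
the policy density `b`. Differences of densities and directional derivatives of densities
are also used for `b`. -/
def score (w q b : ℝ × Cov d → ℝ) (z : Obs d) : ℝ :=
  w z.2 * b z.2 * (z.1 - q z.2) + ∫ t, q (t, z.2.2) * b (t, z.2.2) ∂M.ν

/-- The weight `ω` as a function of the pair `(t, x)`. -/
def ω₂ (z : ℝ × Cov d) : ℝ := M.ω z.1 z.2

/-- The regression function `m` as a function of the pair `(t, x)`. -/
def m₂ (z : ℝ × Cov d) : ℝ := M.m z.1 z.2

/-- The policy density as a function of the pair `(t, x)`. -/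
def pol₂ (θ : Par p) (z : ℝ × Cov d) : ℝ := M.pol θ z.1 z.2

lemma measurable_ω₂ : Measurable M.ω₂ := M.measurable_ω
lemma measurable_m₂ : Measurable M.m₂ := M.measurable_m
lemma measurable_pol₂ (θ : Par p) : Measurable (M.pol₂ θ) := M.measurable_pol_θ θ

lemma measurable_score_param {𝒟 : Type*} [MeasurableSpace 𝒟] {w q : 𝒟 → ℝ × Cov d → ℝ}
    (hw : Measurable (Function.uncurry w)) (hq : Measurable (Function.uncurry q))
    {b : ℝ × Cov d → ℝ} (hb : Measurable b) :
    Measurable fun y : 𝒟 × Obs d => M.score (w y.1) (q y.1) b y.2 := by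
  have h1 : Measurable fun y : 𝒟 × Obs d => w y.1 y.2.2 :=
    hw.comp (measurable_fst.prodMk measurable_snd.snd)
  have h2 : Measurable fun y : 𝒟 × Obs d => q y.1 y.2.2 :=
    hq.comp (measurable_fst.prodMk measurable_snd.snd)
  have h3 : Measurable fun y : (𝒟 × Obs d) × ℝ => q y.1.1 (y.2, y.1.2.2.2) * b (y.2, y.1.2.2.2) :=
    (hq.comp (measurable_fst.fst.prodMk (measurable_snd.prodMk measurable_fst.snd.snd.snd))).mul
      (hb.comp (measurable_snd.prodMk measurable_fst.snd.snd.snd))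
  have h4 := h3.stronglyMeasurable.integral_prod_right' (ν := M.ν)
  exact ((h1.mul (hb.comp measurable_snd.snd)).mul (measurable_snd.fst.sub h2)).add h4.measurable

lemma measurable_score {w q b : ℝ × Cov d → ℝ} (hw : Measurable w) (hq : Measurable q)
    (hb : Measurable b) : Measurable (M.score w q b) :=
  (M.measurable_score_param (𝒟 := Unit) (w := fun _ => w) (q := fun _ => q)
    (hw.comp measurable_snd) (hq.comp measurable_snd) hb).comp
      (measurable_const (a := ()) |>.prodMk measurable_id)

lemma score_sub {w q b b' : ℝ × Cov d → ℝ} {z : Obs d}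
    (h : Integrable (fun t => q (t, z.2.2) * b (t, z.2.2)) M.ν)
    (h' : Integrable (fun t => q (t, z.2.2) * b' (t, z.2.2)) M.ν) :
    M.score w q (fun y => b y - b' y) z = M.score w q b z - M.score w q b' z := by
  simp only [score, mul_sub]
  rw [integral_sub h h']
  ring

lemma score_const_mul (w q b : ℝ × Cov d → ℝ) (c : ℝ) (z : Obs d) :
    M.score w q (fun y => c * b y) z = c * M.score w q b z := by
  simp only [score]
  rw [mul_add, ← integral_const_mul]
  congr 1
  · ring
  · exact integral_congr_ae (Eventually.of_forall fun t => by simp only; ring)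

variable {M}

namespace Regular

variable {θs : Par p} {C r : ℝ} (R : M.Regular θs C r)

include R

lemma integrable_section {q b : ℝ × Cov d → ℝ} (hqm : Measurable q) (hbm : Measurable b)
    {c : ℝ} {x : Cov d} (h : ∀ᵐ t ∂M.ν, |q (t, x) * b (t, x)| ≤ c) :
    Integrable (fun t => q (t, x) * b (t, x)) M.ν := by
  have := R.isFiniteMeasure_ν
  have hm : Measurable fun t => q (t, x) * b (t, x) :=
    (hqm.comp (measurable_id.prodMk measurable_const)).mul
      (hbm.comp (measurable_id.prodMk measurable_const))
  exact Integrable.of_bound hm.aestronglyMeasurable c h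

lemma abs_score_le {w q b : ℝ × Cov d → ℝ} {κ : ℝ} {z : Obs d} (hκ : 0 ≤ κ) (hy : |z.1| ≤ C)
    (hq : |q z.2| ≤ C) (hb : |b z.2| ≤ κ)
    (h : ∀ᵐ t ∂M.ν, |q (t, z.2.2)| ≤ C ∧ |b (t, z.2.2)| ≤ κ) :
    |M.score w q b z| ≤ κ * (2 * C * |w z.2| + C ^ 2) := by
  have hC := R.C_pos
  have := R.isFiniteMeasure_ν
  have h1 : |w z.2 * b z.2 * (z.1 - q z.2)| ≤ |w z.2| * κ * (C + C) := by
    rw [abs_mul, abs_mul]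
    have : |z.1 - q z.2| ≤ C + C := (abs_sub _ _).trans (add_le_add hy hq)
    gcongr
  have h2 : |∫ t, q (t, z.2.2) * b (t, z.2.2) ∂M.ν| ≤ C * κ * M.ν.real Set.univ := by
    rw [← Real.norm_eq_abs]
    refine norm_integral_le_of_norm_le_const (μ := M.ν) ?_
    filter_upwards [h] with t ht
    rw [norm_mul]
    exact mul_le_mul ht.1 ht.2 (abs_nonneg _) hC.le
  have h3 : C * κ * M.ν.real Set.univ ≤ C * κ * C := by gcongr; exact R.ν_real_le
  rw [score]
  refine (abs_add_le _ _).trans ((add_le_add h1 (h2.trans h3)).trans (le_of_eq ?_))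
  ring

/-- The pointwise error bound that comes with replacing `(ω, m)` by `(w, q)` in a score. -/
def _root_.PolicyModel.scoreErr (M : PolicyModel d p Ω₀) (C : ℝ) (w q : ℝ × Cov d → ℝ)
    (z : Obs d) : ℝ :=
  2 * C * |w z.2 - M.ω₂ z.2| + C * |q z.2 - M.m₂ z.2| + ∫ t, |q (t, z.2.2) - M.m₂ (t, z.2.2)| ∂M.ν

lemma abs_score_sub_le {w q b : ℝ × Cov d → ℝ} (hqm : Measurable q) (hbm : Measurable b)
    {κ : ℝ} {z : Obs d} (hy : |z.1| ≤ C) (hz : z.2.1 ∈ M.𝒯 ∧ z.2.2 ∈ M.𝒳)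
    (hq : |q z.2| ≤ C) (hb : |b z.2| ≤ κ)
    (h : ∀ᵐ t ∂M.ν, (|q (t, z.2.2)| ≤ C ∧ |M.m₂ (t, z.2.2)| ≤ C) ∧ |b (t, z.2.2)| ≤ κ) :
    |M.score w q b z - M.score M.ω₂ M.m₂ b z| ≤ κ * M.scoreErr C w q z := by
  have hC := R.C_pos
  have hκ : 0 ≤ κ := (abs_nonneg _).trans hb
  have hωb : |M.ω₂ z.2| ≤ C := by
    have := R.ω_bounds hz.1 hz.2
    rw [ω₂, abs_of_nonneg this.1]; exact this.2.1
  have hi1 : Integrable (fun t => q (t, z.2.2) * b (t, z.2.2)) M.ν := by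
    refine R.integrable_section hqm hbm (c := C * κ) ?_
    filter_upwards [h] with t ht
    rw [abs_mul]
    exact mul_le_mul ht.1.1 ht.2 (abs_nonneg _) hC.le
  have hi2 : Integrable (fun t => M.m₂ (t, z.2.2) * b (t, z.2.2)) M.ν := by
    refine R.integrable_section M.measurable_m₂ hbm (c := C * κ) ?_
    filter_upwards [h] with t ht
    rw [abs_mul]
    exact mul_le_mul ht.1.2 ht.2 (abs_nonneg _) hC.le
  have hi3 : Integrable (fun t => |q (t, z.2.2) - M.m₂ (t, z.2.2)|) M.ν := by
    have := R.isFiniteMeasure_ν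
    refine Integrable.of_bound (((hqm.sub M.measurable_m₂).comp
      (measurable_id.prodMk measurable_const)).abs).aestronglyMeasurable (C + C) ?_
    filter_upwards [h] with t ht
    rw [Real.norm_eq_abs, abs_abs]
    exact (abs_sub _ _).trans (add_le_add ht.1.1 ht.1.2)
  have e : M.score w q b z - M.score M.ω₂ M.m₂ b z
      = (w z.2 - M.ω₂ z.2) * b z.2 * (z.1 - q z.2) - M.ω₂ z.2 * b z.2 * (q z.2 - M.m₂ z.2)
        + ∫ t, (q (t, z.2.2) * b (t, z.2.2) - M.m₂ (t, z.2.2) * b (t, z.2.2)) ∂M.ν := by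
    rw [integral_sub hi1 hi2, score, score]; ring
  have h1 : |(w z.2 - M.ω₂ z.2) * b z.2 * (z.1 - q z.2)| ≤ |w z.2 - M.ω₂ z.2| * κ * (C + C) := by
    rw [abs_mul, abs_mul]
    have : |z.1 - q z.2| ≤ C + C := (abs_sub _ _).trans (add_le_add hy hq)
    gcongr
  have h2 : |M.ω₂ z.2 * b z.2 * (q z.2 - M.m₂ z.2)| ≤ C * κ * |q z.2 - M.m₂ z.2| := by
    rw [abs_mul, abs_mul]
    gcongr
  have h3 : |∫ t, (q (t, z.2.2) * b (t, z.2.2) - M.m₂ (t, z.2.2) * b (t, z.2.2)) ∂M.ν|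
      ≤ κ * ∫ t, |q (t, z.2.2) - M.m₂ (t, z.2.2)| ∂M.ν := by
    rw [← integral_const_mul]
    refine (abs_integral_le_integral_abs).trans (integral_mono_ae (hi1.sub hi2).abs
      (hi3.const_mul κ) ?_)
    filter_upwards [h] with t ht
    rw [← sub_mul, abs_mul, mul_comm]
    gcongr
    exact ht.2
  rw [e, scoreErr]
  refine (abs_add_le _ _).trans ((add_le_add ((abs_sub _ _).trans (add_le_add h1 h2)) h3).trans
    (le_of_eq ?_))
  ring

/-- The doubly robust property: the expectation of the score with nuisance functions `w` and `q`
is linear in `b` with integrand `m`, up to the product of the two errors. -/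
lemma integral_score {w q b : ℝ × Cov d → ℝ} (hwm : Measurable w) (hqm : Measurable q)
    (hbm : Measurable b) (hwi : Integrable w M.lawTX) {κ : ℝ}
    (hq : ∀ᵐ z ∂M.base, |q z| ≤ C) (hb : ∀ᵐ z ∂M.base, |b z| ≤ κ) :
    ∫ z, M.score w q b z ∂M.obsLaw = ∫ z, M.m₂ z * b z ∂M.base
      + ∫ z, (w z - M.ω₂ z) * b z * (M.m₂ z - q z) ∂M.lawTX := by
  have hν := R.isFiniteMeasure_ν
  have hB := R.isFiniteMeasure_base
  have hq' := M.lawTX_ac.ae_le hq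
  have hb' := M.lawTX_ac.ae_le hb
  have hmae := R.ae_abs_m_le
  have hmae' := M.lawTX_ac.ae_le hmae
  have hmb : Integrable (fun z => M.m₂ z * b z) M.base := by
    refine Integrable.of_bound (M.measurable_m₂.mul hbm).aestronglyMeasurable (C * κ) ?_
    filter_upwards [hmae, hb] with z h1 h2
    rw [norm_mul]
    exact mul_le_mul h1 h2 (abs_nonneg _) R.C_pos.le
  have hqb : Integrable (fun z => q z * b z) M.base := by
    refine Integrable.of_bound (hqm.mul hbm).aestronglyMeasurable (C * κ) ?_
    filter_upwards [hq, hb] with z h1 h2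
    rw [norm_mul]
    exact mul_le_mul h1 h2 (abs_nonneg _) R.C_pos.le
  have hωi : Integrable M.ω₂ M.lawTX := by
    refine Integrable.of_bound M.measurable_ω₂.aestronglyMeasurable C ?_
    filter_upwards [M.lawTX_ac.ae_le M.ae_base_mem] with z hz
    have := R.ω_bounds hz.1 hz.2
    rw [ω₂, Real.norm_of_nonneg this.1]; exact this.2.1
  have hwb : Integrable (fun z => w z * b z) M.lawTX :=
    hwi.mul_bdd hbm.aestronglyMeasurable hb'
  have hωb : Integrable (fun z => M.ω₂ z * b z) M.lawTX :=
    hωi.mul_bdd hbm.aestronglyMeasurable hb'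
  have hwbq : Integrable (fun z => w z * b z * q z) M.lawTX :=
    hwb.mul_bdd hqm.aestronglyMeasurable hq'
  have hwbm : Integrable (fun z => w z * b z * M.m₂ z) M.lawTX :=
    hwb.mul_bdd M.measurable_m₂.aestronglyMeasurable hmae'
  have hωbq : Integrable (fun z => M.ω₂ z * b z * q z) M.lawTX :=
    hωb.mul_bdd hqm.aestronglyMeasurable hq'
  have hωbm : Integrable (fun z => M.ω₂ z * b z * M.m₂ z) M.lawTX :=
    hωb.mul_bdd M.measurable_m₂.aestronglyMeasurable hmae'
  have hTX : M.obsLaw.map Prod.snd = M.lawTX := M.map_snd_obsLaw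
  have i1 : Integrable (fun z : Obs d => z.1 * (w z.2 * b z.2)) M.obsLaw := by
    have : Integrable (fun z : Obs d => w z.2 * b z.2) M.obsLaw := by
      rw [← hTX] at hwb
      exact hwb.comp_measurable measurable_snd
    exact this.bdd_mul measurable_fst.aestronglyMeasurable R.ae_obsLaw_abs_le
  have i2 : Integrable (fun z : Obs d => w z.2 * b z.2 * q z.2) M.obsLaw := by
    rw [← hTX] at hwbq
    exact hwbq.comp_measurable measurable_snd
  have hswap : Integrable (fun x => ∫ t, q (t, x) * b (t, x) ∂M.ν) M.lawX := by
    rw [base] at hqb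
    exact hqb.integral_prod_right
  have hsm : AEStronglyMeasurable (fun x => ∫ t, q (t, x) * b (t, x) ∂M.ν)
      (M.obsLaw.map fun z => z.2.2) := by
    rw [M.map_snd_snd_obsLaw]; exact hswap.1
  have i3 : Integrable (fun z : Obs d => ∫ t, q (t, z.2.2) * b (t, z.2.2) ∂M.ν) M.obsLaw := by
    rw [← M.map_snd_snd_obsLaw] at hswap
    exact hswap.comp_measurable measurable_snd.snd
  have e1 : ∫ z, M.score w q b z ∂M.obsLaw
      = ∫ z, z.1 * (w z.2 * b z.2) ∂M.obsLaw - ∫ z, w z.2 * b z.2 * q z.2 ∂M.obsLaw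
        + ∫ z, ∫ t, q (t, z.2.2) * b (t, z.2.2) ∂M.ν ∂M.obsLaw := by
    rw [← integral_sub i1 i2, ← integral_add (f := fun z => z.1 * (w z.2 * b z.2) - w z.2 * b z.2 * q z.2) (i1.sub i2) i3]
    refine integral_congr_ae (Eventually.of_forall fun z => ?_)
    simp only [score]; ring
  have e2 : ∫ z, z.1 * (w z.2 * b z.2) ∂M.obsLaw = ∫ z, w z * b z * M.m₂ z ∂M.lawTX := by
    rw [R.integral_Yobs_mul (h := fun z => w z * b z) (hwm.mul hbm) hwb]
    exact integral_congr_ae (Eventually.of_forall fun z => mul_comm _ _)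
  have e3 : ∫ z : Obs d, w z.2 * b z.2 * q z.2 ∂M.obsLaw = ∫ z, w z * b z * q z ∂M.lawTX := by
    rw [← hTX] at hwbq ⊢
    rw [integral_map measurable_snd.aemeasurable hwbq.1]
  have e4 : ∫ z : Obs d, ∫ t, q (t, z.2.2) * b (t, z.2.2) ∂M.ν ∂M.obsLaw
      = ∫ z, M.ω₂ z * b z * q z ∂M.lawTX := by
    have h1 := integral_map (μ := M.obsLaw) measurable_snd.snd.aemeasurable hsm
    rw [← h1, M.map_snd_snd_obsLaw]
    have h2 := R.integral_lawTX_ω fun z => q z * b z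
    have h3 : ∫ z, M.ω₂ z * b z * q z ∂M.lawTX = ∫ z, M.ω z.1 z.2 * (q z * b z) ∂M.lawTX :=
      integral_congr_ae (Eventually.of_forall fun z => by simp only [ω₂]; ring)
    rw [h3, h2]
    rw [base] at hqb ⊢
    rw [integral_prod_symm _ hqb]
  have e5 : ∫ z, M.m₂ z * b z ∂M.base = ∫ z, M.ω₂ z * b z * M.m₂ z ∂M.lawTX := by
    rw [← R.integral_lawTX_ω fun z => M.m₂ z * b z]
    exact integral_congr_ae (Eventually.of_forall fun z => by simp only [ω₂]; ring)
  have e6 : ∫ z, (w z - M.ω₂ z) * b z * (M.m₂ z - q z) ∂M.lawTX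
      = (∫ z, w z * b z * M.m₂ z ∂M.lawTX - ∫ z, w z * b z * q z ∂M.lawTX)
        - (∫ z, M.ω₂ z * b z * M.m₂ z ∂M.lawTX - ∫ z, M.ω₂ z * b z * q z ∂M.lawTX) := by
    rw [← integral_sub hwbm hwbq, ← integral_sub hωbm hωbq, ← integral_sub
      (f := fun z => w z * b z * M.m₂ z - w z * b z * q z)
      (g := fun z => M.ω₂ z * b z * M.m₂ z - M.ω₂ z * b z * q z) (hwbm.sub hwbq) (hωbm.sub hωbq)]
    exact integral_congr_ae (Eventually.of_forall fun z => by simp only; ring)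
  rw [e1, e2, e3, e4, e5, e6]
  ring

end Regular

/-- The nuisance functions `w` and `q` are within `a` and `b` of the truth in `L²`, and `q` is
bounded by `C`. -/
structure Close (M : PolicyModel d p Ω₀) (C : ℝ) (w q : ℝ × Cov d → ℝ) (a b : ℝ) : Prop where
  measurable_w : Measurable w
  measurable_q : Measurable q
  abs_q_le : ∀ z, |q z| ≤ C
  a_pos : 0 < a
  b_pos : 0 < b
  memLp_w : MemLp (fun z => w z - M.ω₂ z) 2 M.lawTX
  sq_w : ∫ z, (w z - M.ω₂ z) ^ 2 ∂M.lawTX ≤ a ^ 2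
  sq_q : ∫ z, (q z - M.m₂ z) ^ 2 ∂M.lawTX ≤ b ^ 2

namespace Regular

variable {θs : Par p} {C r : ℝ} (R : M.Regular θs C r)

include R

lemma integrable_ω₂ : Integrable M.ω₂ M.lawTX := by
  refine Integrable.of_bound M.measurable_ω₂.aestronglyMeasurable C ?_
  filter_upwards [M.lawTX_ac.ae_le M.ae_base_mem] with z hz
  have := R.ω_bounds hz.1 hz.2
  rw [ω₂, Real.norm_of_nonneg this.1]; exact this.2.1

lemma integrable_w {w q : ℝ × Cov d → ℝ} {a b : ℝ} (h : M.Close C w q a b) :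
    Integrable w M.lawTX := by
  have := (h.memLp_w.integrable one_le_two).add R.integrable_ω₂
  refine this.congr (Eventually.of_forall fun z => ?_)
  simp

lemma ae_abs_q_sub_m_le {w q : ℝ × Cov d → ℝ} {a b : ℝ} (h : M.Close C w q a b) :
    ∀ᵐ z ∂M.base, |q z - M.m₂ z| ≤ 2 * C := by
  filter_upwards [R.ae_abs_m_le] with z hz
  exact (abs_sub _ _).trans ((add_le_add (h.abs_q_le z) hz).trans_eq (by ring))

lemma memLp_q {w q : ℝ × Cov d → ℝ} {a b : ℝ} (h : M.Close C w q a b) :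
    MemLp (fun z => q z - M.m₂ z) 2 M.lawTX :=
  MemLp.of_bound (h.measurable_q.sub M.measurable_m₂).aestronglyMeasurable (2 * C)
    (M.lawTX_ac.ae_le (R.ae_abs_q_sub_m_le h))

/-- The second-order remainder of a doubly robust score. -/
lemma abs_integral_remainder_le {w q : ℝ × Cov d → ℝ} {a b : ℝ} (h : M.Close C w q a b)
    {g : ℝ × Cov d → ℝ} {κ : ℝ} (hκ : 0 ≤ κ) (hg : ∀ᵐ z ∂M.base, |g z| ≤ κ) :
    |∫ z, (w z - M.ω₂ z) * g z * (M.m₂ z - q z) ∂M.lawTX| ≤ κ * (a * b) := by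
  have h1 := integral_abs_mul_le_of_sq h.memLp_w (R.memLp_q h) h.a_pos h.b_pos h.sq_w h.sq_q
  refine (abs_integral_le_integral_abs).trans ?_
  refine le_trans ?_ (mul_le_mul_of_nonneg_left h1 hκ)
  rw [← integral_const_mul]
  have hi : Integrable (fun z => (w z - M.ω₂ z) * (q z - M.m₂ z)) M.lawTX :=
    h.memLp_w.integrable_mul (R.memLp_q h)
  refine integral_mono_of_nonneg (Eventually.of_forall fun _ => abs_nonneg _)
    (hi.abs.const_mul κ) ?_
  filter_upwards [M.lawTX_ac.ae_le hg] with z hz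
  rw [abs_mul, abs_mul, abs_mul, abs_sub_comm (M.m₂ z)]
  calc |w z - M.ω₂ z| * |g z| * |q z - M.m₂ z| ≤ |w z - M.ω₂ z| * κ * |q z - M.m₂ z| := by gcongr
    _ = _ := by ring

lemma integral_base_le {g : ℝ × Cov d → ℝ} (hg : ∀ z, 0 ≤ g z) (hi : Integrable g M.lawTX) :
    ∫ z, g z ∂M.base ≤ C * ∫ z, g z ∂M.lawTX := by
  have h1 := integral_mono_measure R.base_le (Eventually.of_forall hg)
    (hi.smul_measure ENNReal.ofReal_ne_top)
  rw [integral_smul_measure, ENNReal.toReal_ofReal R.C_pos.le, smul_eq_mul] at h1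
  exact h1

lemma integral_abs_q_sub_m_base_le {w q : ℝ × Cov d → ℝ} {a b : ℝ} (h : M.Close C w q a b) :
    ∫ z, |q z - M.m₂ z| ∂M.base ≤ C * b := by
  have h1 := integral_abs_le_of_sq (R.memLp_q h) h.b_pos h.sq_q
  refine (R.integral_base_le (fun _ => abs_nonneg _)
    ((R.memLp_q h).integrable one_le_two).abs).trans ?_
  exact mul_le_mul_of_nonneg_left h1 R.C_pos.le

lemma integrable_integral_abs {w q : ℝ × Cov d → ℝ} {a b : ℝ} (h : M.Close C w q a b) :
    Integrable (fun z : Obs d => ∫ t, |q (t, z.2.2) - M.m₂ (t, z.2.2)| ∂M.ν) M.obsLaw ∧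
    ∫ z : Obs d, ∫ t, |q (t, z.2.2) - M.m₂ (t, z.2.2)| ∂M.ν ∂M.obsLaw ≤ C * b := by
  have hν := R.isFiniteMeasure_ν
  have hB := R.isFiniteMeasure_base
  have hi : Integrable (fun z => |q z - M.m₂ z|) M.base := by
    refine Integrable.of_bound
      ((h.measurable_q.sub M.measurable_m₂).abs).aestronglyMeasurable (2 * C) ?_
    simpa using R.ae_abs_q_sub_m_le h
  have h1 := R.integral_abs_q_sub_m_base_le h
  rw [base] at hi h1
  have hs := hi.integral_prod_right
  rw [integral_prod_symm _ hi] at h1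
  rw [← M.map_snd_snd_obsLaw] at hs h1
  rw [integral_map measurable_snd.snd.aemeasurable hs.1] at h1
  exact ⟨hs.comp_measurable measurable_snd.snd, h1⟩

lemma integral_abs_section_nonneg_le {w q : ℝ × Cov d → ℝ} {a b : ℝ} (h : M.Close C w q a b) :
    ∀ᵐ z ∂M.obsLaw, 0 ≤ ∫ t, |q (t, z.2.2) - M.m₂ (t, z.2.2)| ∂M.ν ∧
      ∫ t, |q (t, z.2.2) - M.m₂ (t, z.2.2)| ∂M.ν ≤ 2 * C ^ 2 := by
  have hν := R.isFiniteMeasure_ν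
  filter_upwards [M.ae_obsLaw (R.ae_abs_q_sub_m_le h)] with z hz
  refine ⟨integral_nonneg fun _ => abs_nonneg _, ?_⟩
  have h1 : ‖∫ t, |q (t, z.2.2) - M.m₂ (t, z.2.2)| ∂M.ν‖ ≤ 2 * C * M.ν.real Set.univ := by
    refine norm_integral_le_of_norm_le_const ?_
    filter_upwards [hz.2] with t ht
    rwa [Real.norm_eq_abs, abs_abs]
  refine (le_abs_self _).trans (h1.trans ?_)
  have := R.ν_real_le
  have := R.C_pos
  nlinarith

omit R in
lemma memLp_comp_snd {g : ℝ × Cov d → ℝ} (hg : MemLp g 2 M.lawTX) :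
    MemLp (fun z : Obs d => g z.2) 2 M.obsLaw := by
  rw [← M.map_snd_obsLaw] at hg
  exact hg.comp_of_map measurable_snd.aemeasurable

omit R in
lemma integral_comp_snd {g : ℝ × Cov d → ℝ} (hg : Measurable g) :
    ∫ z : Obs d, g z.2 ∂M.obsLaw = ∫ z, g z ∂M.lawTX := by
  rw [← M.map_snd_obsLaw, integral_map measurable_snd.aemeasurable hg.aestronglyMeasurable]

/-- The error bound of a score is small in `L²`. -/
lemma scoreErr_sq {w q : ℝ × Cov d → ℝ} {a b : ℝ} (h : M.Close C w q a b) :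
    MemLp (M.scoreErr C w q) 2 M.obsLaw ∧
    ∫ z, M.scoreErr C w q z ^ 2 ∂M.obsLaw
      ≤ 12 * C ^ 2 * a ^ 2 + 3 * C ^ 2 * b ^ 2 + 6 * C ^ 3 * b := by
  have hC := R.C_pos
  obtain ⟨hi, hle⟩ := R.integrable_integral_abs h
  have hsec := R.integral_abs_section_nonneg_le h
  have m1 : MemLp (fun z : Obs d => 2 * C * |w z.2 - M.ω₂ z.2|) 2 M.obsLaw :=
    (memLp_comp_snd h.memLp_w).abs.const_mul _
  have m2 : MemLp (fun z : Obs d => C * |q z.2 - M.m₂ z.2|) 2 M.obsLaw :=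
    (memLp_comp_snd (R.memLp_q h)).abs.const_mul _
  have m3 : MemLp (fun z : Obs d => ∫ t, |q (t, z.2.2) - M.m₂ (t, z.2.2)| ∂M.ν) 2 M.obsLaw := by
    refine MemLp.of_bound hi.1 (2 * C ^ 2) ?_
    filter_upwards [hsec] with z hz
    rw [Real.norm_of_nonneg hz.1]
    exact hz.2
  have hm : MemLp (M.scoreErr C w q) 2 M.obsLaw := (m1.add m2).add m3
  refine ⟨hm, ?_⟩
  have j1 : Integrable (fun z : Obs d => 12 * C ^ 2 * (w z.2 - M.ω₂ z.2) ^ 2) M.obsLaw :=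
    (memLp_comp_snd h.memLp_w).integrable_sq.const_mul _
  have j2 : Integrable (fun z : Obs d => 3 * C ^ 2 * (q z.2 - M.m₂ z.2) ^ 2) M.obsLaw :=
    (memLp_comp_snd (R.memLp_q h)).integrable_sq.const_mul _
  have j3 := hi.const_mul (6 * C ^ 2)
  have h1 : ∫ z, M.scoreErr C w q z ^ 2 ∂M.obsLaw
      ≤ ∫ z, (12 * C ^ 2 * (w z.2 - M.ω₂ z.2) ^ 2 + 3 * C ^ 2 * (q z.2 - M.m₂ z.2) ^ 2
        + 6 * C ^ 2 * ∫ t, |q (t, z.2.2) - M.m₂ (t, z.2.2)| ∂M.ν) ∂M.obsLaw := by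
    refine integral_mono_ae hm.integrable_sq ((j1.add j2).add j3) ?_
    filter_upwards [hsec] with z hz
    simp only [scoreErr]
    rw [← sq_abs (w z.2 - M.ω₂ z.2), ← sq_abs (q z.2 - M.m₂ z.2)]
    set x := |w z.2 - M.ω₂ z.2|
    set y := |q z.2 - M.m₂ z.2|
    set v := ∫ t, |q (t, z.2.2) - M.m₂ (t, z.2.2)| ∂M.ν
    have hv : v ^ 2 ≤ 2 * C ^ 2 * v := by rw [sq]; exact mul_le_mul_of_nonneg_right hz.2 hz.1
    nlinarith [sq_nonneg (2 * C * x - C * y), sq_nonneg (2 * C * x - v), sq_nonneg (C * y - v)]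
  refine h1.trans ?_
  rw [integral_add (f := fun z : Obs d => 12 * C ^ 2 * (w z.2 - M.ω₂ z.2) ^ 2
      + 3 * C ^ 2 * (q z.2 - M.m₂ z.2) ^ 2) (j1.add j2) j3,
    integral_add j1 j2, integral_const_mul, integral_const_mul, integral_const_mul,
    integral_comp_snd (g := fun z => (w z - M.ω₂ z) ^ 2)
      ((h.measurable_w.sub M.measurable_ω₂).pow_const 2),
    integral_comp_snd (g := fun z => (q z - M.m₂ z) ^ 2)
      ((h.measurable_q.sub M.measurable_m₂).pow_const 2)]
  have k1 := mul_le_mul_of_nonneg_left h.sq_w (by positivity : 0 ≤ 12 * C ^ 2)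
  have k2 := mul_le_mul_of_nonneg_left h.sq_q (by positivity : 0 ≤ 3 * C ^ 2)
  have k3 := mul_le_mul_of_nonneg_left hle (by positivity : 0 ≤ 6 * C ^ 2)
  have k4 : 6 * C ^ 2 * (C * b) = 6 * C ^ 3 * b := by ring
  linarith

end Regular

end PolicyModel

/-! ### Differentiability of the scores in the policy parameter -/

lemma mem_ball_add {E : Type*} [SeminormedAddCommGroup E] {x h : E} {r : ℝ} (hh : ‖h‖ < r) :
    x + h ∈ Metric.ball x r := by
  simpa [Metric.mem_ball, dist_eq_norm] using hh

namespace PolicyModel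

variable {d p : ℕ} {Ω₀ : Type*} [MeasurableSpace Ω₀] (M : PolicyModel d p Ω₀)

/-- The influence function `φ̇`, with the gradient of the policy density replaced by a function `g`
on pairs `(t, x)`. It is used with a measurable version `g` of the gradient. -/
def influence (g : ℝ × Cov d → Par p) (z : Obs d) : Par p :=
  (M.ω₂ z.2 * (z.1 - M.m₂ z.2)) • g z.2 + ∫ t, M.m₂ (t, z.2.2) • g (t, z.2.2) ∂M.ν

/-- The remainder of the linearization at `θs` of the score in the policy parameter. -/
def scoreRem (θs : Par p) (g : ℝ × Cov d → Par p) (w q : ℝ × Cov d → ℝ) (h : Par p) (z : Obs d) : ℝ :=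
  M.score w q (fun y => M.pol₂ (θs + h) y - M.pol₂ θs y) z - inner ℝ (M.influence g z) h

variable {M}

lemma measurable_influence {g : ℝ × Cov d → Par p} (hg : Measurable g) :
    Measurable (M.influence g) := by
  have h1 : Measurable fun y : Obs d × ℝ => M.m₂ (y.2, y.1.2.2) • g (y.2, y.1.2.2) :=
    (M.measurable_m₂.comp (measurable_snd.prodMk measurable_fst.snd.snd)).smul
      (hg.comp (measurable_snd.prodMk measurable_fst.snd.snd))
  have h2 := h1.stronglyMeasurable.integral_prod_right' (ν := M.ν)
  exact (((M.measurable_ω₂.comp measurable_snd).mul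
    (measurable_fst.sub (M.measurable_m₂.comp measurable_snd))).smul
      (hg.comp measurable_snd)).add h2.measurable

/-- The properties of a measurable version `g` of the gradient `∂_θ π_θs`. -/
structure GradVersion (M : PolicyModel d p Ω₀) (θs : Par p) (C : ℝ) (g : ℝ × Cov d → Par p) :
    Prop where
  measurable : Measurable g
  ae_eq : ∀ᵐ z ∂M.base, g z = M.dpol θs z.1 z.2
  norm_le : ∀ᵐ z ∂M.base, ‖g z‖ ≤ C

namespace Regular

variable {θs : Par p} {C r : ℝ} (R : M.Regular θs C r)

include R

lemma ae_lipschitz : ∀ᵐ z ∂M.base, ∀ θ ∈ Metric.ball θs r, ∀ θ' ∈ Metric.ball θs r,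
    |M.pol₂ θ z - M.pol₂ θ' z| ≤ C * ‖θ - θ'‖ := by
  filter_upwards [R.diff] with z hz θ hθ θ' hθ'
  have h := (convex_ball θs r).norm_image_sub_le_of_norm_fderiv_le (𝕜 := ℝ) (C := C)
    (f := fun θ => M.pol θ z.1 z.2) (fun x hx => (hz x hx).1) (fun x hx => ?_) hθ' hθ
  · exact h
  · have h2 := (hz x hx).2
    rwa [dpol, gradient, LinearIsometryEquiv.norm_map] at h2

lemma mem_ball_self : θs ∈ Metric.ball θs r := Metric.mem_ball_self R.r_pos

lemma mem_Θ {h : Par p} (hh : ‖h‖ < r) : θs + h ∈ M.Θ := R.ball_subset (mem_ball_add hh)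

lemma tendsto_diffQuot (v : Par p) : ∀ᵐ z ∂M.base,
    Tendsto (fun δ : ℝ => δ⁻¹ * (M.pol₂ (θs + δ • v) z - M.pol₂ θs z)) (𝓝[≠] 0)
      (𝓝 (inner ℝ (M.dpol θs z.1 z.2) v)) := by
  filter_upwards [R.diff] with z hz
  have h1 := (hz θs R.mem_ball_self).1.hasGradientAt.hasFDerivAt.hasLineDerivAt v
  have h2 := hasLineDerivAt_iff_tendsto_slope_zero.1 h1
  simpa [dpol, pol₂] using h2

lemma exists_gradVersion : ∃ g, M.GradVersion θs C g := by
  have hB := R.isFiniteMeasure_base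
  have hae : AEMeasurable (fun z : ℝ × Cov d => M.dpol θs z.1 z.2) M.base := by
    have hco : ∀ i : Fin p, AEMeasurable (fun z : ℝ × Cov d => M.dpol θs z.1 z.2 i) M.base := by
      intro i
      have hlim : Tendsto (fun n : ℕ => (1 / ((n : ℝ) + 1))) atTop (𝓝[≠] 0) :=
        tendsto_nhdsWithin_iff.2 ⟨tendsto_one_div_add_atTop_nhds_zero_nat,
          Eventually.of_forall fun n => (by positivity : (1 / ((n : ℝ) + 1)) ≠ 0)⟩
      refine aemeasurable_of_tendsto_metrizable_ae atTop (f := fun (n : ℕ) z =>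
        (1 / ((n : ℝ) + 1))⁻¹ * (M.pol₂ (θs + (1 / ((n : ℝ) + 1)) • EuclideanSpace.single i 1) z
          - M.pol₂ θs z)) (fun n => ?_) ?_
      · exact (((M.measurable_pol₂ _).sub (M.measurable_pol₂ _)).const_mul _).aemeasurable
      · filter_upwards [R.tendsto_diffQuot (EuclideanSpace.single i 1)] with z hz
        have h1 := hz.comp hlim
        have h2 : inner ℝ (M.dpol θs z.1 z.2) (EuclideanSpace.single i (1 : ℝ))
            = M.dpol θs z.1 z.2 i := by simp [EuclideanSpace.inner_single_right]
        rw [h2] at h1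
        exact h1
    have h2 : AEMeasurable (fun z : ℝ × Cov d => (M.dpol θs z.1 z.2).ofLp) M.base :=
      aemeasurable_pi_iff.2 hco
    exact (WithLp.measurable_toLp 2 (Fin p → ℝ)).comp_aemeasurable h2
  refine ⟨hae.mk _, hae.measurable_mk, ?_, ?_⟩
  · filter_upwards [hae.ae_eq_mk] with z hz using hz.symm
  · filter_upwards [hae.ae_eq_mk, R.diff] with z hz hz2
    rw [← hz]
    exact (hz2 θs R.mem_ball_self).2

lemma ae_good : ∀ᵐ z ∂M.obsLaw, |z.1| ≤ C ∧ z.2.1 ∈ M.𝒯 ∧ z.2.2 ∈ M.𝒳 ∧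
    |M.m₂ z.2| ≤ C ∧ |M.ω₂ z.2| ≤ C ∧ (∀ᵐ t ∂M.ν, |M.m₂ (t, z.2.2)| ≤ C) ∧
    ∀ᵐ t ∂M.ν, t ∈ M.𝒯 := by
  filter_upwards [R.ae_obsLaw_abs_le, M.ae_obsLaw M.ae_base_mem, M.ae_obsLaw R.ae_abs_m_le]
    with z h1 h2 h3
  refine ⟨h1, h2.1.1, h2.1.2, h3.1, ?_, h3.2, M.ae_ν_mem⟩
  have := R.ω_bounds h2.1.1 h2.1.2
  rw [ω₂, abs_of_nonneg this.1]; exact this.2.1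

variable {g : ℝ × Cov d → Par p} (G : M.GradVersion θs C g)

include G

lemma ae_influence : ∀ᵐ z ∂M.obsLaw, M.influence g z = M.phiDot θs z ∧
    ‖M.influence g z‖ ≤ 3 * C ^ 3 ∧
    ∀ v, inner ℝ (M.influence g z) v = M.score M.ω₂ M.m₂ (fun y => inner ℝ (g y) v) z := by
  have hν := R.isFiniteMeasure_ν
  have hC := R.C_pos
  filter_upwards [R.ae_good, M.ae_obsLaw G.ae_eq, M.ae_obsLaw G.norm_le] with z h1 h2 h3
  obtain ⟨hy, ht, hx, hm, hω, hms, -⟩ := h1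
  have hb : ∀ᵐ t ∂M.ν, ‖M.m₂ (t, z.2.2) • g (t, z.2.2)‖ ≤ C * C := by
    filter_upwards [hms, h3.2] with t h4 h5
    rw [norm_smul]
    exact mul_le_mul h4 h5 (norm_nonneg _) hC.le
  have hmm : Measurable fun t : ℝ => M.m₂ (t, z.2.2) • g (t, z.2.2) :=
    (M.measurable_m₂.comp (measurable_id.prodMk measurable_const)).smul
      (G.measurable.comp (measurable_id.prodMk measurable_const))
  have hint : Integrable (fun t => M.m₂ (t, z.2.2) • g (t, z.2.2)) M.ν :=
    Integrable.of_bound hmm.aestronglyMeasurable (C * C) hb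
  refine ⟨?_, ?_, fun v => ?_⟩
  · rw [influence, phiDot, add_comm]
    congr 1
    · refine integral_congr_ae ?_
      filter_upwards [h2.2] with t h4
      rw [h4, m₂]
    · rw [h2.1, ω₂, m₂, ω]
      congr 1
      ring
  · rw [influence]
    have h4 : ‖(M.ω₂ z.2 * (z.1 - M.m₂ z.2)) • g z.2‖ ≤ C * (C + C) * C := by
      rw [norm_smul, norm_mul, Real.norm_eq_abs, Real.norm_eq_abs]
      have : |z.1 - M.m₂ z.2| ≤ C + C := (abs_sub _ _).trans (add_le_add hy hm)
      have := h3.1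
      gcongr
    have h5 : ‖∫ t, M.m₂ (t, z.2.2) • g (t, z.2.2) ∂M.ν‖ ≤ C * C * M.ν.real Set.univ :=
      norm_integral_le_of_norm_le_const hb
    have h6 : C * C * M.ν.real Set.univ ≤ C * C * C := by gcongr; exact R.ν_real_le
    refine (norm_add_le _ _).trans ((add_le_add h4 (h5.trans h6)).trans (le_of_eq (by ring)))
  · rw [influence, score, inner_add_left, real_inner_smul_left]
    congr 1
    · ring
    · rw [real_inner_comm, ← integral_inner hint v]
      refine integral_congr_ae (Eventually.of_forall fun t => ?_)
      simp only [real_inner_smul_right, real_inner_comm]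

/-- The difference between a difference quotient of the policy density and its limit. -/
def _root_.PolicyModel.quotErr (M : PolicyModel d p Ω₀) (θs : Par p) (g : ℝ × Cov d → Par p)
    (v : Par p) (δ : ℝ) (z : ℝ × Cov d) : ℝ :=
  δ⁻¹ * (M.pol₂ (θs + δ • v) z - M.pol₂ θs z) - inner ℝ (g z) v

omit R in
lemma measurable_quotErr (v : Par p) (δ : ℝ) : Measurable (M.quotErr θs g v δ) := by
  have := G.measurable
  exact (((M.measurable_pol₂ _).sub (M.measurable_pol₂ _)).const_mul _).sub (by fun_prop)

lemma tendsto_quotErr (v : Par p) : ∀ᵐ z ∂M.base,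
    Tendsto (fun δ => M.quotErr θs g v δ z) (𝓝[>] 0) (𝓝 0) := by
  filter_upwards [R.tendsto_diffQuot v, G.ae_eq] with z h1 h2
  have h3 := (h1.mono_left (nhdsGT_le_nhdsNE (0 : ℝ))).sub_const
    (inner ℝ (g z) v)
  rw [h2, sub_self] at h3
  simpa only [quotErr, h2] using h3

omit G in
lemma eventually_small (v : Par p) : ∀ᶠ δ in 𝓝[>] (0 : ℝ), 0 < δ ∧ ‖δ • v‖ < r := by
  have h1 : Tendsto (fun δ : ℝ => ‖δ • v‖) (𝓝[>] 0) (𝓝 0) := by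
    have : Continuous fun δ : ℝ => ‖δ • v‖ := by fun_prop
    simpa using (this.tendsto 0).mono_left nhdsWithin_le_nhds
  exact (eventually_mem_nhdsWithin).and (h1.eventually_lt_const R.r_pos)

lemma abs_quotErr_le (v : Par p) : ∀ᵐ z ∂M.base, ∀ δ : ℝ, 0 < δ → ‖δ • v‖ < r →
    |M.quotErr θs g v δ z| ≤ 2 * C * ‖v‖ := by
  filter_upwards [R.ae_lipschitz, G.norm_le] with z h1 h2 δ hδ hδv
  have h3 := h1 _ (mem_ball_add hδv) _ R.mem_ball_self
  rw [add_sub_cancel_left, norm_smul, Real.norm_of_nonneg hδ.le] at h3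
  have h4 : |inner ℝ (g z) v| ≤ C * ‖v‖ :=
    (abs_real_inner_le_norm _ _).trans (mul_le_mul_of_nonneg_right h2 (norm_nonneg _))
  have h5 : |δ⁻¹ * (M.pol₂ (θs + δ • v) z - M.pol₂ θs z)| ≤ C * ‖v‖ := by
    rw [abs_mul, abs_of_pos (inv_pos.2 hδ), inv_mul_le_iff₀ hδ]
    linarith
  rw [quotErr]
  refine (abs_sub _ _).trans ((add_le_add h5 h4).trans (le_of_eq (by ring)))

/-- Differentiability in `L²` of the score in the policy parameter. -/
lemma tendsto_integral_score_quotErr_sq (v : Par p) :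
    Tendsto (fun δ => ∫ z, M.score M.ω₂ M.m₂ (M.quotErr θs g v δ) z ^ 2 ∂M.obsLaw) (𝓝[>] 0)
      (𝓝 0) := by
  have hν := R.isFiniteMeasure_ν
  have hC := R.C_pos
  have hbd : 0 ≤ 2 * C * ‖v‖ := by positivity
  suffices h : Tendsto (fun δ => ∫ z, M.score M.ω₂ M.m₂ (M.quotErr θs g v δ) z ^ 2 ∂M.obsLaw)
      (𝓝[>] 0) (𝓝 (∫ _z : Obs d, (0 : ℝ) ∂M.obsLaw)) by simpa using h
  refine tendsto_integral_filter_of_dominated_convergence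
    (fun _ => ((2 * C * ‖v‖) * (3 * C ^ 2)) ^ 2) ?_ ?_ (integrable_const _) ?_
  · refine Eventually.of_forall fun δ => ?_
    exact ((M.measurable_score M.measurable_ω₂ M.measurable_m₂
      (measurable_quotErr G v δ)).pow_const 2).aestronglyMeasurable
  · filter_upwards [R.eventually_small v] with δ hδ
    filter_upwards [R.ae_good, M.ae_obsLaw (R.abs_quotErr_le G v)] with z h1 h2
    obtain ⟨hy, ht, hx, hm, hω, hms, -⟩ := h1
    rw [norm_pow]
    refine pow_le_pow_left₀ (norm_nonneg _) ?_ 2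
    refine (R.abs_score_le hbd hy hm (h2.1 δ hδ.1 hδ.2) ?_).trans ?_
    · filter_upwards [hms, h2.2] with t h3 h4 using ⟨h3, h4 δ hδ.1 hδ.2⟩
    · gcongr
      nlinarith
  · filter_upwards [R.ae_good, M.ae_obsLaw (R.abs_quotErr_le G v),
      M.ae_obsLaw (R.tendsto_quotErr G v)] with z h1 h2 h3
    obtain ⟨hy, ht, hx, hm, hω, hms, -⟩ := h1
    have e1 : Tendsto (fun δ => M.ω₂ z.2 * M.quotErr θs g v δ z.2 * (z.1 - M.m₂ z.2)) (𝓝[>] 0)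
        (𝓝 (M.ω₂ z.2 * 0 * (z.1 - M.m₂ z.2))) := (h3.1.const_mul _).mul_const _
    have e2 : Tendsto (fun δ => ∫ t, M.m₂ (t, z.2.2) * M.quotErr θs g v δ (t, z.2.2) ∂M.ν) (𝓝[>] 0)
        (𝓝 (∫ _t, (0 : ℝ) ∂M.ν)) := by
      refine tendsto_integral_filter_of_dominated_convergence (fun _ => C * (2 * C * ‖v‖)) ?_ ?_
        (integrable_const _) ?_
      · refine Eventually.of_forall fun δ => ?_
        exact ((M.measurable_m₂.comp (measurable_id.prodMk measurable_const)).mul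
          ((measurable_quotErr G v δ).comp
            (measurable_id.prodMk measurable_const))).aestronglyMeasurable
      · filter_upwards [R.eventually_small v] with δ hδ
        filter_upwards [hms, h2.2] with t h4 h5
        rw [norm_mul]
        exact mul_le_mul h4 (h5 δ hδ.1 hδ.2) (norm_nonneg _) hC.le
      · filter_upwards [h3.2] with t h4
        simpa using h4.const_mul (M.m₂ (t, z.2.2))
    have e3 := (e1.add e2).pow 2
    simpa [score] using e3

/-- The welfare is differentiated under the integral; at a critical point the influence function
is centred. -/
lemma integral_inner_influence [StandardBorelSpace Ω₀] [Nonempty Ω₀] (hU : M.Unconfounded)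
    (hd : DifferentiableAt ℝ M.welfare θs) (h0 : ∇ M.welfare θs = 0) (v : Par p) :
    ∫ z, inner ℝ (M.influence g z) v ∂M.obsLaw = 0 := by
  have hB := R.isFiniteMeasure_base
  have hν := R.isFiniteMeasure_ν
  have hC := R.C_pos
  have hgm := G.measurable
  have hgb : ∀ᵐ z ∂M.base, |inner ℝ (g z) v| ≤ C * ‖v‖ := by
    filter_upwards [G.norm_le] with z hz
    exact (abs_real_inner_le_norm _ _).trans (mul_le_mul_of_nonneg_right hz (norm_nonneg _))
  have e1 : ∫ z, inner ℝ (M.influence g z) v ∂M.obsLaw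
      = ∫ z, M.m₂ z * inner ℝ (g z) v ∂M.base := by
    have h1 : ∫ z, inner ℝ (M.influence g z) v ∂M.obsLaw
        = ∫ z, M.score M.ω₂ M.m₂ (fun y => inner ℝ (g y) v) z ∂M.obsLaw := by
      refine integral_congr_ae ?_
      filter_upwards [R.ae_influence G] with z hz using hz.2.2 v
    rw [h1, R.integral_score M.measurable_ω₂ M.measurable_m₂ (by fun_prop) R.integrable_ω₂
      R.ae_abs_m_le hgb]
    simp
  rw [e1]
  -- the difference quotients of the welfare tend to the integral, and to zero
  have hm2 : ∀ᵐ z ∂M.base, |M.m₂ z| ≤ C := R.ae_abs_m_le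
  have hib : ∀ b : ℝ × Cov d → ℝ, Measurable b → ∀ κ, (∀ᵐ z ∂M.base, |b z| ≤ κ) →
      Integrable (fun z => M.m₂ z * b z) M.base := by
    intro b hb κ hκ
    refine Integrable.of_bound (M.measurable_m₂.mul hb).aestronglyMeasurable (C * κ) ?_
    filter_upwards [hm2, hκ] with z h1 h2
    rw [norm_mul]
    exact mul_le_mul h1 h2 (abs_nonneg _) hC.le
  have lim1 : Tendsto (fun δ => ∫ z, M.m₂ z * M.quotErr θs g v δ z ∂M.base) (𝓝[>] 0) (𝓝 0) := by
    suffices h : Tendsto (fun δ => ∫ z, M.m₂ z * M.quotErr θs g v δ z ∂M.base)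
        (𝓝[>] 0) (𝓝 (∫ _z : ℝ × Cov d, (0 : ℝ) ∂M.base)) by simpa using h
    refine tendsto_integral_filter_of_dominated_convergence (fun _ => C * (2 * C * ‖v‖)) ?_ ?_
        (integrable_const _) ?_
    · exact Eventually.of_forall fun δ =>
        (M.measurable_m₂.mul (measurable_quotErr G v δ)).aestronglyMeasurable
    · filter_upwards [R.eventually_small v] with δ hδ
      filter_upwards [hm2, R.abs_quotErr_le G v] with t h4 h5
      rw [norm_mul]
      exact mul_le_mul h4 (h5 δ hδ.1 hδ.2) (norm_nonneg _) hC.le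
    · filter_upwards [R.tendsto_quotErr G v] with z h4
      simpa using h4.const_mul (M.m₂ z)
  have lim2 : Tendsto (fun δ : ℝ => δ⁻¹ * (M.welfare (θs + δ • v) - M.welfare θs)) (𝓝[>] 0)
      (𝓝 0) := by
    have h1 := hd.hasGradientAt.hasFDerivAt.hasLineDerivAt v
    have h2 := hasLineDerivAt_iff_tendsto_slope_zero.1 h1
    rw [h0] at h2
    have h3 := h2.mono_left (nhdsGT_le_nhdsNE (0 : ℝ))
    simpa using h3
  have hpol : ∀ θ ∈ M.Θ, ∀ᵐ z ∂M.base, |M.pol₂ θ z| ≤ C := by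
    intro θ hθ
    filter_upwards [M.ae_base_mem] with z hz
    rw [pol₂, abs_of_nonneg (M.pol_nonneg θ hθ _ hz.1 _ hz.2)]
    exact R.pol_le θ hθ _ hz.1 _ hz.2
  have e2 : (fun δ => ∫ z, M.m₂ z * M.quotErr θs g v δ z ∂M.base) =ᶠ[𝓝[>] 0]
      fun δ => δ⁻¹ * (M.welfare (θs + δ • v) - M.welfare θs)
        - ∫ z, M.m₂ z * inner ℝ (g z) v ∂M.base := by
    filter_upwards [R.eventually_small v] with δ hδ
    have hin := R.mem_Θ hδ.2
    have hin0 := R.ball_subset R.mem_ball_self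
    have i1 := hib _ (M.measurable_pol₂ _) _ (hpol _ hin)
    have i2 := hib _ (M.measurable_pol₂ _) _ (hpol _ hin0)
    have i3 := hib _ (by fun_prop) _ hgb
    rw [hU.welfare_eq R hin, hU.welfare_eq R hin0]
    have : ∫ z, M.m₂ z * M.quotErr θs g v δ z ∂M.base
        = ∫ z, (δ⁻¹ * (M.m₂ z * M.pol₂ (θs + δ • v) z - M.m₂ z * M.pol₂ θs z)
          - M.m₂ z * inner ℝ (g z) v) ∂M.base :=
      integral_congr_ae (Eventually.of_forall fun z => by simp only [quotErr]; ring)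
    have i4 : Integrable (fun z => δ⁻¹ * (M.m₂ z * M.pol₂ (θs + δ • v) z - M.m₂ z * M.pol₂ θs z))
        M.base := (i1.sub i2).const_mul _
    rw [this, integral_sub i4 i3, integral_const_mul, integral_sub i1 i2]
    rfl
  have lim3 := (lim2.sub_const (∫ z, M.m₂ z * inner ℝ (g z) v ∂M.base)).congr' e2.symm
  have := tendsto_nhds_unique lim1 lim3
  linarith

end Regular

end PolicyModel

/-! ### Remainders of the linearized scores -/

namespace PolicyModel

variable {d p : ℕ} {Ω₀ : Type*} [MeasurableSpace Ω₀] {M : PolicyModel d p Ω₀}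

lemma measurable_scoreRem_param {𝒟 : Type*} [MeasurableSpace 𝒟] {w q : 𝒟 → ℝ × Cov d → ℝ}
    (hw : Measurable (Function.uncurry w)) (hq : Measurable (Function.uncurry q))
    {g : ℝ × Cov d → Par p} (hg : Measurable g) (θs h : Par p) :
    Measurable fun y : 𝒟 × Obs d => M.scoreRem θs g (w y.1) (q y.1) h y.2 := by
  have h1 := M.measurable_score_param hw hq
    ((M.measurable_pol₂ (θs + h)).sub (M.measurable_pol₂ θs))
  have h2 : Measurable fun y : 𝒟 × Obs d => M.influence g y.2 :=
    (measurable_influence hg).comp measurable_snd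
  exact h1.sub (by fun_prop)

lemma measurable_scoreRem {w q : ℝ × Cov d → ℝ} (hw : Measurable w) (hq : Measurable q)
    {g : ℝ × Cov d → Par p} (hg : Measurable g) (θs h : Par p) :
    Measurable (M.scoreRem θs g w q h) :=
  (measurable_scoreRem_param (𝒟 := Unit) (w := fun _ => w) (q := fun _ => q)
    (hw.comp measurable_snd) (hq.comp measurable_snd) hg θs h).comp
      (measurable_const (a := ()) |>.prodMk measurable_id)

lemma scoreRem_zero (θs : Par p) (g : ℝ × Cov d → Par p) (w q : ℝ × Cov d → ℝ) (z : Obs d) :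
    M.scoreRem θs g w q 0 z = 0 := by
  simp [scoreRem, score]

namespace Regular

variable {θs : Par p} {C r : ℝ} (R : M.Regular θs C r)

include R

lemma ae_abs_pol_le {θ : Par p} (hθ : θ ∈ M.Θ) : ∀ᵐ z ∂M.base, |M.pol₂ θ z| ≤ C := by
  filter_upwards [M.ae_base_mem] with z hz
  rw [pol₂, abs_of_nonneg (M.pol_nonneg θ hθ _ hz.1 _ hz.2)]
  exact R.pol_le θ hθ _ hz.1 _ hz.2

/-- The score of a difference of two policy densities is the difference of the scores. -/
lemma score_pol_sub {q : ℝ × Cov d → ℝ} (w : ℝ × Cov d → ℝ) (hqm : Measurable q) {z : Obs d}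
    (hx : z.2.2 ∈ M.𝒳) (hq : ∀ᵐ t ∂M.ν, |q (t, z.2.2)| ≤ C) {θ θ' : Par p} (hθ : θ ∈ M.Θ)
    (hθ' : θ' ∈ M.Θ) :
    M.score w q (fun y => M.pol₂ θ y - M.pol₂ θ' y) z
      = M.score w q (M.pol₂ θ) z - M.score w q (M.pol₂ θ') z := by
  have key : ∀ θ ∈ M.Θ, Integrable (fun t => q (t, z.2.2) * M.pol₂ θ (t, z.2.2)) M.ν := by
    intro θ hθ
    refine R.integrable_section hqm (M.measurable_pol₂ θ) (c := C * C) ?_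
    filter_upwards [hq, M.ae_ν_mem] with t h1 h2
    rw [abs_mul]
    refine mul_le_mul h1 ?_ (abs_nonneg _) R.C_pos.le
    rw [pol₂, abs_of_nonneg (M.pol_nonneg θ hθ _ h2 _ hx)]
    exact R.pol_le θ hθ _ h2 _ hx
  exact M.score_sub (key θ hθ) (key θ' hθ')

variable {g : ℝ × Cov d → Par p} (G : M.GradVersion θs C g)

include G

/-- The remainders are Lipschitz in the local parameter, for all nuisance functions simultaneously. The
Lipschitz constant at an observation involves the error of the weight there, which need not be
bounded. -/
lemma ae_abs_scoreRem_sub_le : ∀ᵐ z ∂M.obsLaw, ∀ (w q : ℝ × Cov d → ℝ) (a b : ℝ),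
    M.Close C w q a b → ∀ h h' : Par p, ‖h‖ < r → ‖h'‖ < r →
    |M.scoreRem θs g w q h z - M.scoreRem θs g w q h' z|
      ≤ (2 * C ^ 2 * |w z.2 - M.ω₂ z.2| + 6 * C ^ 3) * ‖h - h'‖ := by
  have hC := R.C_pos
  filter_upwards [R.ae_good, M.ae_obsLaw R.ae_lipschitz, R.ae_influence G]
    with z h1 h2 h3 w q a b cl h h' hh hh'
  obtain ⟨hy, ht, hx, hm, hω, hms, hts⟩ := h1
  have hqs : ∀ᵐ t ∂M.ν, |q (t, z.2.2)| ≤ C := Eventually.of_forall fun t => cl.abs_q_le _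
  have hin := R.mem_Θ hh
  have hin' := R.mem_Θ hh'
  have hin0 := R.ball_subset R.mem_ball_self
  have e1 : M.scoreRem θs g w q h z - M.scoreRem θs g w q h' z
      = M.score w q (fun y => M.pol₂ (θs + h) y - M.pol₂ (θs + h') y) z
        - inner ℝ (M.influence g z) (h - h') := by
    rw [scoreRem, scoreRem, R.score_pol_sub w cl.measurable_q hx hqs hin hin0,
      R.score_pol_sub w cl.measurable_q hx hqs hin' hin0,
      R.score_pol_sub w cl.measurable_q hx hqs hin hin', inner_sub_right]
    ring
  have hlip : ∀ {y : ℝ × Cov d}, (∀ θ ∈ Metric.ball θs r, ∀ θ' ∈ Metric.ball θs r,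
      |M.pol₂ θ y - M.pol₂ θ' y| ≤ C * ‖θ - θ'‖) →
      |M.pol₂ (θs + h) y - M.pol₂ (θs + h') y| ≤ C * ‖h - h'‖ := by
    intro y hy
    have := hy _ (mem_ball_add hh) _ (mem_ball_add hh')
    rwa [add_sub_add_left_eq_sub] at this
  have e2 := R.abs_score_le (w := w) (q := q) (z := z)
    (b := fun y => M.pol₂ (θs + h) y - M.pol₂ (θs + h') y) (κ := C * ‖h - h'‖)
    (by positivity) hy (cl.abs_q_le _) (hlip h2.1) (by
      filter_upwards [hqs, h2.2] with t h4 h5 using ⟨h4, hlip h5⟩)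
  have e3 : |inner ℝ (M.influence g z) (h - h')| ≤ 3 * C ^ 3 * ‖h - h'‖ :=
    (abs_real_inner_le_norm _ _).trans (mul_le_mul_of_nonneg_right h3.2.1 (norm_nonneg _))
  have e4 : |w z.2| ≤ |w z.2 - M.ω₂ z.2| + C := by
    have := abs_add_le (w z.2 - M.ω₂ z.2) (M.ω₂ z.2)
    rw [sub_add_cancel] at this
    linarith
  rw [e1]
  refine (abs_sub _ _).trans ((add_le_add e2 e3).trans ?_)
  have e5 : C * ‖h - h'‖ * (2 * C * |w z.2| + C ^ 2)
      ≤ C * ‖h - h'‖ * (2 * C * (|w z.2 - M.ω₂ z.2| + C) + C ^ 2) := by gcongr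
  refine (add_le_add e5 le_rfl).trans (le_of_eq (by ring))

variable {w q : ℝ × Cov d → ℝ} {a b : ℝ} (cl : M.Close C w q a b)

include cl

lemma memLp_scoreRem {h : Par p} (hh : ‖h‖ < r) : MemLp (M.scoreRem θs g w q h) 2 M.obsLaw := by
  have hC := R.C_pos
  have hbd : MemLp (fun z : Obs d => (2 * C ^ 2 * |w z.2 - M.ω₂ z.2| + 6 * C ^ 3) * ‖h‖) 2
      M.obsLaw := by
    have := (((memLp_comp_snd cl.memLp_w).abs.const_mul (2 * C ^ 2)).add
      (memLp_const (6 * C ^ 3))).mul_const ‖h‖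
    exact this
  refine hbd.mono (measurable_scoreRem cl.measurable_w cl.measurable_q G.measurable θs
    h).aestronglyMeasurable ?_
  filter_upwards [R.ae_abs_scoreRem_sub_le G] with z hz
  have := hz w q a b cl h 0 hh (by simpa using R.r_pos)
  rw [scoreRem_zero, sub_zero, sub_zero] at this
  rw [Real.norm_eq_abs, Real.norm_of_nonneg (by positivity)]
  exact this

/-- In `L²`, the remainders are Lipschitz with a constant that does not depend on the nuisance
functions. -/
lemma integral_scoreRem_sub_sq_le (ha : a ≤ 1) {h h' : Par p} (hh : ‖h‖ < r) (hh' : ‖h'‖ < r) :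
    ∫ z, (M.scoreRem θs g w q h z - M.scoreRem θs g w q h' z) ^ 2 ∂M.obsLaw
      ≤ (9 * C ^ 3 * ‖h - h'‖) ^ 2 := by
  have hC := R.C_pos
  have hC1 := R.one_le
  have hsub := (R.memLp_scoreRem G cl hh).sub (R.memLp_scoreRem G cl hh')
  have hi : Integrable (fun z : Obs d => (8 * C ^ 4 * ‖h - h'‖ ^ 2) * (w z.2 - M.ω₂ z.2) ^ 2
      + 72 * C ^ 6 * ‖h - h'‖ ^ 2) M.obsLaw :=
    ((memLp_comp_snd cl.memLp_w).integrable_sq.const_mul _).add (integrable_const _)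
  have h1 : ∫ z, (M.scoreRem θs g w q h z - M.scoreRem θs g w q h' z) ^ 2 ∂M.obsLaw
      ≤ ∫ z : Obs d, ((8 * C ^ 4 * ‖h - h'‖ ^ 2) * (w z.2 - M.ω₂ z.2) ^ 2
        + 72 * C ^ 6 * ‖h - h'‖ ^ 2) ∂M.obsLaw := by
    refine integral_mono_ae hsub.integrable_sq hi ?_
    filter_upwards [R.ae_abs_scoreRem_sub_le G] with z hz
    have h2 := pow_le_pow_left₀ (abs_nonneg _) (hz w q a b cl h h' hh hh') 2
    rw [sq_abs] at h2
    refine h2.trans ?_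
    rw [← sq_abs (w z.2 - M.ω₂ z.2)]
    set x := |w z.2 - M.ω₂ z.2|
    have h3 : (2 * C ^ 2 * x + 6 * C ^ 3) ^ 2 ≤ 8 * C ^ 4 * x ^ 2 + 72 * C ^ 6 := by
      nlinarith [sq_nonneg (2 * C ^ 2 * x - 6 * C ^ 3)]
    rw [mul_pow]
    have := mul_le_mul_of_nonneg_right h3 (sq_nonneg ‖h - h'‖)
    linarith
  refine h1.trans ?_
  rw [integral_add ((memLp_comp_snd cl.memLp_w).integrable_sq.const_mul _) (integrable_const _),
    integral_const_mul, integral_const, probReal_univ, one_smul,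
    integral_comp_snd (g := fun z => (w z - M.ω₂ z) ^ 2)
      ((cl.measurable_w.sub M.measurable_ω₂).pow_const 2)]
  have h4 : ∫ z, (w z - M.ω₂ z) ^ 2 ∂M.lawTX ≤ 1 :=
    cl.sq_w.trans (pow_le_one₀ cl.a_pos.le ha)
  have h5 : 8 * C ^ 4 * ‖h - h'‖ ^ 2 * ∫ z, (w z - M.ω₂ z) ^ 2 ∂M.lawTX
      ≤ 8 * C ^ 4 * ‖h - h'‖ ^ 2 * 1 := by gcongr
  have h6 : C ^ 4 ≤ C ^ 6 := pow_le_pow_right₀ hC1 (by norm_num)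
  have h7 : C ^ 4 * ‖h - h'‖ ^ 2 ≤ C ^ 6 * ‖h - h'‖ ^ 2 := by gcongr
  have h8 : 0 ≤ C ^ 6 * ‖h - h'‖ ^ 2 := by positivity
  have h9 : (9 * C ^ 3 * ‖h - h'‖) ^ 2 = 81 * (C ^ 6 * ‖h - h'‖ ^ 2) := by ring
  linarith

/-- The remainder has, up to a product of nuisance errors, the welfare increment as its mean. -/
lemma abs_integral_scoreRem_sub_le [StandardBorelSpace Ω₀] [Nonempty Ω₀] (hU : M.Unconfounded)
    (hd : DifferentiableAt ℝ M.welfare θs) (h0 : ∇ M.welfare θs = 0) {h : Par p} (hh : ‖h‖ < r) :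
    |∫ z, M.scoreRem θs g w q h z ∂M.obsLaw - (M.welfare (θs + h) - M.welfare θs)|
      ≤ C * ‖h‖ * (a * b) := by
  have hC := R.C_pos
  have hB := R.isFiniteMeasure_base
  have hlip : ∀ᵐ y ∂M.base, |M.pol₂ (θs + h) y - M.pol₂ θs y| ≤ C * ‖h‖ := by
    filter_upwards [R.ae_lipschitz] with y hy
    simpa using hy _ (mem_ball_add hh) _ R.mem_ball_self
  have hq : ∀ᵐ z ∂M.base, |q z| ≤ C := Eventually.of_forall cl.abs_q_le
  have e1 := R.integral_score cl.measurable_w cl.measurable_q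
    ((M.measurable_pol₂ (θs + h)).sub (M.measurable_pol₂ θs)) (R.integrable_w cl) hq hlip
  have hinf : Integrable (fun z => inner ℝ (M.influence g z) h) M.obsLaw := by
    have hm := measurable_influence (M := M) G.measurable
    have : Measurable fun z => inner ℝ (M.influence g z) h := by fun_prop
    refine Integrable.of_bound this.aestronglyMeasurable (3 * C ^ 3 * ‖h‖) ?_
    filter_upwards [R.ae_influence G] with z hz
    exact (abs_real_inner_le_norm _ _).trans (mul_le_mul_of_nonneg_right hz.2.1 (norm_nonneg _))
  have hrem := (R.memLp_scoreRem G cl hh).integrable one_le_two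
  have hsc : Integrable (M.score w q fun y => M.pol₂ (θs + h) y - M.pol₂ θs y) M.obsLaw := by
    refine (hrem.add hinf).congr (Eventually.of_forall fun z => ?_)
    simp [scoreRem]
  have e2 : ∫ z, M.scoreRem θs g w q h z ∂M.obsLaw
      = ∫ z, M.score w q (fun y => M.pol₂ (θs + h) y - M.pol₂ θs y) z ∂M.obsLaw := by
    have := integral_sub hsc hinf
    rw [R.integral_inner_influence G hU hd h0, sub_zero] at this
    rw [← this]; rfl
  have hmi : ∀ θ ∈ M.Θ, Integrable (fun z => M.m₂ z * M.pol₂ θ z) M.base := by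
    intro θ hθ
    refine Integrable.of_bound (M.measurable_m₂.mul (M.measurable_pol₂ θ)).aestronglyMeasurable
      (C * C) ?_
    filter_upwards [R.ae_abs_m_le, R.ae_abs_pol_le hθ] with z h1 h2
    rw [norm_mul]
    exact mul_le_mul h1 h2 (abs_nonneg _) hC.le
  have e3 : ∫ z, M.m₂ z * (M.pol₂ (θs + h) z - M.pol₂ θs z) ∂M.base
      = M.welfare (θs + h) - M.welfare θs := by
    have hin := R.mem_Θ hh
    have hin0 := R.ball_subset R.mem_ball_self
    rw [hU.welfare_eq R hin, hU.welfare_eq R hin0]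
    simp_rw [mul_sub]
    rw [integral_sub (hmi _ hin) (hmi _ hin0)]
    rfl
  rw [e2]
  simp only [Pi.sub_apply] at e1
  have e4 := R.abs_integral_remainder_le cl (by positivity) hlip
  have e5 : M.score w q (M.pol₂ (θs + h) - M.pol₂ θs)
      = M.score w q (fun y => M.pol₂ (θs + h) y - M.pol₂ θs y) := rfl
  rw [e5, e3] at e1
  rw [e1, add_sub_cancel_left]
  exact e4

/-- Second moment of the remainder in the direction `v` at distance `δ`: apart from the error of
replacing the nuisance functions by the true ones, it is the error of the linearization. -/
lemma integral_scoreRem_sq_le {v : Par p} {δ : ℝ} (hδ : 0 < δ) (hδv : ‖δ • v‖ < r) :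
    ∫ z, M.scoreRem θs g w q (δ • v) z ^ 2 ∂M.obsLaw
      ≤ δ ^ 2 * (2 * ∫ z, M.score M.ω₂ M.m₂ (M.quotErr θs g v δ) z ^ 2 ∂M.obsLaw
        + 2 * (C * ‖v‖) ^ 2 * ∫ z, M.scoreErr C w q z ^ 2 ∂M.obsLaw) := by
  have hC := R.C_pos
  obtain ⟨herr, -⟩ := R.scoreErr_sq cl
  have hquotm := M.measurable_score M.measurable_ω₂ M.measurable_m₂ (measurable_quotErr G v δ)
  have hquot : MemLp (M.score M.ω₂ M.m₂ (M.quotErr θs g v δ)) 2 M.obsLaw := by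
    refine MemLp.of_bound hquotm.aestronglyMeasurable (2 * C * ‖v‖ * (2 * C * C + C ^ 2)) ?_
    filter_upwards [R.ae_good, M.ae_obsLaw (R.abs_quotErr_le G v)] with z h1 h2
    obtain ⟨hy, ht, hx, hm, hω, hms, -⟩ := h1
    refine (R.abs_score_le (κ := 2 * C * ‖v‖) (by positivity) hy hm (h2.1 δ hδ hδv) ?_).trans ?_
    · filter_upwards [hms, h2.2] with t h3 h4 using ⟨h3, h4 δ hδ hδv⟩
    · gcongr
  have hpt : ∀ᵐ z ∂M.obsLaw, M.scoreRem θs g w q (δ • v) z ^ 2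
      ≤ 2 * δ ^ 2 * M.score M.ω₂ M.m₂ (M.quotErr θs g v δ) z ^ 2
        + 2 * (C * (δ * ‖v‖)) ^ 2 * M.scoreErr C w q z ^ 2 := by
    filter_upwards [R.ae_good, M.ae_obsLaw R.ae_lipschitz, R.ae_influence G,
      M.ae_obsLaw G.norm_le] with z h1 h2 h3 h4
    obtain ⟨hy, ht, hx, hm, hω, hms, hts⟩ := h1
    have hin := R.mem_Θ hδv
    have hin0 := R.ball_subset R.mem_ball_self
    have hlip : ∀ {y : ℝ × Cov d}, (∀ θ ∈ Metric.ball θs r, ∀ θ' ∈ Metric.ball θs r,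
        |M.pol₂ θ y - M.pol₂ θ' y| ≤ C * ‖θ - θ'‖) →
        |M.pol₂ (θs + δ • v) y - M.pol₂ θs y| ≤ C * (δ * ‖v‖) := by
      intro y hy
      have := hy _ (mem_ball_add hδv) _ R.mem_ball_self
      rwa [add_sub_cancel_left, norm_smul, Real.norm_of_nonneg hδ.le] at this
    have e1 := R.abs_score_sub_le (w := w) (q := q) (z := z)
      (b := fun y => M.pol₂ (θs + δ • v) y - M.pol₂ θs y) (κ := C * (δ * ‖v‖)) cl.measurable_q
      ((M.measurable_pol₂ (θs + δ • v)).sub (M.measurable_pol₂ θs)) hy ⟨ht, hx⟩ (cl.abs_q_le _)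
      (hlip h2.1) (by
        filter_upwards [hms, h2.2] with t h4 h5 using ⟨⟨cl.abs_q_le _, h4⟩, hlip h5⟩)
    have e2 : M.score M.ω₂ M.m₂ (M.quotErr θs g v δ) z
        = δ⁻¹ * M.score M.ω₂ M.m₂ (fun y => M.pol₂ (θs + δ • v) y - M.pol₂ θs y) z
          - inner ℝ (M.influence g z) v := by
      rw [h3.2.2 v, ← M.score_const_mul]
      refine M.score_sub (b := fun y => δ⁻¹ * (M.pol₂ (θs + δ • v) y - M.pol₂ θs y))
        (b' := fun y => inner ℝ (g y) v) ?_ ?_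
      · refine R.integrable_section M.measurable_m₂ (((M.measurable_pol₂ (θs + δ • v)).sub
          (M.measurable_pol₂ θs)).const_mul _) (c := C * (δ⁻¹ * (C * (δ * ‖v‖)))) ?_
        filter_upwards [hms, h2.2] with t h4 h5
        have := hlip h5
        rw [abs_mul, abs_mul, abs_of_pos (inv_pos.2 hδ)]
        gcongr
        exact this
      · have hgm := G.measurable
        have hgv : Measurable fun y => inner ℝ (g y) v := by fun_prop
        refine R.integrable_section M.measurable_m₂ hgv (c := C * (C * ‖v‖)) ?_
        filter_upwards [hms, h4.2] with t h4 h5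
        rw [abs_mul]
        refine mul_le_mul h4 ?_ (abs_nonneg _) hC.le
        exact (abs_real_inner_le_norm _ _).trans (mul_le_mul_of_nonneg_right h5 (norm_nonneg _))
    set s := M.score M.ω₂ M.m₂ (M.quotErr θs g v δ) z
    have e3 : M.scoreRem θs g w q (δ • v) z
        = (M.score w q (fun y => M.pol₂ (θs + δ • v) y - M.pol₂ θs y) z
          - M.score M.ω₂ M.m₂ (fun y => M.pol₂ (θs + δ • v) y - M.pol₂ θs y) z) + δ * s := by
      rw [scoreRem, e2, real_inner_smul_right, mul_sub, mul_inv_cancel_left₀ hδ.ne']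
      ring
    rw [e3]
    have e4 := pow_le_pow_left₀ (abs_nonneg _) e1 2
    rw [sq_abs, mul_pow] at e4
    set A := M.score w q (fun y => M.pol₂ (θs + δ • v) y - M.pol₂ θs y) z
          - M.score M.ω₂ M.m₂ (fun y => M.pol₂ (θs + δ • v) y - M.pol₂ θs y) z
    nlinarith [sq_nonneg (A - δ * s)]
  have i1 := hquot.integrable_sq.const_mul (2 * δ ^ 2)
  have i2 := herr.integrable_sq.const_mul (2 * (C * (δ * ‖v‖)) ^ 2)
  have := integral_mono_ae (R.memLp_scoreRem G cl hδv).integrable_sq (i1.add i2) hpt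
  refine this.trans (le_of_eq ?_)
  have e := integral_add i1 i2
  simp only [Pi.add_apply]
  rw [e, integral_const_mul, integral_const_mul]
  ring

end Regular

end PolicyModel

/-! ### The cross-fitted empirical process of one fold -/

lemma centered_sq_le {α : Type*} [MeasurableSpace α] {μ : Measure α} [IsProbabilityMeasure μ]
    {f : α → ℝ} (hf : MemLp f 2 μ) :
    ∫ z, (f z - ∫ y, f y ∂μ) ∂μ = 0 ∧ ∫ z, (f z - ∫ y, f y ∂μ) ^ 2 ∂μ ≤ ∫ z, f z ^ 2 ∂μ := by
  constructor
  · rw [integral_sub (hf.integrable one_le_two) (integrable_const _)]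
    simp
  · have h := variance_le_expectation_sq (μ := μ) hf.1
    rw [variance_eq_integral hf.1.aemeasurable] at h
    exact h

lemma abs_sub_integral_le {α : Type*} [MeasurableSpace α] {μ : Measure α} [IsProbabilityMeasure μ]
    {f : α → ℝ} {c : ℝ} (h : ∀ᵐ z ∂μ, |f z| ≤ c) : ∀ᵐ z ∂μ, |f z - ∫ y, f y ∂μ| ≤ 2 * c := by
  have h1 : |∫ y, f y ∂μ| ≤ c := by
    simpa using norm_integral_le_of_norm_le_const (μ := μ) (f := f) h
  filter_upwards [h] with z hz
  exact (abs_sub _ _).trans ((add_le_add hz h1).trans_eq (by ring))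

lemma lintegral_abs_le_of_sq {Ω : Type*} [MeasurableSpace Ω] {P : Measure Ω}
    [IsProbabilityMeasure P] {X : Ω → ℝ} {η : ℝ} (hη : 0 < η)
    (h : ∫⁻ w, ENNReal.ofReal (X w ^ 2) ∂P ≤ ENNReal.ofReal (η ^ 2)) :
    ∫⁻ w, ENNReal.ofReal |X w| ∂P ≤ ENNReal.ofReal (2 * η) := by
  have h1 : ∀ w, ENNReal.ofReal |X w| ≤ ENNReal.ofReal η⁻¹ * ENNReal.ofReal (X w ^ 2)
      + ENNReal.ofReal η := by
    intro w
    rw [← ENNReal.ofReal_mul (by positivity), ← ENNReal.ofReal_add (by positivity) hη.le]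
    apply ENNReal.ofReal_le_ofReal
    have h2 := le_add_pow_div (q := 1) (abs_nonneg (X w)) hη
    rw [sq_abs, pow_one] at h2
    rw [inv_mul_eq_div]
    linarith
  refine (lintegral_mono h1).trans ?_
  rw [lintegral_add_right _ measurable_const, lintegral_const_mul' _ _ ENNReal.ofReal_ne_top,
    lintegral_const, measure_univ, mul_one]
  calc ENNReal.ofReal η⁻¹ * ∫⁻ w, ENNReal.ofReal (X w ^ 2) ∂P + ENNReal.ofReal η
      ≤ ENNReal.ofReal η⁻¹ * ENNReal.ofReal (η ^ 2) + ENNReal.ofReal η := by gcongr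
    _ = ENNReal.ofReal (2 * η) := by
        rw [← ENNReal.ofReal_mul (by positivity), ← ENNReal.ofReal_add (by positivity) hη.le]
        congr 1
        field_simp
        norm_num

lemma continuousOn_of_abs_sub_le {E : Type*} [SeminormedAddCommGroup E] {f : E → ℝ} {s : Set E}
    {K : ℝ} (h : ∀ x ∈ s, ∀ y ∈ s, |f x - f y| ≤ K * ‖x - y‖) : ContinuousOn f s := by
  refine (LipschitzOnWith.of_dist_le_mul (K := K.toNNReal) fun x hx y hy => ?_).continuousOn
  rw [Real.dist_eq, dist_eq_norm]
  exact (h x hx y hy).trans (mul_le_mul_of_nonneg_right (Real.le_coe_toNNReal K) (norm_nonneg _))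

lemma ae_eval_of_map_eq_pi {Ω ι 𝒵 : Type*} [MeasurableSpace Ω] [MeasurableSpace 𝒵] [Fintype ι]
    {P : Measure Ω} {μ : Measure 𝒵} [IsProbabilityMeasure μ] {S : Ω → ι → 𝒵} (hS : Measurable S)
    (hlaw : P.map S = Measure.pi (fun _ => μ)) (i : ι) {Q : 𝒵 → Prop} (hQ : ∀ᵐ z ∂μ, Q z) :
    ∀ᵐ ω ∂P, Q (S ω i) := by
  have h1 : ∀ᵐ s ∂(P.map S), Q (s i) := by
    rw [hlaw]
    exact (measurePreserving_eval (fun _ : ι => μ) i).quasiMeasurePreserving.ae hQ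
  exact ae_of_ae_map hS.aemeasurable h1

/-- The identity from coordinates with the supremum norm to the Euclidean parameter space. -/
def toPar (p : ℕ) : (Fin p → ℝ) →L[ℝ] Par p := (EuclideanSpace.equiv (Fin p) ℝ).symm

/-- A Lipschitz constant of `toPar`. -/
def parConst (p : ℕ) : ℝ := ‖toPar p‖ + 1

lemma one_le_parConst (p : ℕ) : 1 ≤ parConst p := le_add_of_nonneg_left (norm_nonneg _)

lemma norm_toPar_le {p : ℕ} (u : Fin p → ℝ) : ‖toPar p u‖ ≤ parConst p * ‖u‖ :=
  ((toPar p).le_opNorm u).trans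
    (mul_le_mul_of_nonneg_right (le_add_of_nonneg_right zero_le_one) (norm_nonneg _))

lemma exists_eq_smul_toPar {p : ℕ} {h : Par p} {δ : ℝ} (hδ : 0 < δ) (hh : ‖h‖ ≤ δ) :
    ∃ u : Fin p → ℝ, ‖u‖ ≤ 1 ∧ h = δ • toPar p u := by
  refine ⟨δ⁻¹ • h.ofLp, ?_, ?_⟩
  · rw [norm_smul, Real.norm_of_nonneg (inv_pos.2 hδ).le, inv_mul_le_iff₀ hδ, mul_one]
    refine (pi_norm_le_iff_of_nonneg hδ.le).2 fun i => ?_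
    exact (PiLp.norm_apply_le h i).trans hh
  · rw [map_smul, smul_smul, mul_inv_cancel₀ hδ.ne', one_smul]
    rfl

namespace PolicyModel

variable {d p : ℕ} {Ω₀ : Type*} [MeasurableSpace Ω₀]

/-- The centred remainder of the linearized score in the direction `u`, at distance `δ` of `θs`
and divided by `δ`. -/
def scoreCtr (M : PolicyModel d p Ω₀) (θs : Par p) (g : ℝ × Cov d → Par p) (w q : ℝ × Cov d → ℝ)
    (δ : ℝ) (u : Fin p → ℝ) (z : Obs d) : ℝ :=
  δ⁻¹ * (M.scoreRem θs g w q (δ • toPar p u) z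
    - ∫ y, M.scoreRem θs g w q (δ • toPar p u) y ∂M.obsLaw)

variable {M : PolicyModel d p Ω₀}

lemma measurable_scoreCtr_param {𝒟 : Type*} [MeasurableSpace 𝒟] {w q : 𝒟 → ℝ × Cov d → ℝ}
    (hw : Measurable (Function.uncurry w)) (hq : Measurable (Function.uncurry q))
    {g : ℝ × Cov d → Par p} (hg : Measurable g) (θs : Par p) (δ : ℝ) (u : Fin p → ℝ) :
    Measurable fun y : 𝒟 × Obs d => M.scoreCtr θs g (w y.1) (q y.1) δ u y.2 := by
  have h1 := measurable_scoreRem_param (M := M) hw hq hg θs (δ • toPar p u)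
  have h2 := (h1.stronglyMeasurable.integral_prod_right' (ν := M.obsLaw)).measurable
  exact (h1.sub (h2.comp measurable_fst)).const_mul _

lemma measurable_sum_scoreCtr {𝒟 ι : Type*} [MeasurableSpace 𝒟] [Fintype ι]
    {w q : 𝒟 → ℝ × Cov d → ℝ} (hw : Measurable (Function.uncurry w))
    (hq : Measurable (Function.uncurry q)) {g : ℝ × Cov d → Par p} (hg : Measurable g)
    (θs : Par p) (δ : ℝ) (n : ℕ) (u : Fin p → ℝ) :
    Measurable fun y : 𝒟 × (ι → Obs d) =>
      (√n)⁻¹ * ∑ i, M.scoreCtr θs g (w y.1) (q y.1) δ u (y.2 i) := by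
  refine (Finset.measurable_fun_sum Finset.univ fun i _ => ?_).const_mul _
  have h := measurable_scoreCtr_param (M := M) hw hq hg θs δ u
  have h2 : Measurable fun y : 𝒟 × (ι → Obs d) => (y.1, y.2 i) :=
    measurable_fst.prodMk ((measurable_pi_apply i).comp measurable_snd)
  exact h.comp h2

namespace Regular

variable {θs : Par p} {C r : ℝ} (R : M.Regular θs C r) {g : ℝ × Cov d → Par p}
  (G : M.GradVersion θs C g)

lemma norm_smul_toPar_lt {δ : ℝ} (hδ : 0 < δ) (hδr : δ * parConst p < r) {u : Fin p → ℝ}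
    (hu : ‖u‖ ≤ 1) : ‖δ • toPar p u‖ < r := by
  rw [norm_smul, Real.norm_of_nonneg hδ.le]
  refine lt_of_le_of_lt (mul_le_mul_of_nonneg_left (norm_toPar_le u) hδ.le) ?_
  have := one_le_parConst p
  have : δ * (parConst p * ‖u‖) ≤ δ * (parConst p * 1) := by gcongr
  linarith

include R G

/-- Boundedness by a multiple of `ρ`, mean and second moment of increments of the centred
remainder. -/
lemma scoreCtr_sub_bounds {w q : ℝ × Cov d → ℝ} {a b : ℝ} (cl : M.Close C w q a b) (ha : a ≤ 1)
    {ρ : ℝ} (hρ : 1 ≤ ρ) (hw : ∀ z, |w z - M.ω₂ z| ≤ ρ) {δ : ℝ} (hδ : 0 < δ)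
    (hδr : δ * parConst p < r) {u v : Fin p → ℝ} (hu : ‖u‖ ≤ 1) (hv : ‖v‖ ≤ 1) {e : ℝ}
    (huv : ‖u - v‖ ≤ e) :
    (∀ᵐ z ∂M.obsLaw, |M.scoreCtr θs g w q δ u z - M.scoreCtr θs g w q δ v z|
      ≤ ρ * (16 * C ^ 3 * parConst p * e)) ∧
    ∫ z, (M.scoreCtr θs g w q δ u z - M.scoreCtr θs g w q δ v z) ∂M.obsLaw = 0 ∧
    ∫ z, (M.scoreCtr θs g w q δ u z - M.scoreCtr θs g w q δ v z) ^ 2 ∂M.obsLaw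
      ≤ (16 * C ^ 3 * parConst p * e) ^ 2 := by
  have hC := R.C_pos
  have hC1 := R.one_le
  have hp := one_le_parConst p
  set h := δ • toPar p u
  set h' := δ • toPar p v
  have hh : ‖h‖ < r := norm_smul_toPar_lt hδ hδr hu
  have hh' : ‖h'‖ < r := norm_smul_toPar_lt hδ hδr hv
  have hd : ‖h - h'‖ ≤ δ * (parConst p * e) := by
    simp only [h, h']
    rw [← smul_sub, ← map_sub, norm_smul, Real.norm_of_nonneg hδ.le]
    refine mul_le_mul_of_nonneg_left ((norm_toPar_le _).trans ?_) hδ.le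
    gcongr
  have he : 0 ≤ e := (norm_nonneg _).trans huv
  have m1 := R.memLp_scoreRem G cl hh
  have m2 := R.memLp_scoreRem G cl hh'
  set f : Obs d → ℝ := fun z => M.scoreRem θs g w q h z - M.scoreRem θs g w q h' z
  have hf : MemLp f 2 M.obsLaw := m1.sub m2
  have hmean : ∫ z, f z ∂M.obsLaw = ∫ z, M.scoreRem θs g w q h z ∂M.obsLaw
      - ∫ z, M.scoreRem θs g w q h' z ∂M.obsLaw :=
    integral_sub (m1.integrable one_le_two) (m2.integrable one_le_two)
  have key : ∀ z, M.scoreCtr θs g w q δ u z - M.scoreCtr θs g w q δ v z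
      = δ⁻¹ * (f z - ∫ y, f y ∂M.obsLaw) := by
    intro z
    rw [hmean]
    simp only [scoreCtr, f]
    ring
  simp_rw [key]
  obtain ⟨c1, c2⟩ := centered_sq_le hf
  refine ⟨?_, ?_, ?_⟩
  · have hb : ∀ᵐ z ∂M.obsLaw, |f z| ≤ 8 * C ^ 3 * ρ * (δ * (parConst p * e)) := by
      filter_upwards [R.ae_abs_scoreRem_sub_le G] with z hz
      refine (hz w q a b cl h h' hh hh').trans ?_
      have h1 : 2 * C ^ 2 * |w z.2 - M.ω₂ z.2| + 6 * C ^ 3 ≤ 8 * C ^ 3 * ρ := by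
        have h2 : C ^ 2 * |w z.2 - M.ω₂ z.2| ≤ C ^ 2 * ρ := by gcongr; exact hw _
        have h3 : C ^ 2 * ρ ≤ C ^ 3 * ρ := by gcongr; norm_num
        have h4 : C ^ 3 * 1 ≤ C ^ 3 * ρ := by gcongr
        linarith
      exact mul_le_mul h1 hd (norm_nonneg _) (by positivity)
    filter_upwards [abs_sub_integral_le hb] with z hz
    rw [abs_mul, abs_of_pos (inv_pos.2 hδ), inv_mul_le_iff₀ hδ]
    refine hz.trans (le_of_eq (by ring))
  · rw [integral_const_mul, c1, mul_zero]
  · simp_rw [mul_pow]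
    rw [integral_const_mul]
    have h1 := c2.trans (R.integral_scoreRem_sub_sq_le G cl ha hh hh')
    have h2 : (9 * C ^ 3 * ‖h - h'‖) ^ 2 ≤ (9 * C ^ 3 * (δ * (parConst p * e))) ^ 2 := by gcongr
    calc δ⁻¹ ^ 2 * ∫ z, (f z - ∫ y, f y ∂M.obsLaw) ^ 2 ∂M.obsLaw
        ≤ δ⁻¹ ^ 2 * (9 * C ^ 3 * (δ * (parConst p * e))) ^ 2 :=
          mul_le_mul_of_nonneg_left (h1.trans h2) (by positivity)
      _ = 9 ^ 2 * (C ^ 3 * parConst p * e) ^ 2 := by field_simp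
      _ ≤ 16 ^ 2 * (C ^ 3 * parConst p * e) ^ 2 := by gcongr; norm_num
      _ = _ := by ring

/-- The centred remainder at a fixed `u` has mean zero, and its second moment is bounded
without a factor `δ⁻¹`. -/
lemma scoreCtr_moments {w q : ℝ × Cov d → ℝ} {a b : ℝ} (cl : M.Close C w q a b)
    {δ : ℝ} (hδ : 0 < δ) (hδr : δ * parConst p < r) {u : Fin p → ℝ} (hu : ‖u‖ ≤ 1) :
    MemLp (M.scoreCtr θs g w q δ u) 2 M.obsLaw ∧
    ∫ z, M.scoreCtr θs g w q δ u z ∂M.obsLaw = 0 ∧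
    ∫ z, M.scoreCtr θs g w q δ u z ^ 2 ∂M.obsLaw
      ≤ 2 * ∫ z, M.score M.ω₂ M.m₂ (M.quotErr θs g (toPar p u) δ) z ^ 2 ∂M.obsLaw
        + 2 * (C * parConst p) ^ 2 * (12 * C ^ 2 * a ^ 2 + 3 * C ^ 2 * b ^ 2 + 6 * C ^ 3 * b) := by
  have hC := R.C_pos
  have hp := one_le_parConst p
  have hh := norm_smul_toPar_lt hδ hδr hu
  have m1 := R.memLp_scoreRem G cl hh
  obtain ⟨c1, c2⟩ := centered_sq_le m1
  have hb := cl.b_pos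
  refine ⟨(m1.sub (memLp_const _)).const_mul _, ?_, ?_⟩
  · simp only [scoreCtr]
    rw [integral_const_mul, c1, mul_zero]
  · simp only [scoreCtr, mul_pow]
    rw [integral_const_mul]
    have h1 := c2.trans (R.integral_scoreRem_sq_le G cl hδ hh)
    obtain ⟨-, h2⟩ := R.scoreErr_sq cl
    have h3 : ‖toPar p u‖ ≤ parConst p := by
      refine (norm_toPar_le u).trans ?_
      have : parConst p * ‖u‖ ≤ parConst p * 1 := by gcongr
      linarith
    have h4 : 2 * (C * ‖toPar p u‖) ^ 2 * ∫ z, M.scoreErr C w q z ^ 2 ∂M.obsLaw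
        ≤ 2 * (C * parConst p) ^ 2 * (12 * C ^ 2 * a ^ 2 + 3 * C ^ 2 * b ^ 2 + 6 * C ^ 3 * b) := by
      gcongr
    have h5 : 0 < δ⁻¹ ^ 2 := by positivity
    refine (mul_le_mul_of_nonneg_left h1 h5.le).trans ?_
    rw [← mul_assoc, ← mul_pow, inv_mul_cancel₀ hδ.ne', one_pow, one_mul, mul_pow]
    rw [mul_pow] at h4
    linarith

/-- The paths of the centred remainder are continuous on the unit cube, simultaneously for all
nuisance functions close to the true ones. -/
lemma ae_continuousOn_scoreCtr {δ : ℝ} (hδ : 0 < δ) (hδr : δ * parConst p < r) :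
    ∀ᵐ z ∂M.obsLaw, ∀ (w q : ℝ × Cov d → ℝ) (a b : ℝ), M.Close C w q a b →
      ContinuousOn (fun u => M.scoreCtr θs g w q δ u z) {u | ‖u‖ ≤ 1} := by
  have hC := R.C_pos
  have hlin : ∀ u v : Fin p → ℝ,
      ‖δ • toPar p u - δ • toPar p v‖ ≤ δ * parConst p * ‖u - v‖ := by
    intro u v
    rw [← smul_sub, ← map_sub, norm_smul, Real.norm_of_nonneg hδ.le, mul_assoc]
    exact mul_le_mul_of_nonneg_left (norm_toPar_le _) hδ.le
  filter_upwards [R.ae_abs_scoreRem_sub_le G] with z' hz' w q a b hcl'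
  simp only [scoreCtr]
  have hiw : Integrable (fun z : Obs d => 2 * C ^ 2 * |w z.2 - M.ω₂ z.2| + 6 * C ^ 3)
      M.obsLaw :=
    (((memLp_comp_snd hcl'.memLp_w).integrable one_le_two).abs.const_mul _).add
      (integrable_const _)
  refine ContinuousOn.mul continuousOn_const (ContinuousOn.sub ?_ ?_)
  · refine continuousOn_of_abs_sub_le (K := (2 * C ^ 2 * |w z'.2 - M.ω₂ z'.2|
      + 6 * C ^ 3) * (δ * parConst p)) fun u hu v hv => ?_
    refine (hz' _ _ _ _ hcl' _ _ (norm_smul_toPar_lt hδ hδr hu)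
      (norm_smul_toPar_lt hδ hδr hv)).trans
      (le_of_le_of_eq (mul_le_mul_of_nonneg_left (hlin u v) ?_) (mul_assoc _ _ _).symm)
    positivity
  · refine continuousOn_of_abs_sub_le (K := (∫ z : Obs d, (2 * C ^ 2 * |w z.2 - M.ω₂ z.2|
      + 6 * C ^ 3) ∂M.obsLaw) * (δ * parConst p)) fun u hu v hv => ?_
    have hhu := norm_smul_toPar_lt hδ hδr hu
    have hhv := norm_smul_toPar_lt hδ hδr hv
    rw [← integral_sub ((R.memLp_scoreRem G hcl' hhu).integrable one_le_two)
      ((R.memLp_scoreRem G hcl' hhv).integrable one_le_two)]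
    refine (abs_integral_le_integral_abs).trans ?_
    rw [mul_assoc, ← integral_mul_const]
    refine integral_mono_ae (((R.memLp_scoreRem G hcl' hhu).sub
      (R.memLp_scoreRem G hcl' hhv)).integrable one_le_two).abs (hiw.mul_const _) ?_
    filter_upwards [R.ae_abs_scoreRem_sub_le G] with z hz
    refine (hz _ _ _ _ hcl' _ _ hhu hhv).trans ?_
    exact mul_le_mul_of_nonneg_left (hlin u v) (by positivity)

/-- Second moments of the centred remainder are small, if `δ` and the distance of the nuisance
functions to the true ones are. -/
lemma integral_scoreCtr_sq_le {κ ε : ℝ} (hε : ε ≤ 1)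
    (hκ : 2 * (C * parConst p) ^ 2 * (21 * C ^ 3) * ε ≤ κ / 2)
    {w q : ℝ × Cov d → ℝ} {a b : ℝ} (ha : a ≤ ε) (hb : b ≤ ε) (cl : M.Close C w q a b)
    {δ : ℝ} (hδ : 0 < δ) (hδr : δ * parConst p < r) {u : Fin p → ℝ} (hu : ‖u‖ ≤ 1)
    (hδκ : 2 * ∫ z, M.score M.ω₂ M.m₂ (M.quotErr θs g (toPar p u) δ) z ^ 2 ∂M.obsLaw ≤ κ / 2) :
    ∫ z, M.scoreCtr θs g w q δ u z ^ 2 ∂M.obsLaw ≤ κ := by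
  have hC1 := R.one_le
  have hC := R.C_pos
  obtain ⟨-, -, b3⟩ := R.scoreCtr_moments G cl hδ hδr hu
  have ha0 := cl.a_pos
  have hb0 := cl.b_pos
  have h2 : 12 * C ^ 2 * a ^ 2 + 3 * C ^ 2 * b ^ 2 + 6 * C ^ 3 * b ≤ 21 * C ^ 3 * ε := by
    have e1 : a ^ 2 ≤ ε := by nlinarith
    have e2 : b ^ 2 ≤ ε := by nlinarith
    have e3 : C ^ 2 ≤ C ^ 3 := pow_le_pow_right₀ hC1 (by norm_num)
    have e4 : C ^ 2 * a ^ 2 ≤ C ^ 3 * ε := mul_le_mul e3 e1 (by positivity) (by positivity)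
    have e5 : C ^ 2 * b ^ 2 ≤ C ^ 3 * ε := mul_le_mul e3 e2 (by positivity) (by positivity)
    have e6 : C ^ 3 * b ≤ C ^ 3 * ε := by gcongr
    linarith
  have h4 := mul_le_mul_of_nonneg_left h2 (by positivity : 0 ≤ 2 * (C * parConst p) ^ 2)
  linarith

/-- The chaining bound for the empirical process of one fold, in terms of the second moments on the
dyadic grid of level `J`. -/
lemma exists_fold_bound_of_grid {η' : ℝ} (hη' : 0 < η') {c₀ K : ℝ}
    (hc₀ : c₀ = 2 * Real.exp 1 * (2 * p + 2).factorial) (hK : K = 16 * C ^ 3 * parConst p)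
    (J : ℕ)
    {Ω : Type*} [MeasurableSpace Ω] (P : Measure Ω) [IsProbabilityMeasure P]
    {ι 𝒟 : Type} [Fintype ι] [MeasurableSpace 𝒟] {D : Ω → 𝒟} {S : Ω → ι → Obs d}
    (hD : Measurable D) (hS : Measurable S) (hDS : IndepFun D S P)
    (hlaw : P.map S = Measure.pi (fun _ => M.obsLaw)) {n : ℕ} (hn : 1 ≤ n)
    (hcard : Fintype.card ι ≤ n) {w q : 𝒟 → ℝ × Cov d → ℝ}
    (hw : Measurable (Function.uncurry w)) (hq : Measurable (Function.uncurry q))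
    {a b : ℝ} (ha1 : a ≤ 1) (hcl : ∀ x, M.Close C (w x) (q x) a b)
    (hwn : ∀ x z, |w x z - M.ω₂ z| ≤ √n) {δ : ℝ} (hδ : 0 < δ) (hδr : δ * parConst p < r)
    (hgrid : ∀ k ∈ dyadicIdx p J, ∀ x,
      ∫ z, M.scoreCtr θs g (w x) (q x) δ (dyadicPt J k) z ^ 2 ∂M.obsLaw ≤ η' ^ 2) :
    ∃ T : Ω → ℝ≥0∞, AEMeasurable T P ∧
      (∀ᵐ ω ∂P, ∀ u : Fin p → ℝ, ‖u‖ ≤ 1 → ENNReal.ofReal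
        |(√n)⁻¹ * ∑ i, M.scoreCtr θs g (w (D ω)) (q (D ω)) δ u (S ω i)| ≤ T ω) ∧
      ∫⁻ ω, T ω ∂P ≤ ∑ _k ∈ dyadicIdx p J, ENNReal.ofReal (2 * η')
        + ENNReal.ofReal (4 * (1 + 6 ^ p * c₀) * K * (3 / 4) ^ J) := by
  have hC := R.C_pos
  have hp := one_le_parConst p
  have hK0 : 0 < K := by rw [hK]; positivity
  have hc₀0 : 0 ≤ c₀ := by rw [hc₀]; positivity
  have hn1 : (1 : ℝ) ≤ n := by exact_mod_cast hn
  have hsn : 1 ≤ √(n : ℝ) := Real.one_le_sqrt.2 hn1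
  have hsn0 : 0 < √(n : ℝ) := zero_lt_one.trans_le hsn
  have hcard' : (Fintype.card ι : ℝ) ≤ √(n : ℝ) ^ 2 := by
    rw [Real.sq_sqrt (by positivity)]; exact_mod_cast hcard
  let X : (Fin p → ℝ) → Ω → ℝ := fun u ω =>
    (√n)⁻¹ * ∑ i, M.scoreCtr θs g (w (D ω)) (q (D ω)) δ u (S ω i)
  have hmeasF := fun u => measurable_sum_scoreCtr (M := M) (ι := ι) hw hq G.measurable θs δ n u
  have hXm : ∀ u, Measurable (X u) := fun u => by
    have h1 : Measurable fun ω => (D ω, S ω) := hD.prodMk hS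
    have h2 := (hmeasF u).comp h1
    simp only [Function.comp_def] at h2
    exact h2
  have hcont : ∀ᵐ ω ∂P, ContinuousOn (fun u => X u ω) {u | ‖u‖ ≤ 1} := by
    filter_upwards [ae_all_iff.2 fun i => ae_eval_of_map_eq_pi hS hlaw i
      (R.ae_continuousOn_scoreCtr G hδ hδr)] with ω hω
    exact ContinuousOn.mul continuousOn_const (continuousOn_finsetSum _ fun i _ =>
      hω i _ _ _ _ (hcl (D ω)))
  have hmom : ∀ u v, ‖u‖ ≤ 1 → ‖v‖ ≤ 1 → ∀ e : ℝ, 0 < e → ‖u - v‖ ≤ e →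
      ∫⁻ ω, ENNReal.ofReal ((X u ω - X v ω) ^ (2 * p + 2)) ∂P
        ≤ ENNReal.ofReal (c₀ * (K * e) ^ (2 * p + 2)) := by
    intro u v hu hv e he huv
    have hF : Measurable (Function.uncurry fun (x : 𝒟) (s : ι → Obs d) => ENNReal.ofReal
        (((√n)⁻¹ * ∑ i, M.scoreCtr θs g (w x) (q x) δ u (s i)
          - (√n)⁻¹ * ∑ i, M.scoreCtr θs g (w x) (q x) δ v (s i)) ^ (2 * p + 2))) :=
      (((hmeasF u).sub (hmeasF v)).pow_const _).ennreal_ofReal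
    refine lintegral_le_of_indep hD hS hDS hF fun x => ?_
    rw [hlaw]
    rw [hc₀]
    obtain ⟨b1, b2, b3⟩ := R.scoreCtr_sub_bounds G (hcl x) ha1 hsn (hwn x) hδ hδr hu hv huv
    rw [← hK] at b1 b3
    have hm : Measurable fun z => M.scoreCtr θs g (w x) (q x) δ u z
        - M.scoreCtr θs g (w x) (q x) δ v z :=
      ((measurable_scoreCtr_param hw hq G.measurable θs δ u).comp measurable_prodMk_left).sub
        ((measurable_scoreCtr_param hw hq G.measurable θs δ v).comp measurable_prodMk_left)
    have := lintegral_pow_sum_pi_le (ι := ι) M.obsLaw hm.aestronglyMeasurable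
      (a := K * e) (by positivity) hsn0 b1 b2 b3 hcard' (q := 2 * p + 2) ⟨p + 1, by ring⟩
    refine le_trans (le_of_eq ?_) this
    refine lintegral_congr fun s => ?_
    rw [← mul_sub, ← Finset.sum_sub_distrib]
  obtain ⟨T, hTm, hT1, hT2⟩ := exists_chaining_bound (P := P) (X := X)
    (fun u _ => (hXm u).aemeasurable) hcont hK0 hc₀0 hmom J
  refine ⟨T, hTm, hT1, hT2.trans ?_⟩
  gcongr with k hk
  -- second moments on the grid, conditionally on the training data
  refine lintegral_abs_le_of_sq hη' ?_
  have hF : Measurable (Function.uncurry fun (x : 𝒟) (s : ι → Obs d) => ENNReal.ofReal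
      (((√n)⁻¹ * ∑ i, M.scoreCtr θs g (w x) (q x) δ (dyadicPt J k) (s i)) ^ 2)) :=
    ((hmeasF (dyadicPt J k)).pow_const _).ennreal_ofReal
  refine lintegral_le_of_indep hD hS hDS hF fun x => ?_
  rw [hlaw]
  obtain ⟨b1, b2, -⟩ := R.scoreCtr_moments G (hcl x) hδ hδr (norm_dyadicPt_le hk)
  exact lintegral_sq_sum_pi_le (ι := ι) M.obsLaw b1 hsn0 b2 (hgrid k hk x) hcard'

/-- The empirical process of one fold is uniformly small on a small ball around `θs`: the normalized
sums of the centred remainders have a measurable upper bound with expectation at most `η`. Here `D`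
are the training data and `S` are the data of the fold, which are independent of `D`; `w` and `q` are the
nuisance estimators. The bounds `ε` and `δ₁` depend on the population and on `η` only. -/
lemma exists_fold_bound {η : ℝ} (hη : 0 < η) :
    ∃ ε : ℝ, 0 < ε ∧ ε ≤ 1 ∧ ∃ δ₁ : ℝ, 0 < δ₁ ∧ δ₁ * parConst p < r ∧
    ∀ {Ω : Type*} [MeasurableSpace Ω] (P : Measure Ω) [IsProbabilityMeasure P]
      {ι 𝒟 : Type} [Fintype ι] [MeasurableSpace 𝒟] (D : Ω → 𝒟) (S : Ω → ι → Obs d),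
      Measurable D → Measurable S → IndepFun D S P → P.map S = Measure.pi (fun _ => M.obsLaw) →
    ∀ n : ℕ, 1 ≤ n → Fintype.card ι ≤ n →
    ∀ w q : 𝒟 → ℝ × Cov d → ℝ, Measurable (Function.uncurry w) → Measurable (Function.uncurry q) →
    ∀ a b : ℝ, a ≤ ε → b ≤ ε → (∀ x, M.Close C (w x) (q x) a b) →
      (∀ x z, |w x z - M.ω₂ z| ≤ √n) →
    ∀ δ : ℝ, 0 < δ → δ ≤ δ₁ → ∃ T : Ω → ℝ≥0∞, AEMeasurable T P ∧
      (∀ᵐ ω ∂P, ∀ u : Fin p → ℝ, ‖u‖ ≤ 1 → ENNReal.ofReal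
        |(√n)⁻¹ * ∑ i, M.scoreCtr θs g (w (D ω)) (q (D ω)) δ u (S ω i)| ≤ T ω) ∧
      ∫⁻ ω, T ω ∂P ≤ ENNReal.ofReal η := by
  have hC := R.C_pos
  have hC1 := R.one_le
  have hp := one_le_parConst p
  set K : ℝ := 16 * C ^ 3 * parConst p with hK
  have hK0 : 0 < K := by positivity
  set c₀ : ℝ := 2 * Real.exp 1 * (2 * p + 2).factorial with hc₀
  have hc₀0 : 0 ≤ c₀ := by positivity
  -- the level `J` of the grid makes the chaining term small
  obtain ⟨J, hJ⟩ : ∃ J : ℕ, 4 * (1 + 6 ^ p * c₀) * K * (3 / 4) ^ J ≤ η / 2 := by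
    have hlim : Tendsto (fun J : ℕ => 4 * (1 + 6 ^ p * c₀) * K * (3 / 4 : ℝ) ^ J) atTop (𝓝 0) := by
      simpa using (tendsto_pow_atTop_nhds_zero_of_lt_one (by norm_num : (0:ℝ) ≤ 3 / 4)
        (by norm_num)).const_mul (4 * (1 + 6 ^ p * c₀) * K)
    exact (hlim.eventually_le_const (half_pos hη)).exists
  -- on the finite grid of level `J`, second moments are small
  set N : ℝ := (dyadicIdx p J).card + 1 with hN
  have hN0 : 0 < N := by positivity
  set η' : ℝ := η / (4 * N) with hη'
  have hη'0 : 0 < η' := by positivity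
  set c₁ : ℝ := 2 * (C * parConst p) ^ 2 * (21 * C ^ 3) with hc₁
  have hc₁0 : 0 < c₁ := by positivity
  set ε : ℝ := min 1 (η' ^ 2 / (2 * c₁)) with hε
  have hε0 : 0 < ε := lt_min one_pos (by positivity)
  have hgrid : ∀ᶠ δ in 𝓝[>] (0 : ℝ), ∀ k ∈ dyadicIdx p J,
      2 * ∫ z, M.score M.ω₂ M.m₂ (M.quotErr θs g (toPar p (dyadicPt J k)) δ) z ^ 2 ∂M.obsLaw
        ≤ η' ^ 2 / 2 := by
    refine (Finset.eventually_all _).2 fun k _ => ?_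
    have := (R.tendsto_integral_score_quotErr_sq G (toPar p (dyadicPt J k))).const_mul 2
    rw [mul_zero] at this
    exact this.eventually_le_const (by positivity)
  obtain ⟨δ₀, hδ₀0, hδ₀⟩ := mem_nhdsGT_iff_exists_Ioc_subset.1 hgrid
  have hδ₀0 : 0 < δ₀ := hδ₀0
  refine ⟨ε, hε0, min_le_left _ _, min δ₀ (r / (2 * parConst p)),
    lt_min hδ₀0 (div_pos R.r_pos (by positivity)), ?_, ?_⟩
  · calc min δ₀ (r / (2 * parConst p)) * parConst p ≤ r / (2 * parConst p) * parConst p := by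
          gcongr; exact min_le_right _ _
      _ = r / 2 := by field_simp
      _ < r := half_lt_self R.r_pos
  intro Ω _ P _ ι 𝒟 _ _ D S hD hS hDS hlaw n hn hcard w q hw hq a b ha hb hcl hwn δ hδ hδ1
  have hδr : δ * parConst p < r := by
    calc δ * parConst p ≤ r / (2 * parConst p) * parConst p := by
          gcongr; exact hδ1.trans (min_le_right _ _)
      _ = r / 2 := by field_simp
      _ < r := half_lt_self R.r_pos
  have hg2 : ∀ k ∈ dyadicIdx p J, ∀ x,
      ∫ z, M.scoreCtr θs g (w x) (q x) δ (dyadicPt J k) z ^ 2 ∂M.obsLaw ≤ η' ^ 2 := by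
    intro k hk x
    refine R.integral_scoreCtr_sq_le G (min_le_left _ _) ?_ ha hb (hcl x) hδ hδr
      (norm_dyadicPt_le hk) (hδ₀ ⟨hδ, hδ1.trans (min_le_left _ _)⟩ k hk)
    calc c₁ * ε ≤ c₁ * (η' ^ 2 / (2 * c₁)) := by gcongr; exact min_le_right _ _
      _ = η' ^ 2 / 2 := by field_simp
  obtain ⟨T, hTm, hT1, hT2⟩ := R.exists_fold_bound_of_grid G hη'0 hc₀ hK J P hD hS hDS hlaw hn hcard
    hw hq (ha.trans (min_le_left _ _)) hcl hwn hδ hδr hg2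
  refine ⟨T, hTm, hT1, hT2.trans ?_⟩
  refine (add_le_add le_rfl (ENNReal.ofReal_le_ofReal hJ)).trans ?_
  rw [Finset.sum_const, nsmul_eq_mul, ← ENNReal.ofReal_natCast,
    ← ENNReal.ofReal_mul (by positivity), ← ENNReal.ofReal_add (by positivity) (by positivity)]
  apply ENNReal.ofReal_le_ofReal
  have : ((dyadicIdx p J).card : ℝ) * (2 * η') ≤ η / 2 := by
    calc ((dyadicIdx p J).card : ℝ) * (2 * η') ≤ N * (2 * η') := by
          gcongr; exact le_add_of_nonneg_right zero_le_one
      _ = η / 2 := by rw [hη']; field_simp; norm_num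
  linarith

end Regular

end PolicyModel

/-! ### Truncated nuisance estimators -/

lemma measurable_eLpNorm_two {𝒟 α : Type*} [MeasurableSpace 𝒟] [MeasurableSpace α] {μ : Measure α}
    [SFinite μ] {f : 𝒟 → α → ℝ} (hf : Measurable (Function.uncurry f)) :
    Measurable fun x => eLpNorm (f x) 2 μ := by
  have h : ∀ x, eLpNorm (f x) 2 μ = (∫⁻ z, ‖f x z‖ₑ ^ (2 : ℝ) ∂μ) ^ (1 / 2 : ℝ) := fun x => by
    rw [eLpNorm_eq_lintegral_rpow_enorm_toReal two_ne_zero ENNReal.ofNat_ne_top]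
    simp
  simp_rw [h]
  have h1 : Measurable fun y : 𝒟 × α => ‖f y.1 y.2‖ₑ ^ (2 : ℝ) := hf.enorm.pow_const _
  exact h1.lintegral_prod_right'.pow_const _

lemma memLp_two_of_eLpNorm_le {α : Type*} [MeasurableSpace α] {μ : Measure α} {f : α → ℝ}
    (hf : Measurable f) {a : ℝ} (ha : 0 ≤ a) (h : eLpNorm f 2 μ ≤ ENNReal.ofReal a) :
    MemLp f 2 μ ∧ ∫ z, f z ^ 2 ∂μ ≤ a ^ 2 := by
  have hm : MemLp f 2 μ := ⟨hf.aestronglyMeasurable, h.trans_lt ENNReal.ofReal_lt_top⟩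
  refine ⟨hm, ?_⟩
  have h1 := hm.eLpNorm_eq_integral_rpow_norm two_ne_zero ENNReal.ofNat_ne_top
  rw [h1] at h
  have h0 : 0 ≤ ∫ z, f z ^ 2 ∂μ := integral_nonneg fun _ => sq_nonneg _
  have h2 := (ENNReal.ofReal_le_ofReal_iff ha).1 h
  simp only [ENNReal.toReal_ofNat, Real.rpow_ofNat, Real.norm_eq_abs, sq_abs] at h2
  rw [← one_div, ← Real.sqrt_eq_rpow] at h2
  exact (Real.sqrt_le_left ha).1 h2

/-- Truncation of a real number to the interval `[-C, C]`. -/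
def clip (C y : ℝ) : ℝ := max (min y C) (-C)

lemma measurable_clip (C : ℝ) : Measurable (clip C) := by unfold clip; fun_prop

lemma abs_clip_le {C : ℝ} (hC : 0 ≤ C) (y : ℝ) : |clip C y| ≤ C :=
  abs_le.2 ⟨le_max_right _ _, max_le (min_le_right _ _) (by linarith)⟩

lemma clip_of_abs_le {C y : ℝ} (h : |y| ≤ C) : clip C y = y := by
  obtain ⟨h1, h2⟩ := abs_le.1 h
  rw [clip, min_eq_left h2, max_eq_left h1]

lemma abs_clip_sub_clip_le (C x y : ℝ) : |clip C x - clip C y| ≤ |x - y| :=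
  (abs_max_sub_max_le_abs _ _ _).trans (by simpa using abs_min_sub_min_le_max x C y C)

namespace PolicyModel

variable {d p : ℕ} {Ω₀ : Type*} [MeasurableSpace Ω₀] (M : PolicyModel d p Ω₀)

open Classical in
/-- A weight function `w`, replaced by the true weight `ω` if `w` is not within `a` of `ω` in `L²`,
and at all points at which it is not within `ρ` of `ω`. The first case makes the distance to `ω` at
most `a` for every `w`. -/
def truncW (a ρ : ℝ) (w : ℝ × Cov d → ℝ) (z : ℝ × Cov d) : ℝ :=
  if eLpNorm (fun z => w z - M.ω₂ z) 2 M.lawTX ≤ ENNReal.ofReal a ∧ |w z - M.ω₂ z| ≤ ρ then w z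
  else M.ω₂ z

open Classical in
/-- A regression function `q`, replaced by the true regression function `m` if `q` is not within `b`
of `m` in `L²`, and truncated to `[-C, C]`. -/
def truncQ (C b : ℝ) (q : ℝ × Cov d → ℝ) (z : ℝ × Cov d) : ℝ :=
  if eLpNorm (fun z => q z - M.m₂ z) 2 M.lawTX ≤ ENNReal.ofReal b then clip C (q z)
  else clip C (M.m₂ z)

lemma measurable_truncW {𝒟 : Type*} [MeasurableSpace 𝒟] {w : 𝒟 → ℝ × Cov d → ℝ}
    (hw : Measurable (Function.uncurry w)) (a ρ : ℝ) :
    Measurable (Function.uncurry fun x => M.truncW a ρ (w x)) := by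
  have h1 : Measurable (Function.uncurry fun x z => w x z - M.ω₂ z) :=
    hw.sub (M.measurable_ω₂.comp measurable_snd)
  have h2 : MeasurableSet {y : 𝒟 × ℝ × Cov d |
      eLpNorm (fun z => w y.1 z - M.ω₂ z) 2 M.lawTX ≤ ENNReal.ofReal a ∧
        |w y.1 y.2 - M.ω₂ y.2| ≤ ρ} :=
    (measurableSet_le ((measurable_eLpNorm_two h1).comp measurable_fst) measurable_const).inter
      (measurableSet_le h1.abs measurable_const)
  exact Measurable.ite h2 hw (M.measurable_ω₂.comp measurable_snd)

lemma measurable_truncQ {𝒟 : Type*} [MeasurableSpace 𝒟] {q : 𝒟 → ℝ × Cov d → ℝ}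
    (hq : Measurable (Function.uncurry q)) (C b : ℝ) :
    Measurable (Function.uncurry fun x => M.truncQ C b (q x)) := by
  have h1 : Measurable (Function.uncurry fun x z => q x z - M.m₂ z) :=
    hq.sub (M.measurable_m₂.comp measurable_snd)
  have h2 : MeasurableSet {y : 𝒟 × ℝ × Cov d |
      eLpNorm (fun z => q y.1 z - M.m₂ z) 2 M.lawTX ≤ ENNReal.ofReal b} :=
    measurableSet_le ((measurable_eLpNorm_two h1).comp measurable_fst) measurable_const
  exact Measurable.ite h2 ((measurable_clip C).comp hq)
    ((measurable_clip C).comp (M.measurable_m₂.comp measurable_snd))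

variable {M}

lemma abs_truncW_sub_le {a ρ : ℝ} (hρ : 0 ≤ ρ) (w : ℝ × Cov d → ℝ) (z : ℝ × Cov d) :
    |M.truncW a ρ w z - M.ω₂ z| ≤ ρ := by
  rw [truncW]
  split_ifs with h
  · exact h.2
  · simpa using hρ

lemma measurable_of_uncurry_const {α : Type*} [MeasurableSpace α] {f : α → ℝ}
    (h : Measurable (Function.uncurry fun _ : Unit => f)) : Measurable f :=
  h.comp (measurable_const (a := ()) |>.prodMk measurable_id)

lemma eLpNorm_truncW_le {a : ℝ} (ρ : ℝ) (w : ℝ × Cov d → ℝ) :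
    eLpNorm (fun z => M.truncW a ρ w z - M.ω₂ z) 2 M.lawTX ≤ ENNReal.ofReal a := by
  by_cases h : eLpNorm (fun z => w z - M.ω₂ z) 2 M.lawTX ≤ ENNReal.ofReal a
  · refine (eLpNorm_mono fun z => ?_).trans h
    rw [truncW]
    split_ifs
    · exact le_rfl
    · simp
  · have : (fun z => M.truncW a ρ w z - M.ω₂ z) = 0 := by
      funext z
      simp [truncW, h]
    rw [this, eLpNorm_zero]
    exact zero_le

namespace Regular

variable {θs : Par p} {C r : ℝ} (R : M.Regular θs C r)

include R

lemma eLpNorm_truncQ_le {b : ℝ} (q : ℝ × Cov d → ℝ) :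
    eLpNorm (fun z => M.truncQ C b q z - M.m₂ z) 2 M.lawTX ≤ ENNReal.ofReal b := by
  have hm := M.lawTX_ac.ae_le R.ae_abs_m_le
  by_cases h : eLpNorm (fun z => q z - M.m₂ z) 2 M.lawTX ≤ ENNReal.ofReal b
  · refine (eLpNorm_mono_ae ?_).trans h
    filter_upwards [hm] with z hz
    have h1 : M.truncQ C b q z = clip C (q z) := by simp [truncQ, h]
    have h2 : M.m₂ z = clip C (M.m₂ z) := (clip_of_abs_le hz).symm
    rw [h1, h2, ← h2]
    nth_rewrite 1 [h2]
    exact abs_clip_sub_clip_le _ _ _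
  · have : (fun z => M.truncQ C b q z - M.m₂ z) =ᵐ[M.lawTX] 0 := by
      filter_upwards [hm] with z hz
      have h2 : clip C (M.m₂ z) = M.m₂ z := clip_of_abs_le hz
      simp [truncQ, h, h2]
    rw [eLpNorm_congr_ae this, eLpNorm_zero]
    exact zero_le

/-- Truncated nuisance functions are close to the true ones, whatever `w` and `q` are. -/
lemma close_trunc {w q : ℝ × Cov d → ℝ} (hw : Measurable w) (hq : Measurable q) {a b : ℝ}
    (ha : 0 < a) (hb : 0 < b) (ρ : ℝ) :
    M.Close C (M.truncW a ρ w) (M.truncQ C b q) a b := by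
  have h1 : Measurable (M.truncW a ρ w) :=
    measurable_of_uncurry_const (M.measurable_truncW (𝒟 := Unit) (w := fun _ => w)
      (hw.comp measurable_snd) a ρ)
  have h2 : Measurable (M.truncQ C b q) :=
    measurable_of_uncurry_const (M.measurable_truncQ (𝒟 := Unit) (q := fun _ => q)
      (hq.comp measurable_snd) C b)
  obtain ⟨h3, h4⟩ := memLp_two_of_eLpNorm_le (h1.sub M.measurable_ω₂) ha.le
    (eLpNorm_truncW_le ρ w)
  obtain ⟨-, h6⟩ := memLp_two_of_eLpNorm_le (h2.sub M.measurable_m₂) hb.le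
    (R.eLpNorm_truncQ_le q)
  refine ⟨h1, h2, fun z => ?_, ha, hb, h3, h4, h6⟩
  rw [truncQ]
  split_ifs <;> exact abs_clip_le R.C_pos.le _

omit R in
/-- The truncation of the nuisance functions does not change the score at observations at which
the truncation is not active. -/
lemma score_trunc_eq {w q : ℝ × Cov d → ℝ} {a b ρ : ℝ}
    (hw : eLpNorm (fun z => w z - M.ω₂ z) 2 M.lawTX ≤ ENNReal.ofReal a)
    (hq : eLpNorm (fun z => q z - M.m₂ z) 2 M.lawTX ≤ ENNReal.ofReal b)
    (hqC : ∀ t ∈ M.𝒯, ∀ x ∈ M.𝒳, |q (t, x)| ≤ C) {z : Obs d} (ht : z.2.1 ∈ M.𝒯)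
    (hx : z.2.2 ∈ M.𝒳) (hz : |w z.2 - M.ω₂ z.2| ≤ ρ) {θ : Par p} (hθ : θ ∈ M.Θ) :
    w z.2 * M.pol θ z.2.1 z.2.2 * (z.1 - q z.2) + ∫ t, q (t, z.2.2) ∂(M.policy θ z.2.2)
      = M.score (M.truncW a ρ w) (M.truncQ C b q) (M.pol₂ θ) z := by
  have h1 : M.truncW a ρ w z.2 = w z.2 := by simp [truncW, hw, hz]
  have h2 : ∀ t ∈ M.𝒯, M.truncQ C b q (t, z.2.2) = q (t, z.2.2) := fun t ht => by
    simp [truncQ, hq, clip_of_abs_le (hqC t ht _ hx)]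
  have h3 := h2 _ ht
  rw [score, h1, M.integral_policy hθ hx, show M.truncQ C b q z.2 = q z.2 from h3]
  congr 1
  refine integral_congr_ae ?_
  filter_upwards [M.ae_ν_mem] with t ht
  rw [h2 t ht]
  rfl

end Regular

end PolicyModel

/-! ### Cross-fitting -/

/-- A union bound and Chebyshev's inequality, conditionally on independent data `D`: if `f x` has second
moment at most `c` for all `x`, the values `f D` at `n` observations are all at most `√n` outside an
event of probability `c`. -/
lemma measure_exists_sqrt_lt_le {Ω 𝒟 𝒵 ι : Type*} [MeasurableSpace Ω] [MeasurableSpace 𝒟]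
    [MeasurableSpace 𝒵] [Fintype ι] {P : Measure Ω} [IsProbabilityMeasure P] {μ : Measure 𝒵}
    [IsProbabilityMeasure μ] {D : Ω → 𝒟} {S : Ω → ι → 𝒵} (hD : Measurable D) (hS : Measurable S)
    (hDS : IndepFun D S P) (hlaw : P.map S = Measure.pi fun _ => μ) {n : ℕ} (hn : 1 ≤ n)
    (hcard : Fintype.card ι ≤ n) {f : 𝒟 → 𝒵 → ℝ} (hf : Measurable (Function.uncurry f)) {c : ℝ}
    (hc : ∀ x, ∫⁻ z, ENNReal.ofReal (f x z ^ 2) ∂μ ≤ ENNReal.ofReal c) :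
    P {w | ∃ i, √(n : ℝ) < |f (D w) (S w i)|} ≤ ENNReal.ofReal c := by
  have hn0 : (0 : ℝ) < n := by exact_mod_cast hn
  have hfi : ∀ i, Measurable fun y : 𝒟 × (ι → 𝒵) => ENNReal.ofReal (f y.1 (y.2 i) ^ 2) :=
    fun i => ((hf.comp (measurable_fst.prodMk
      ((measurable_pi_apply i).comp measurable_snd))).pow_const 2).ennreal_ofReal
  have hF : Measurable (Function.uncurry fun (x : 𝒟) (s : ι → 𝒵) =>
      ∑ i, ENNReal.ofReal (f x (s i) ^ 2)) := Finset.measurable_fun_sum _ fun i _ => hfi i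
  have h1 : ∫⁻ w, ∑ i, ENNReal.ofReal (f (D w) (S w i) ^ 2) ∂P
      ≤ ENNReal.ofReal n * ENNReal.ofReal c := by
    refine lintegral_le_of_indep hD hS hDS hF fun x => ?_
    have hm' : ∀ i ∈ Finset.univ, Measurable fun s : ι → 𝒵 => ENNReal.ofReal (f x (s i) ^ 2) :=
      fun i _ => (hfi i).comp (measurable_prodMk_left (x := x))
    rw [hlaw, lintegral_finsetSum _ hm']
    have h2 : ∀ i : ι, ∫⁻ s : ι → 𝒵, ENNReal.ofReal (f x (s i) ^ 2) ∂(Measure.pi fun _ => μ)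
        ≤ ENNReal.ofReal c := fun i => by
      have hm : Measurable fun z => ENNReal.ofReal (f x z ^ 2) :=
        ((hf.comp measurable_prodMk_left).pow_const 2).ennreal_ofReal
      have h3 := (measurePreserving_eval (fun _ : ι => μ) i).lintegral_comp hm
      exact h3.trans_le (hc x)
    refine (Finset.sum_le_sum fun i _ => h2 i).trans ?_
    rw [Finset.sum_const, nsmul_eq_mul, Finset.card_univ, ENNReal.ofReal_natCast]
    gcongr
  have hFm : AEMeasurable (fun w => ∑ i, ENNReal.ofReal (f (D w) (S w i) ^ 2)) P :=
    (hF.comp (hD.prodMk hS)).aemeasurable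
  have h2 : {w | ∃ i, √(n : ℝ) < |f (D w) (S w i)|}
      ⊆ {w | ENNReal.ofReal n ≤ ∑ i, ENNReal.ofReal (f (D w) (S w i) ^ 2)} := by
    rintro w ⟨i, hi⟩
    refine le_trans ?_ (Finset.single_le_sum
      (f := fun i => ENNReal.ofReal (f (D w) (S w i) ^ 2)) (fun _ _ => zero_le)
      (Finset.mem_univ i))
    apply ENNReal.ofReal_le_ofReal
    rw [← sq_abs]
    exact (Real.sqrt_le_left (abs_nonneg _)).1 hi.le
  have h3 := mul_meas_ge_le_lintegral₀ hFm (ENNReal.ofReal n)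
  have h4 : ENNReal.ofReal (n : ℝ) * P {w | ∃ i, √(n : ℝ) < |f (D w) (S w i)|}
      ≤ ENNReal.ofReal n * ENNReal.ofReal c := by
    refine le_trans ?_ (h3.trans h1)
    gcongr
  exact (ENNReal.mul_le_mul_iff_right (ENNReal.ofReal_pos.2 hn0).ne' ENNReal.ofReal_ne_top).1 h4

namespace CrossFitting

variable {d p L : ℕ} {Ω₀ : Type*} [MeasurableSpace Ω₀] (A : CrossFitting d L)

/-- The data of fold `ℓ`: the observations with index in the fold. -/
def foldData {n : ℕ} (s : Fin n → Obs d) (ℓ : Fin L) : {i : Fin n // A.fold n i = ℓ} → Obs d :=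
  fun i => s i.1

/-- The truncated weight estimator of fold `ℓ`, with truncation at the level `√n`. -/
def wTrunc (M : PolicyModel d p Ω₀) (a : ℝ) (n : ℕ) (ℓ : Fin L)
    (D : {i : Fin n // A.fold n i ≠ ℓ} → Obs d) : ℝ × Cov d → ℝ :=
  M.truncW a √n (A.ωhat n ℓ D)

/-- The truncated regression estimator of fold `ℓ`. -/
def qTrunc (M : PolicyModel d p Ω₀) (C b : ℝ) (n : ℕ) (ℓ : Fin L)
    (D : {i : Fin n // A.fold n i ≠ ℓ} → Obs d) : ℝ × Cov d → ℝ :=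
  M.truncQ C b (A.mhat n ℓ D)

/-- The average over all observations of a function that may depend on the training data of the
fold of the observation. -/
def foldAverage {n : ℕ} (F : (ℓ : Fin L) → ({i : Fin n // A.fold n i ≠ ℓ} → Obs d) → Obs d → ℝ)
    (s : Fin n → Obs d) : ℝ :=
  (1 / (n : ℝ)) * ∑ ℓ, ∑ i, F ℓ (A.train s ℓ) (A.foldData s ℓ i)

/-- The doubly robust welfare estimator with truncated nuisance estimators. -/
def truncWelfare (M : PolicyModel d p Ω₀) (C a b : ℝ) {n : ℕ} (s : Fin n → Obs d) (θ : Par p) : ℝ :=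
  A.foldAverage (fun ℓ D => M.score (A.wTrunc M a n ℓ D) (A.qTrunc M C b n ℓ D) (M.pol₂ θ)) s

lemma measurable_train {n : ℕ} (ℓ : Fin L) :
    Measurable fun s : Fin n → Obs d => A.train s ℓ := by
  unfold train; fun_prop

lemma measurable_foldData {n : ℕ} (ℓ : Fin L) :
    Measurable fun s : Fin n → Obs d => A.foldData s ℓ := by
  unfold foldData; fun_prop

lemma measurable_wTrunc (M : PolicyModel d p Ω₀) (a : ℝ) (n : ℕ) (ℓ : Fin L) :
    Measurable (Function.uncurry (A.wTrunc M a n ℓ)) :=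
  M.measurable_truncW (A.measurable_ωhat n ℓ) a _

lemma measurable_qTrunc (M : PolicyModel d p Ω₀) (C b : ℝ) (n : ℕ) (ℓ : Fin L) :
    Measurable (Function.uncurry (A.qTrunc M C b n ℓ)) :=
  M.measurable_truncQ (A.measurable_mhat n ℓ) C b

lemma close_trunc {M : PolicyModel d p Ω₀} {θs : Par p} {C r : ℝ} (R : M.Regular θs C r) {a b : ℝ}
    (ha : 0 < a) (hb : 0 < b) (n : ℕ) (ℓ : Fin L) (D : {i : Fin n // A.fold n i ≠ ℓ} → Obs d) :
    M.Close C (A.wTrunc M a n ℓ D) (A.qTrunc M C b n ℓ D) a b :=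
  R.close_trunc ((A.measurable_ωhat n ℓ).comp measurable_prodMk_left)
    ((A.measurable_mhat n ℓ).comp measurable_prodMk_left) ha hb _

lemma card_foldType_le (n : ℕ) (ℓ : Fin L) : Fintype.card {i : Fin n // A.fold n i = ℓ} ≤ n :=
  (Fintype.card_subtype_le _).trans_eq (Fintype.card_fin n)

/-- Summation over the folds, and over the indices in each fold, is summation over all indices. -/
lemma sum_fold {n : ℕ} (f : Fin n → Fin L → ℝ) :
    ∑ ℓ, ∑ i : {i : Fin n // A.fold n i = ℓ}, f i.1 ℓ = ∑ i, f i (A.fold n i) := by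
  rw [← Finset.sum_fiberwise Finset.univ (A.fold n) fun i => f i (A.fold n i)]
  refine Finset.sum_congr rfl fun ℓ _ => ?_
  rw [Finset.sum_subtype (Finset.univ.filter fun i => A.fold n i = ℓ) (p := fun i => A.fold n i = ℓ)
    (by simp)]
  refine Finset.sum_congr rfl fun i _ => ?_
  rw [i.2]

/-- An average over all observations, without dependence on training data. -/
lemma foldAverage_const {n : ℕ} (f : Obs d → ℝ) (s : Fin n → Obs d) :
    A.foldAverage (fun _ _ => f) s = (1 / (n : ℝ)) * ∑ i, f (s i) := by
  rw [foldAverage]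
  congr 1
  exact A.sum_fold fun i _ => f (s i)

section Sample

variable {Ω : Type*} [MeasurableSpace Ω] {P : Measure Ω}
  {Z : ℕ → Ω → Obs d} {μ : Measure (Obs d)}

lemma measurable_sample (hZ : ∀ i, Measurable (Z i)) (n : ℕ) : Measurable (sample Z n) :=
  measurable_pi_lambda _ fun i => hZ i

lemma indepFun_train_foldData (hZ : ∀ i, Measurable (Z i)) (hind : iIndepFun Z P) (n : ℕ)
    (ℓ : Fin L) :
    IndepFun (fun w => A.train (sample Z n w) ℓ) (fun w => A.foldData (sample Z n w) ℓ) P := by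
  have h1 : iIndepFun (fun i : Fin n => Z i) P := hind.precomp Fin.val_injective
  have h2 := h1.indepFun_finset (Finset.univ.filter fun i => A.fold n i ≠ ℓ)
    (Finset.univ.filter fun i => A.fold n i = ℓ)
    (Finset.disjoint_filter.2 fun i _ h => h) (fun i => hZ i)
  let φ : ((Finset.univ.filter fun i => A.fold n i ≠ ℓ : Finset (Fin n)) → Obs d) →
      {i : Fin n // A.fold n i ≠ ℓ} → Obs d := fun s i => s ⟨i.1, by simpa using i.2⟩
  let ψ : ((Finset.univ.filter fun i => A.fold n i = ℓ : Finset (Fin n)) → Obs d) →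
      {i : Fin n // A.fold n i = ℓ} → Obs d := fun s i => s ⟨i.1, by simpa using i.2⟩
  have hφ : Measurable φ := measurable_pi_lambda _ fun i => measurable_pi_apply _
  have hψ : Measurable ψ := measurable_pi_lambda _ fun i => measurable_pi_apply _
  exact h2.comp hφ hψ

lemma map_foldData [IsProbabilityMeasure P] (hZ : ∀ i, Measurable (Z i)) (hind : iIndepFun Z P)
    (hlaw : ∀ i, P.map (Z i) = μ) (n : ℕ) (ℓ : Fin L) :
    P.map (fun w => A.foldData (sample Z n w) ℓ) = Measure.pi fun _ => μ := by
  have h1 : iIndepFun (fun i : {i : Fin n // A.fold n i = ℓ} => Z i.1) P :=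
    hind.precomp (g := fun i : {i : Fin n // A.fold n i = ℓ} => (i.1 : ℕ))
      fun i j h => Subtype.ext (Fin.val_injective h)
  have h2 := (iIndepFun_iff_map_fun_eq_pi_map fun i => (hZ _).aemeasurable).1 h1
  simp_rw [hlaw] at h2
  exact h2

lemma ae_sample (hZ : ∀ i, Measurable (Z i)) (hlaw : ∀ i, P.map (Z i) = μ) {Q : Obs d → Prop}
    (hQ : ∀ᵐ z ∂μ, Q z) : ∀ᵐ w ∂P, ∀ i, Q (Z i w) := by
  refine ae_all_iff.2 fun i => ae_of_ae_map (hZ i).aemeasurable ?_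
  rwa [hlaw i]

end Sample

/-- On samples at which no truncation is active, truncating the nuisance estimators does not change
the welfare estimator. -/
lemma drWelfare_eq_truncWelfare {M : PolicyModel d p Ω₀} {C a b : ℝ} {n : ℕ} {s : Fin n → Obs d}
    (hw : ∀ ℓ, eLpNorm (fun z => A.ωhatOn s ℓ z - M.ω z.1 z.2) 2 M.lawTX ≤ ENNReal.ofReal a)
    (hq : ∀ ℓ, eLpNorm (fun z => A.mhatOn s ℓ z - M.m z.1 z.2) 2 M.lawTX ≤ ENNReal.ofReal b)
    (hqC : ∀ ℓ, ∀ t ∈ M.𝒯, ∀ x ∈ M.𝒳, |A.mhatOn s ℓ (t, x)| ≤ C)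
    (hs : ∀ i, (s i).2.1 ∈ M.𝒯 ∧ (s i).2.2 ∈ M.𝒳)
    (hρ : ∀ ℓ i, |A.ωhatOn s ℓ (A.foldData s ℓ i).2 - M.ω₂ (A.foldData s ℓ i).2| ≤ √n)
    {θ : Par p} (hθ : θ ∈ M.Θ) :
    A.drWelfare M s θ = A.truncWelfare M C a b s θ := by
  rw [drWelfare, truncWelfare, foldAverage]
  congr 1
  refine Finset.sum_congr rfl fun ℓ _ => ?_
  rw [Finset.sum_subtype (Finset.univ.filter fun i => A.fold n i = ℓ) (p := fun i => A.fold n i = ℓ)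
    (by simp)]
  refine Finset.sum_congr rfl fun i _ => ?_
  exact PolicyModel.Regular.score_trunc_eq (hw ℓ) (hq ℓ) (hqC ℓ) (hs i).1 (hs i).2 (hρ ℓ i) hθ

/-- With probability tending to one, truncating the nuisance estimators does not change the welfare
estimator. -/
lemma tendsto_measure_drWelfare_ne {M : PolicyModel d p Ω₀} {Ω : Type*} [MeasurableSpace Ω]
    {P : Measure Ω} [IsProbabilityMeasure P] {Z : ℕ → Ω → Obs d} (hZ : ∀ i, Measurable (Z i))
    (hind : iIndepFun Z P) (hlaw : ∀ i, P.map (Z i) = M.obsLaw) {C : ℝ} {a b : ℕ → ℝ}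
    (ha0 : ∀ n, 1 ≤ n → 0 ≤ a n) (ha : Tendsto a atTop (𝓝 0))
    (hw : ∀ ℓ, Tendsto (fun n => P {w | ENNReal.ofReal (a n)
      < eLpNorm (fun z => A.ωhatOn (sample Z n w) ℓ z - M.ω z.1 z.2) 2 M.lawTX}) atTop (𝓝 0))
    (hq : ∀ ℓ, Tendsto (fun n => P {w | ENNReal.ofReal (b n)
      < eLpNorm (fun z => A.mhatOn (sample Z n w) ℓ z - M.m z.1 z.2) 2 M.lawTX}) atTop (𝓝 0))
    (hqC : ∀ ℓ, Tendsto (fun n => P {w | ∃ t ∈ M.𝒯, ∃ x ∈ M.𝒳,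
      C < |A.mhatOn (sample Z n w) ℓ (t, x)|}) atTop (𝓝 0)) :
    Tendsto (fun n => P {w | ¬ ∀ θ ∈ M.Θ, A.drWelfare M (sample Z n w) θ
      = A.truncWelfare M C (a n) (b n) (sample Z n w) θ}) atTop (𝓝 0) := by
  classical
  have hbase : ∀ᵐ w ∂P, ∀ i, (Z i w).2.1 ∈ M.𝒯 ∧ (Z i w).2.2 ∈ M.𝒳 := by
    refine ae_sample (Q := fun z => z.2.1 ∈ M.𝒯 ∧ z.2.2 ∈ M.𝒳) hZ hlaw ?_
    filter_upwards [M.ae_obsLaw M.ae_base_mem] with z hz using hz.1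
  -- the weight estimator, set to the truth if the training data are bad
  let f : (n : ℕ) → (ℓ : Fin L) → ({i : Fin n // A.fold n i ≠ ℓ} → Obs d) → Obs d → ℝ :=
    fun n ℓ D z => if eLpNorm (fun z => A.ωhat n ℓ D z - M.ω₂ z) 2 M.lawTX ≤ ENNReal.ofReal (a n)
      then A.ωhat n ℓ D z.2 - M.ω₂ z.2 else 0
  have hf : ∀ n ℓ, Measurable (Function.uncurry (f n ℓ)) := fun n ℓ => by
    have h1 : Measurable (Function.uncurry fun D z => A.ωhat n ℓ D z - M.ω₂ z) :=
      (A.measurable_ωhat n ℓ).sub (M.measurable_ω₂.comp measurable_snd)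
    refine Measurable.ite
      (measurableSet_le ((measurable_eLpNorm_two (μ := M.lawTX) h1).comp measurable_fst)
        measurable_const) ?_ measurable_const
    exact h1.comp (measurable_fst.prodMk measurable_snd.snd)
  have hsq : ∀ n ℓ, 1 ≤ n → ∀ D, ∫⁻ z, ENNReal.ofReal (f n ℓ D z ^ 2) ∂M.obsLaw
      ≤ ENNReal.ofReal (a n ^ 2) := by
    intro n ℓ hn D
    by_cases hD : eLpNorm (fun z => A.ωhat n ℓ D z - M.ω₂ z) 2 M.lawTX ≤ ENNReal.ofReal (a n)
    · have hm : Measurable fun z => A.ωhat n ℓ D z - M.ω₂ z :=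
        ((A.measurable_ωhat n ℓ).comp measurable_prodMk_left).sub M.measurable_ω₂
      obtain ⟨h1, h2⟩ := memLp_two_of_eLpNorm_le hm (ha0 n hn) hD
      have h3 := PolicyModel.Regular.memLp_comp_snd h1
      simp only [f, hD, if_true]
      rw [← ofReal_integral_eq_lintegral_ofReal h3.integrable_sq
        (Eventually.of_forall fun _ => sq_nonneg _)]
      apply ENNReal.ofReal_le_ofReal
      exact (PolicyModel.Regular.integral_comp_snd (hm.pow_const 2)).trans_le h2
    · simp [f, hD]
  have htail : ∀ (n : ℕ) (ℓ : Fin L), 1 ≤ n → P {w | ∃ i, √(n : ℝ)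
      < |f n ℓ (A.train (sample Z n w) ℓ) (A.foldData (sample Z n w) ℓ i)|}
        ≤ ENNReal.ofReal (a n ^ 2) := fun n ℓ hn =>
    measure_exists_sqrt_lt_le ((A.measurable_train ℓ).comp (measurable_sample hZ n))
      ((A.measurable_foldData ℓ).comp (measurable_sample hZ n))
      (A.indepFun_train_foldData hZ hind n ℓ) (A.map_foldData hZ hind hlaw n ℓ) hn
      (A.card_foldType_le n ℓ) (hf n ℓ) (hsq n ℓ hn)
  set p1 := fun n ℓ => P {w | ENNReal.ofReal (a n)
      < eLpNorm (fun z => A.ωhatOn (sample Z n w) ℓ z - M.ω z.1 z.2) 2 M.lawTX}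
  set p2 := fun n ℓ => P {w | ENNReal.ofReal (b n)
      < eLpNorm (fun z => A.mhatOn (sample Z n w) ℓ z - M.m z.1 z.2) 2 M.lawTX}
  set p3 := fun n ℓ => P {w | ∃ t ∈ M.𝒯, ∃ x ∈ M.𝒳, C < |A.mhatOn (sample Z n w) ℓ (t, x)|}
  have hlim : Tendsto (fun n => ∑ ℓ, (p1 n ℓ + p2 n ℓ + p3 n ℓ + ENNReal.ofReal (a n ^ 2))) atTop
      (𝓝 0) := by
    have h1 : Tendsto (fun n => ENNReal.ofReal (a n ^ 2)) atTop (𝓝 0) := by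
      simpa using ENNReal.tendsto_ofReal (ha.pow 2)
    simpa using tendsto_finsetSum Finset.univ fun ℓ _ => (((hw ℓ).add (hq ℓ)).add (hqC ℓ)).add h1
  refine tendsto_of_tendsto_of_tendsto_of_le_of_le' tendsto_const_nhds hlim
    (Eventually.of_forall fun _ => zero_le) ?_
  filter_upwards [eventually_ge_atTop 1] with n hn
  have hsub : {w | ¬ ∀ θ ∈ M.Θ, A.drWelfare M (sample Z n w) θ
      = A.truncWelfare M C (a n) (b n) (sample Z n w) θ}
      ⊆ {w | ¬ ∀ i, (Z i w).2.1 ∈ M.𝒯 ∧ (Z i w).2.2 ∈ M.𝒳} ∪ ⋃ ℓ, (({w | ENNReal.ofReal (a n)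
        < eLpNorm (fun z => A.ωhatOn (sample Z n w) ℓ z - M.ω z.1 z.2) 2 M.lawTX}
      ∪ {w | ENNReal.ofReal (b n)
        < eLpNorm (fun z => A.mhatOn (sample Z n w) ℓ z - M.m z.1 z.2) 2 M.lawTX}
      ∪ {w | ∃ t ∈ M.𝒯, ∃ x ∈ M.𝒳, C < |A.mhatOn (sample Z n w) ℓ (t, x)|})
      ∪ {w | ∃ i, √(n : ℝ)
        < |f n ℓ (A.train (sample Z n w) ℓ) (A.foldData (sample Z n w) ℓ i)|}) := by
    intro w hw
    by_contra hcon
    simp only [Set.mem_union, Set.mem_iUnion, Set.mem_ofPred_eq, not_or, not_exists, not_lt,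
      not_and, not_not] at hcon
    obtain ⟨c1, c2⟩ := hcon
    refine hw fun θ hθ => A.drWelfare_eq_truncWelfare (fun ℓ => (c2 ℓ).1.1.1)
      (fun ℓ => (c2 ℓ).1.1.2) (fun ℓ => (c2 ℓ).1.2) (fun i => c1 i) (fun ℓ i => ?_) hθ
    have h1 := (c2 ℓ).2 i
    have h2 : eLpNorm (fun z => A.ωhat n ℓ (A.train (sample Z n w) ℓ) z - M.ω₂ z) 2 M.lawTX
      ≤ ENNReal.ofReal (a n) := (c2 ℓ).1.1.1
    simp only [f, h2, if_true] at h1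
    exact h1
  refine (measure_mono hsub).trans ((measure_union_le _ _).trans ?_)
  rw [show P {w | ¬ ∀ i, (Z i w).2.1 ∈ M.𝒯 ∧ (Z i w).2.2 ∈ M.𝒳} = 0 from hbase, zero_add]
  refine (measure_iUnion_fintype_le _ _).trans (Finset.sum_le_sum fun ℓ _ => ?_)
  refine (measure_union_le _ _).trans (add_le_add ((measure_union_le _ _).trans
    (add_le_add (measure_union_le _ _) le_rfl)) (htail n ℓ hn))

end CrossFitting

/-! ### Stochastic differentiability of the welfare estimator -/

/-- The remainder at `h` of the expansion at `θs` of the criterion functions `Wn` around their limit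
`W`, with normalized gradient `S`. -/
def expansionRem {Ω E : Type*} [NormedAddCommGroup E] [InnerProductSpace ℝ E]
    (Wn : ℕ → Ω → E → ℝ) (W : E → ℝ) (S : ℕ → Ω → E) (θs : E) (n : ℕ) (w : Ω) (h : E) : ℝ :=
  Wn n w (θs + h) - Wn n w θs - (W (θs + h) - W θs) - (√(n : ℝ))⁻¹ * inner ℝ (S n w) h

/-- Stochastic differentiability: outside an event of small probability, the remainder of
the expansion on the ball of radius `δ` is at most `δ / √n` times a variable with small expectation,
for all small `δ`. The exceptional event does not depend on `δ`, while the dominating variable may: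
the peeling argument takes a union over shells of dominating variables, and pays for the
exceptional event once. -/
def StochDiff {Ω E : Type*} [MeasurableSpace Ω] [NormedAddCommGroup E] [InnerProductSpace ℝ E]
    (P : Measure Ω) (Wn : ℕ → Ω → E → ℝ) (W : E → ℝ) (S : ℕ → Ω → E) (θs : E) : Prop :=
  ∀ η : ℝ, 0 < η → ∃ δ₁ : ℝ, 0 < δ₁ ∧ ∀ᶠ n : ℕ in atTop, ∃ B : Set Ω, P B ≤ ENNReal.ofReal η ∧
    ∀ δ : ℝ, 0 < δ → δ ≤ δ₁ → ∃ T : Ω → ℝ≥0∞, AEMeasurable T P ∧ ∫⁻ w, T w ∂P ≤ ENNReal.ofReal η ∧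
      ∀ᵐ w ∂P, w ∉ B → ∀ h : E, ‖h‖ ≤ δ →
        ENNReal.ofReal |expansionRem Wn W S θs n w h| ≤ ENNReal.ofReal (δ / √(n : ℝ)) * T w

namespace CrossFitting

variable {d p L : ℕ} {Ω₀ : Type*} [MeasurableSpace Ω₀] (A : CrossFitting d L)
  {M : PolicyModel d p Ω₀} {θs : Par p} {C r : ℝ} {g : ℝ × Cov d → Par p}

/-- The remainder of the expansion is, up to the bias of second order in the nuisance functions, the
sum of the centred empirical processes of the folds. -/
lemma abs_truncWelfare_expansion_le [StandardBorelSpace Ω₀] [Nonempty Ω₀] (R : M.Regular θs C r)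
    (G : M.GradVersion θs C g) (hU : M.Unconfounded) (hd : DifferentiableAt ℝ M.welfare θs)
    (h0 : ∇ M.welfare θs = 0) {n : ℕ} (hn : 1 ≤ n) {s : Fin n → Obs d}
    (hs : ∀ i, (s i).2.2 ∈ M.𝒳) {a b δ : ℝ} (ha : 0 < a) (hb : 0 < b) (hδ : 0 < δ)
    (hδr : δ * parConst p < r) {u : Fin p → ℝ} (hu : ‖u‖ ≤ 1) :
    |A.truncWelfare M C a b s (θs + δ • toPar p u) - A.truncWelfare M C a b s θs
      - (M.welfare (θs + δ • toPar p u) - M.welfare θs)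
      - (1 / (n : ℝ)) * ∑ i, inner ℝ (M.influence g (s i)) (δ • toPar p u)|
    ≤ δ / √(n : ℝ) * (∑ ℓ, |(√(n : ℝ))⁻¹ * ∑ i, M.scoreCtr θs g (A.wTrunc M a n ℓ (A.train s ℓ))
        (A.qTrunc M C b n ℓ (A.train s ℓ)) δ u (A.foldData s ℓ i)|
      + √(n : ℝ) * (C * parConst p * (a * b))) := by
  have hC := R.C_pos
  have hn0 : (0 : ℝ) < n := by exact_mod_cast hn
  have hsn0 : 0 < √(n : ℝ) := Real.sqrt_pos.2 hn0
  set h := δ • toPar p u with hh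
  have hhr : ‖h‖ < r := PolicyModel.Regular.norm_smul_toPar_lt hδ hδr hu
  have hhn : ‖h‖ ≤ δ * parConst p := by
    rw [hh, norm_smul, Real.norm_of_nonneg hδ.le]
    gcongr
    refine (norm_toPar_le u).trans ?_
    have := one_le_parConst p
    calc parConst p * ‖u‖ ≤ parConst p * 1 := by gcongr
      _ = parConst p := mul_one _
  have hθs : θs ∈ M.Θ := R.ball_subset R.mem_ball_self
  have hcl := fun ℓ => A.close_trunc R ha hb n ℓ (A.train s ℓ)
  set w := fun ℓ => A.wTrunc M a n ℓ (A.train s ℓ)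
  set q := fun ℓ => A.qTrunc M C b n ℓ (A.train s ℓ)
  set ΔW := M.welfare (θs + h) - M.welfare θs
  set e : Fin L → ℝ := fun ℓ => ∫ y, M.scoreRem θs g (w ℓ) (q ℓ) h y ∂M.obsLaw - ΔW
  have he : ∀ ℓ, |e ℓ| ≤ C * (δ * parConst p) * (a * b) := fun ℓ =>
    (R.abs_integral_scoreRem_sub_le G (hcl ℓ) hU hd h0 hhr).trans (by gcongr)
  have hterm : ∀ (ℓ : Fin L) (z : Obs d), z.2.2 ∈ M.𝒳 →
      M.score (w ℓ) (q ℓ) (M.pol₂ (θs + h)) z - M.score (w ℓ) (q ℓ) (M.pol₂ θs) z - ΔW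
        - inner ℝ (M.influence g z) h = δ * M.scoreCtr θs g (w ℓ) (q ℓ) δ u z + e ℓ := by
    intro ℓ z hz
    have h1 := R.score_pol_sub (w ℓ) (hcl ℓ).measurable_q hz
      (Eventually.of_forall fun t => (hcl ℓ).abs_q_le _) (R.mem_Θ hhr) hθs
    rw [PolicyModel.scoreCtr, ← mul_assoc, mul_inv_cancel₀ hδ.ne', one_mul, ← hh,
      PolicyModel.scoreRem, h1]
    simp only [e]
    ring
  have hW : ΔW = (1 / (n : ℝ)) * ∑ ℓ : Fin L, ∑ _i : {i : Fin n // A.fold n i = ℓ}, ΔW := by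
    rw [A.sum_fold fun _ _ => ΔW, Finset.sum_const, Finset.card_univ, Fintype.card_fin,
      nsmul_eq_mul]
    field_simp
  have hinner : ∑ i, inner ℝ (M.influence g (s i)) h
      = ∑ ℓ : Fin L, ∑ i, inner ℝ (M.influence g (A.foldData s ℓ i)) h :=
    (A.sum_fold fun i _ => inner ℝ (M.influence g (s i)) h).symm
  -- the summands of fold `ℓ` are `δ` times the centred remainders, plus the bias `e ℓ`
  have key : A.truncWelfare M C a b s (θs + h) - A.truncWelfare M C a b s θs - ΔW
      - (1 / (n : ℝ)) * ∑ i, inner ℝ (M.influence g (s i)) h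
      = (1 / (n : ℝ)) * (∑ ℓ, δ * ∑ i, M.scoreCtr θs g (w ℓ) (q ℓ) δ u (A.foldData s ℓ i)
        + ∑ ℓ, ∑ _i : {i : Fin n // A.fold n i = ℓ}, e ℓ) := by
    rw [hinner]
    nth_rewrite 1 [hW]
    rw [truncWelfare, truncWelfare, foldAverage, foldAverage, ← mul_sub, ← mul_sub, ← mul_sub]
    congr 1
    simp only [← Finset.sum_sub_distrib, ← Finset.sum_add_distrib, Finset.mul_sum]
    refine Finset.sum_congr rfl fun ℓ _ => Finset.sum_congr rfl fun i _ => ?_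
    exact hterm ℓ _ (hs i.1)
  rw [key]
  have b1 : |∑ ℓ, ∑ _i : {i : Fin n // A.fold n i = ℓ}, e ℓ|
      ≤ n * (C * (δ * parConst p) * (a * b)) := by
    rw [A.sum_fold fun _ ℓ => e ℓ]
    refine (Finset.abs_sum_le_sum_abs _ _).trans ?_
    refine (Finset.sum_le_sum fun i _ => he (A.fold n i)).trans_eq ?_
    simp
  have b2 : |∑ ℓ, δ * ∑ i, M.scoreCtr θs g (w ℓ) (q ℓ) δ u (A.foldData s ℓ i)|
      ≤ δ * √(n : ℝ) * ∑ ℓ, |(√(n : ℝ))⁻¹ * ∑ i, M.scoreCtr θs g (w ℓ) (q ℓ) δ u (A.foldData s ℓ i)| := by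
    refine (Finset.abs_sum_le_sum_abs _ _).trans (le_of_eq ?_)
    rw [Finset.mul_sum]
    refine Finset.sum_congr rfl fun ℓ _ => ?_
    rw [abs_mul, abs_mul, abs_of_pos hδ, abs_of_pos (inv_pos.2 hsn0)]
    field_simp
  rw [abs_mul, abs_of_pos (by positivity : 0 < 1 / (n : ℝ))]
  refine (mul_le_mul_of_nonneg_left ((abs_add_le _ _).trans (add_le_add b2 b1))
    (by positivity)).trans (le_of_eq ?_)
  have hsq : (n : ℝ) = √(n : ℝ) * √(n : ℝ) := (Real.mul_self_sqrt hn0.le).symm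
  set x := √(n : ℝ)
  rw [hsq]
  field_simp
  rfl

lemma tendsto_const_mul_rpow_neg {ρ : ℝ} (hρ : 0 < ρ) (ε : ℝ) :
    Tendsto (fun n : ℕ => ε * (n : ℝ) ^ (-ρ)) atTop (𝓝 0) := by
  simpa using ((tendsto_rpow_neg_atTop hρ).comp tendsto_natCast_atTop_atTop).const_mul ε

/-- The doubly robust welfare estimator is stochastically differentiable at `θs`, with the influence
function as its derivative. -/
theorem stochDiff_drWelfare [StandardBorelSpace Ω₀] [Nonempty Ω₀] (R : M.Regular θs C r)
    (G : M.GradVersion θs C g) (hU : M.Unconfounded) (hd : DifferentiableAt ℝ M.welfare θs)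
    (h0 : ∇ M.welfare θs = 0) {Ω : Type*} [MeasurableSpace Ω] {P : Measure Ω}
    [IsProbabilityMeasure P] {Z : ℕ → Ω → Obs d} (hZ : ∀ i, Measurable (Z i))
    (hind : iIndepFun Z P) (hlaw : ∀ i, P.map (Z i) = M.obsLaw) {ρω ρm : ℝ} (hω : 0 < ρω)
    (hm : 0 < ρm) (hρ : 1 / 2 ≤ ρω + ρm)
    (hw : ∀ ℓ : Fin L, IsLittleOInProb P
      (fun n w => eLpNorm (fun z => A.ωhatOn (sample Z n w) ℓ z - M.ω z.1 z.2) 2 M.lawTX)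
      (fun n => (n : ℝ) ^ (-ρω)))
    (hq : ∀ ℓ : Fin L, IsLittleOInProb P
      (fun n w => eLpNorm (fun z => A.mhatOn (sample Z n w) ℓ z - M.m z.1 z.2) 2 M.lawTX)
      (fun n => (n : ℝ) ^ (-ρm)))
    (hqC : ∀ ℓ, Tendsto (fun n => P {w | ∃ t ∈ M.𝒯, ∃ x ∈ M.𝒳,
      C < |A.mhatOn (sample Z n w) ℓ (t, x)|}) atTop (𝓝 0)) :
    StochDiff P (fun n w => A.drWelfare M (sample Z n w)) M.welfare
      (fun n w => (√(n : ℝ))⁻¹ • ∑ k ∈ Finset.range n, M.influence g (Z k w)) θs := by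
  intro η hη
  have hC := R.C_pos
  have hp := one_le_parConst p
  set η' : ℝ := η / (2 * (L + 1)) with hη'
  have hη'0 : 0 < η' := by positivity
  set κ : ℝ := C * parConst p with hκ
  have hκ0 : 0 < κ := by positivity
  obtain ⟨ε₀, hε₀, hε₀1, δ₀, hδ₀, hδ₀r, hfold⟩ := R.exists_fold_bound G hη'0
  set ε : ℝ := min ε₀ (η / (2 * κ)) with hε
  have hε0 : 0 < ε := lt_min hε₀ (by positivity)
  have hε1 : ε ≤ 1 := (min_le_left _ _).trans hε₀1
  have hεκ : κ * (ε * ε) ≤ η / 2 := by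
    calc κ * (ε * ε) ≤ κ * (1 * (η / (2 * κ))) := by gcongr; exact min_le_right _ _
      _ = η / 2 := by field_simp
  have hpow : ∀ {n : ℕ}, 1 ≤ n → ∀ {ρ : ℝ}, 0 < ρ → 0 < ε * (n : ℝ) ^ (-ρ) ∧
      ε * (n : ℝ) ^ (-ρ) ≤ ε := by
    intro n hn ρ hρ
    have hn1 : (1 : ℝ) ≤ n := by exact_mod_cast hn
    refine ⟨mul_pos hε0 (Real.rpow_pos_of_pos (by linarith) _), ?_⟩
    exact mul_le_of_le_one_right hε0.le (Real.rpow_le_one_of_one_le_of_nonpos hn1 (by linarith))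
  have hbad := A.tendsto_measure_drWelfare_ne hZ hind hlaw (C := C)
    (fun n hn => (hpow hn hω).1.le) (tendsto_const_mul_rpow_neg hω ε)
    (fun ℓ => hw ℓ ε hε0) (fun ℓ => hq ℓ ε hε0) hqC
  refine ⟨δ₀, hδ₀, ?_⟩
  filter_upwards [eventually_ge_atTop 1,
    hbad.eventually_le_const (ENNReal.ofReal_pos.2 hη)] with n hn hB
  refine ⟨_, hB, fun δ hδ hδ1 => ?_⟩
  have hn1 : (1 : ℝ) ≤ n := by exact_mod_cast hn
  have hn0 : (0 : ℝ) < n := by linarith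
  obtain ⟨ha0, ha1⟩ := hpow hn hω
  obtain ⟨hb0, hb1⟩ := hpow hn hm
  set a := ε * (n : ℝ) ^ (-ρω)
  set b := ε * (n : ℝ) ^ (-ρm)
  have hδr : δ * parConst p < r := lt_of_le_of_lt (by gcongr) hδ₀r
  -- the bias, by the product rate of the nuisance estimators
  have hbias : √(n : ℝ) * (κ * (a * b)) ≤ η / 2 := by
    have h1 : √(n : ℝ) * ((n : ℝ) ^ (-ρω) * (n : ℝ) ^ (-ρm)) ≤ 1 := by
      rw [Real.sqrt_eq_rpow, ← Real.rpow_add hn0, ← Real.rpow_add hn0]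
      exact Real.rpow_le_one_of_one_le_of_nonpos hn1 (by linarith)
    calc √(n : ℝ) * (κ * (a * b))
        = κ * (ε * ε) * (√(n : ℝ) * ((n : ℝ) ^ (-ρω) * (n : ℝ) ^ (-ρm))) := by
          simp only [a, b]; ring
      _ ≤ κ * (ε * ε) * 1 := by gcongr
      _ ≤ η / 2 := by rw [mul_one]; exact hεκ
  have hex := fun ℓ : Fin L => hfold P (fun w => A.train (sample Z n w) ℓ)
    (fun w => A.foldData (sample Z n w) ℓ) ((A.measurable_train ℓ).comp (measurable_sample hZ n))
    ((A.measurable_foldData ℓ).comp (measurable_sample hZ n))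
    (A.indepFun_train_foldData hZ hind n ℓ) (A.map_foldData hZ hind hlaw n ℓ) n hn
    (A.card_foldType_le n ℓ) (A.wTrunc M a n ℓ) (A.qTrunc M C b n ℓ) (A.measurable_wTrunc M a n ℓ)
    (A.measurable_qTrunc M C b n ℓ) a b (ha1.trans (min_le_left _ _))
    (hb1.trans (min_le_left _ _)) (fun D => A.close_trunc R ha0 hb0 n ℓ D)
    (fun D z => PolicyModel.abs_truncW_sub_le (Real.sqrt_nonneg _) _ z) δ hδ hδ1
  choose T hTm hT1 hT2 using hex
  refine ⟨fun w => ∑ ℓ, T ℓ w + ENNReal.ofReal (η / 2), ?_, ?_, ?_⟩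
  · exact (Finset.aemeasurable_fun_sum _ fun ℓ _ => hTm ℓ).add aemeasurable_const
  · rw [lintegral_add_right _ measurable_const, lintegral_const, measure_univ, mul_one,
      lintegral_finsetSum' _ fun ℓ _ => hTm ℓ]
    refine (add_le_add (Finset.sum_le_sum fun ℓ _ => hT2 ℓ) le_rfl).trans ?_
    rw [Finset.sum_const, nsmul_eq_mul, Finset.card_univ, Fintype.card_fin,
      ← ENNReal.ofReal_natCast, ← ENNReal.ofReal_mul (by positivity),
      ← ENNReal.ofReal_add (by positivity) (by positivity)]
    apply ENNReal.ofReal_le_ofReal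
    have : (L : ℝ) * η' ≤ η / 2 := by
      calc (L : ℝ) * η' ≤ (L + 1) * η' := by gcongr; linarith
        _ = η / 2 := by rw [hη']; field_simp
    linarith
  · have hbase : ∀ᵐ w ∂P, ∀ i, (Z i w).2.2 ∈ M.𝒳 := by
      refine ae_sample (Q := fun z => z.2.2 ∈ M.𝒳) hZ hlaw ?_
      filter_upwards [R.ae_good] with z hz using hz.2.2.1
    filter_upwards [hbase, ae_all_iff.2 hT1] with w hw1 hw2 hwB h hh
    obtain ⟨u, hu, rfl⟩ := exists_eq_smul_toPar hδ hh
    rw [not_not] at hwB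
    have hsu := PolicyModel.Regular.norm_smul_toPar_lt hδ hδr hu
    have hdec := A.abs_truncWelfare_expansion_le R G hU hd h0 hn (s := sample Z n w)
      (fun i => hw1 i) ha0 hb0 hδ hδr hu
    have hsum : (√(n : ℝ))⁻¹ * inner ℝ ((√(n : ℝ))⁻¹ • ∑ k ∈ Finset.range n, M.influence g (Z k w))
          (δ • toPar p u)
        = (1 / (n : ℝ)) * ∑ i : Fin n, inner ℝ (M.influence g (sample Z n w i)) (δ • toPar p u) := by
      rw [real_inner_smul_left, sum_inner, ← mul_assoc, ← mul_inv, Real.mul_self_sqrt hn0.le,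
        one_div, Finset.sum_range]
      rfl
    rw [expansionRem, hwB _ (R.mem_Θ hsu), hwB _ (R.ball_subset R.mem_ball_self), hsum]
    refine (ENNReal.ofReal_le_ofReal hdec).trans ?_
    rw [ENNReal.ofReal_mul (by positivity)]
    gcongr
    rw [ENNReal.ofReal_add (Finset.sum_nonneg fun _ _ => abs_nonneg _) (by positivity),
      ENNReal.ofReal_sum_of_nonneg fun _ _ => abs_nonneg _]
    exact add_le_add (Finset.sum_le_sum fun ℓ _ => hw2 ℓ u hu) (ENNReal.ofReal_le_ofReal hbias)

end CrossFitting

/-! ### Uniform consistency of the welfare estimator -/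

namespace PolicyModel

variable {d p : ℕ} {Ω₀ : Type*} [MeasurableSpace Ω₀] {M : PolicyModel d p Ω₀}

lemma measurable_scoreErr_param {𝒟 : Type*} [MeasurableSpace 𝒟] {w q : 𝒟 → ℝ × Cov d → ℝ}
    (hw : Measurable (Function.uncurry w)) (hq : Measurable (Function.uncurry q)) (C : ℝ) :
    Measurable fun y : 𝒟 × Obs d => M.scoreErr C (w y.1) (q y.1) y.2 := by
  have h1 : Measurable fun y : 𝒟 × Obs d => w y.1 y.2.2 :=
    hw.comp (measurable_fst.prodMk measurable_snd.snd)
  have h2 : Measurable fun y : 𝒟 × Obs d => q y.1 y.2.2 :=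
    hq.comp (measurable_fst.prodMk measurable_snd.snd)
  have h3 : Measurable fun y : (𝒟 × Obs d) × ℝ =>
      |q y.1.1 (y.2, y.1.2.2.2) - M.m₂ (y.2, y.1.2.2.2)| := by
    have h5 : Measurable fun y : (𝒟 × Obs d) × ℝ => (y.2, y.1.2.2.2) :=
      measurable_snd.prodMk measurable_fst.snd.snd.snd
    exact ((hq.comp (measurable_fst.fst.prodMk h5)).sub (M.measurable_m₂.comp h5)).abs
  have h4 := h3.stronglyMeasurable.integral_prod_right' (ν := M.ν)
  have h6 : Measurable fun y : 𝒟 × Obs d => M.ω₂ y.2.2 := M.measurable_ω₂.comp measurable_snd.snd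
  have h7 : Measurable fun y : 𝒟 × Obs d => M.m₂ y.2.2 := M.measurable_m₂.comp measurable_snd.snd
  exact (((h1.sub h6).abs.const_mul _).add ((h2.sub h7).abs.const_mul _)).add h4.measurable

lemma scoreErr_nonneg {C : ℝ} (hC : 0 ≤ C) (w q : ℝ × Cov d → ℝ) (z : Obs d) :
    0 ≤ M.scoreErr C w q z := by
  rw [scoreErr]
  have := integral_nonneg (μ := M.ν) (f := fun t => |q (t, z.2.2) - M.m₂ (t, z.2.2)|)
    fun _ => abs_nonneg _
  positivity

namespace Regular

variable {θs : Par p} {C r : ℝ} (R : M.Regular θs C r)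

include R

/-- The scores with the true nuisance functions are bounded and continuous in the parameter. -/
lemma ae_continuousOn_score : ∀ᵐ z ∂M.obsLaw,
    ContinuousOn (fun θ => M.score M.ω₂ M.m₂ (M.pol₂ θ) z) M.Θ ∧
      ∀ θ ∈ M.Θ, |M.score M.ω₂ M.m₂ (M.pol₂ θ) z| ≤ 3 * C ^ 3 := by
  have hC := R.C_pos
  have hν := R.isFiniteMeasure_ν
  filter_upwards [R.ae_good, M.ae_obsLaw R.continuous] with z h1 h2
  obtain ⟨hy, ht, hx, hm, hω, hms, hts⟩ := h1
  have hpol : ∀ θ ∈ M.Θ, ∀ t ∈ M.𝒯, |M.pol₂ θ (t, z.2.2)| ≤ C := fun θ hθ t ht => by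
    rw [pol₂, abs_of_nonneg (M.pol_nonneg θ hθ _ ht _ hx)]
    exact R.pol_le θ hθ _ ht _ hx
  refine ⟨?_, fun θ hθ => ?_⟩
  · refine ContinuousOn.add (ContinuousOn.mul (ContinuousOn.mul continuousOn_const h2.1)
      continuousOn_const) ?_
    refine continuousOn_of_dominated (bound := fun _ => C * C) (fun θ hθ => ?_) (fun θ hθ => ?_)
      (integrable_const _) ?_
    · have h3 : Measurable fun t : ℝ => (t, z.2.2) := measurable_id.prodMk measurable_const
      exact ((M.measurable_m₂.comp h3).mul ((M.measurable_pol₂ θ).comp h3)).aestronglyMeasurable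
    · filter_upwards [hms, hts] with t h3 h4
      rw [Real.norm_eq_abs, abs_mul]
      exact mul_le_mul h3 (hpol θ hθ t h4) (abs_nonneg _) hC.le
    · filter_upwards [h2.2] with t h3
      exact continuousOn_const.mul h3
  · refine (R.abs_score_le hC.le hy hm (hpol θ hθ _ ht) ?_).trans ?_
    · filter_upwards [hms, hts] with t h3 h4
      exact ⟨h3, hpol θ hθ t h4⟩
    · calc C * (2 * C * |M.ω₂ z.2| + C ^ 2) ≤ C * (2 * C * C + C ^ 2) := by gcongr
        _ = 3 * C ^ 3 := by ring

lemma integral_score_eq_welfare [StandardBorelSpace Ω₀] [Nonempty Ω₀] (hU : M.Unconfounded)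
    {θ : Par p} (hθ : θ ∈ M.Θ) :
    ∫ z, M.score M.ω₂ M.m₂ (M.pol₂ θ) z ∂M.obsLaw = M.welfare θ := by
  rw [R.integral_score M.measurable_ω₂ M.measurable_m₂ (M.measurable_pol₂ θ) R.integrable_ω₂
    R.ae_abs_m_le (R.ae_abs_pol_le hθ), hU.welfare_eq R hθ]
  simp [m₂, pol₂]

/-- Uniform law of large numbers for the scores with the true nuisance functions. -/
lemma tendsto_measure_average_score [StandardBorelSpace Ω₀] [Nonempty Ω₀] (hU : M.Unconfounded)
    (hΘ : IsCompact M.Θ) {Ω : Type*} [MeasurableSpace Ω] {P : Measure Ω} [IsProbabilityMeasure P]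
    {Z : ℕ → Ω → Obs d} (hZ : ∀ i, Measurable (Z i)) (hind : iIndepFun Z P)
    (hlaw : ∀ i, P.map (Z i) = M.obsLaw) {κ : ℝ} (hκ : 0 < κ) :
    Tendsto (fun n : ℕ => P {w | ∃ θ ∈ M.Θ, κ < |(1 / (n : ℝ)) *
      ∑ i, M.score M.ω₂ M.m₂ (M.pol₂ θ) (sample Z n w i) - M.welfare θ|}) atTop (𝓝 0) := by
  classical
  have hC := R.C_pos
  have : CompactSpace M.Θ := isCompact_iff_compactSpace.1 hΘ
  obtain ⟨N, hsub, hNm, hN0⟩ := exists_measurable_superset_of_null R.ae_continuousOn_score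
  have hgood : ∀ z, z ∉ N → ContinuousOn (fun θ => M.score M.ω₂ M.m₂ (M.pol₂ θ) z) M.Θ ∧
      ∀ θ ∈ M.Θ, |M.score M.ω₂ M.m₂ (M.pol₂ θ) z| ≤ 3 * C ^ 3 := by
    intro z hz
    by_contra hcon
    exact hz (hsub hcon)
  -- the scores as continuous functions of the parameter, set to zero on a null set
  let Φ : Obs d → C(M.Θ, ℝ) := fun z => if h : z ∈ N then 0 else
    ⟨fun θ => M.score M.ω₂ M.m₂ (M.pol₂ θ) z, continuousOn_iff_continuous_domRestrict.1 (hgood z h).1⟩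
  have hΦ1 : ∀ z, z ∉ N → ∀ θ : M.Θ, Φ z θ = M.score M.ω₂ M.m₂ (M.pol₂ θ) z := by
    intro z hz θ
    simp only [Φ, hz, dif_neg, not_false_iff]
    rfl
  have hΦ0 : ∀ z, z ∈ N → Φ z = 0 := fun z hz => by simp only [Φ, hz, dif_pos]
  have hΦm : ∀ θ, Measurable fun z => Φ z θ := by
    intro θ
    have h1 : (fun z => Φ z θ) = fun z => if z ∈ N then 0
        else M.score M.ω₂ M.m₂ (M.pol₂ θ) z := by
      funext z
      split_ifs with hz
      · rw [hΦ0 z hz]; rfl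
      · exact hΦ1 z hz θ
    rw [h1]
    exact Measurable.ite hNm measurable_const
      (M.measurable_score M.measurable_ω₂ M.measurable_m₂ (M.measurable_pol₂ θ))
  have hΦc : ∀ z, ‖Φ z‖ ≤ 3 * C ^ 3 := by
    intro z
    rw [ContinuousMap.norm_le _ (by positivity)]
    intro θ
    by_cases hz : z ∈ N
    · rw [hΦ0 z hz]; simp; positivity
    · rw [hΦ1 z hz]; exact (hgood z hz).2 θ θ.2
  obtain ⟨m, hm, hlim⟩ := tendsto_average_continuousMap hZ hind hlaw hΦm hΦc
  have hmW : ∀ θ : M.Θ, m θ = M.welfare θ := by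
    intro θ
    rw [hm, ← R.integral_score_eq_welfare hU θ.2]
    refine integral_congr_ae ?_
    filter_upwards [measure_eq_zero_iff_ae_notMem.1 hN0] with z hz using hΦ1 z hz θ
  have hae : ∀ᵐ w ∂P, ∀ i, Z i w ∉ N :=
    CrossFitting.ae_sample (Q := fun z => z ∉ N) hZ hlaw (measure_eq_zero_iff_ae_notMem.1 hN0)
  refine tendsto_of_tendsto_of_tendsto_of_le_of_le tendsto_const_nhds
    (tendstoInMeasure_iff_norm.1 hlim κ hκ) (fun _ => zero_le) fun n => ?_
  refine measure_mono_ae ?_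
  filter_upwards [hae] with w hw
  rintro ⟨θ, hθ, h1⟩
  refine h1.le.trans ?_
  refine le_trans (le_of_eq ?_) (ContinuousMap.norm_coe_le_norm _ (⟨θ, hθ⟩ : M.Θ))
  rw [Real.norm_eq_abs, ContinuousMap.sub_apply, ContinuousMap.smul_apply, hmW,
    ContinuousMap.sum_apply, Finset.sum_range, smul_eq_mul, one_div]
  congr 3
  exact Finset.sum_congr rfl fun i _ => (hΦ1 _ (hw i) ⟨θ, hθ⟩).symm

end Regular

end PolicyModel

namespace CrossFitting

variable {d p L : ℕ} {Ω₀ : Type*} [MeasurableSpace Ω₀] (A : CrossFitting d L)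
  {M : PolicyModel d p Ω₀} {θs : Par p} {C r : ℝ}

/-- The truncated welfare estimator and its version with the true nuisance functions differ, uniformly
in the policy parameter, by at most an average of nuisance errors. -/
lemma abs_truncWelfare_sub_le (R : M.Regular θs C r) {n : ℕ} {s : Fin n → Obs d}
    (hs : ∀ i, |(s i).1| ≤ C ∧ (s i).2.1 ∈ M.𝒯 ∧ (s i).2.2 ∈ M.𝒳 ∧
      (∀ᵐ t ∂M.ν, |M.m₂ (t, (s i).2.2)| ≤ C)) {a b : ℝ} (ha : 0 < a) (hb : 0 < b) {θ : Par p}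
    (hθ : θ ∈ M.Θ) :
    |A.truncWelfare M C a b s θ - (1 / (n : ℝ)) * ∑ i, M.score M.ω₂ M.m₂ (M.pol₂ θ) (s i)|
      ≤ C * A.foldAverage
        (fun ℓ D => M.scoreErr C (A.wTrunc M a n ℓ D) (A.qTrunc M C b n ℓ D)) s := by
  rw [← A.foldAverage_const, truncWelfare, foldAverage, foldAverage, foldAverage, ← mul_sub,
    abs_mul, abs_of_nonneg (by positivity : 0 ≤ 1 / (n : ℝ)), mul_left_comm]
  refine mul_le_mul_of_nonneg_left ?_ (by positivity)
  simp only [← Finset.sum_sub_distrib, Finset.mul_sum]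
  refine (Finset.abs_sum_le_sum_abs _ _).trans (Finset.sum_le_sum fun ℓ _ => ?_)
  refine (Finset.abs_sum_le_sum_abs _ _).trans (Finset.sum_le_sum fun i _ => ?_)
  obtain ⟨hy, ht, hx, hms⟩ := hs i.1
  have hcl := A.close_trunc R ha hb n ℓ (A.train s ℓ)
  have hpol : ∀ t ∈ M.𝒯, |M.pol₂ θ (t, (s i.1).2.2)| ≤ C := fun t ht => by
    rw [PolicyModel.pol₂, abs_of_nonneg (M.pol_nonneg θ hθ _ ht _ hx)]
    exact R.pol_le θ hθ _ ht _ hx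
  refine R.abs_score_sub_le hcl.measurable_q (M.measurable_pol₂ θ) hy ⟨ht, hx⟩ (hcl.abs_q_le _)
    (hpol _ ht) ?_
  filter_upwards [hms, M.ae_ν_mem] with t h3 h4
  exact ⟨⟨hcl.abs_q_le _, h3⟩, hpol t h4⟩

lemma measurable_foldAverage {Ω : Type*} [MeasurableSpace Ω] {Z : ℕ → Ω → Obs d}
    (hZ : ∀ i, Measurable (Z i)) {n : ℕ}
    {F : (ℓ : Fin L) → ({i : Fin n // A.fold n i ≠ ℓ} → Obs d) → Obs d → ℝ}
    (hF : ∀ ℓ, Measurable (Function.uncurry (F ℓ))) :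
    Measurable fun w => A.foldAverage F (sample Z n w) := by
  refine (Finset.measurable_fun_sum _ fun ℓ _ => Finset.measurable_fun_sum _ fun i _ => ?_).const_mul
    (1 / (n : ℝ))
  have h1 : Measurable fun w => A.train (sample Z n w) ℓ :=
    (A.measurable_train ℓ).comp (measurable_sample hZ n)
  have h2 : Measurable fun w => A.foldData (sample Z n w) ℓ i :=
    (measurable_pi_apply i).comp ((A.measurable_foldData ℓ).comp (measurable_sample hZ n))
  exact (hF ℓ).comp (h1.prodMk h2)

/-- The mean of an average over the folds, by conditioning on the training data of each fold. -/
lemma lintegral_foldAverage_le {Ω : Type*} [MeasurableSpace Ω] {P : Measure Ω}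
    [IsProbabilityMeasure P] {Z : ℕ → Ω → Obs d} {μ : Measure (Obs d)} [IsProbabilityMeasure μ]
    (hZ : ∀ i, Measurable (Z i)) (hind : iIndepFun Z P) (hlaw : ∀ i, P.map (Z i) = μ) {n : ℕ}
    (hn : 1 ≤ n) {F : (ℓ : Fin L) → ({i : Fin n // A.fold n i ≠ ℓ} → Obs d) → Obs d → ℝ}
    (hF : ∀ ℓ, Measurable (Function.uncurry (F ℓ))) (hF0 : ∀ ℓ D z, 0 ≤ F ℓ D z) {κ : ℝ}
    (hκ : 0 ≤ κ) (hle : ∀ ℓ D, ∫⁻ z, ENNReal.ofReal (F ℓ D z) ∂μ ≤ ENNReal.ofReal κ) :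
    ∫⁻ w, ENNReal.ofReal (A.foldAverage F (sample Z n w)) ∂P ≤ ENNReal.ofReal κ := by
  have hn0 : (0 : ℝ) < n := by exact_mod_cast hn
  have htr : ∀ ℓ, Measurable fun w => A.train (sample Z n w) ℓ := fun ℓ =>
    (A.measurable_train ℓ).comp (measurable_sample hZ n)
  have hfd : ∀ ℓ, Measurable fun w => A.foldData (sample Z n w) ℓ := fun ℓ =>
    (A.measurable_foldData ℓ).comp (measurable_sample hZ n)
  have hone : ∀ (ℓ : Fin L) (i : {i : Fin n // A.fold n i = ℓ}),
      ∫⁻ w, ENNReal.ofReal (F ℓ (A.train (sample Z n w) ℓ) (A.foldData (sample Z n w) ℓ i)) ∂P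
        ≤ ENNReal.ofReal κ := by
    intro ℓ i
    have hG : Measurable (Function.uncurry fun D (s : {i : Fin n // A.fold n i = ℓ} → Obs d) =>
        ENNReal.ofReal (F ℓ D (s i))) :=
      ((hF ℓ).comp (measurable_fst.prodMk
        ((measurable_pi_apply i).comp measurable_snd))).ennreal_ofReal
    refine lintegral_le_of_indep (htr ℓ) (hfd ℓ) (A.indepFun_train_foldData hZ hind n ℓ) hG
      fun D => ?_
    have h4 : Measurable fun z => ENNReal.ofReal (F ℓ D z) :=
      ((hF ℓ).comp measurable_prodMk_left).ennreal_ofReal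
    rw [A.map_foldData hZ hind hlaw n ℓ]
    exact ((measurePreserving_eval (fun _ : {i : Fin n // A.fold n i = ℓ} => μ)
      i).lintegral_comp h4).trans_le (hle ℓ D)
  have hmeas : ∀ (ℓ : Fin L) (i : {i : Fin n // A.fold n i = ℓ}), Measurable fun w =>
      ENNReal.ofReal (F ℓ (A.train (sample Z n w) ℓ) (A.foldData (sample Z n w) ℓ i)) :=
    fun ℓ i => ((hF ℓ).comp ((htr ℓ).prodMk ((measurable_pi_apply i).comp (hfd ℓ)))).ennreal_ofReal
  have hrw : ∀ w, ENNReal.ofReal (A.foldAverage F (sample Z n w))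
      = ENNReal.ofReal (1 / (n : ℝ)) * ∑ ℓ, ∑ i,
        ENNReal.ofReal (F ℓ (A.train (sample Z n w) ℓ) (A.foldData (sample Z n w) ℓ i)) := by
    intro w
    rw [foldAverage, ENNReal.ofReal_mul (by positivity), ENNReal.ofReal_sum_of_nonneg
      fun ℓ _ => Finset.sum_nonneg fun i _ => hF0 _ _ _]
    congr 1
    exact Finset.sum_congr rfl fun ℓ _ => ENNReal.ofReal_sum_of_nonneg fun i _ => hF0 _ _ _
  simp_rw [hrw]
  rw [lintegral_const_mul' _ _ ENNReal.ofReal_ne_top, lintegral_finsetSum _ fun ℓ _ =>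
    Finset.measurable_fun_sum _ fun i _ => hmeas ℓ i]
  have hsum : ∑ ℓ, ∫⁻ w, ∑ i, ENNReal.ofReal
      (F ℓ (A.train (sample Z n w) ℓ) (A.foldData (sample Z n w) ℓ i)) ∂P
        ≤ ENNReal.ofReal (n * κ) := by
    have h1 : ∑ ℓ, ∑ _i : {i : Fin n // A.fold n i = ℓ}, κ = n * κ := by
      rw [A.sum_fold fun _ _ => κ]; simp
    rw [← h1, ENNReal.ofReal_sum_of_nonneg fun ℓ _ => Finset.sum_nonneg fun i _ => hκ]
    refine Finset.sum_le_sum fun ℓ _ => ?_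
    rw [lintegral_finsetSum _ fun i _ => hmeas ℓ i,
      ENNReal.ofReal_sum_of_nonneg fun i _ => hκ]
    exact Finset.sum_le_sum fun i _ => hone ℓ i
  refine (mul_le_mul_right hsum _).trans (le_of_eq ?_)
  rw [← ENNReal.ofReal_mul (by positivity)]
  congr 1
  field_simp

lemma lintegral_foldAverage_scoreErr_le (R : M.Regular θs C r) {Ω : Type*} [MeasurableSpace Ω]
    {P : Measure Ω} [IsProbabilityMeasure P] {Z : ℕ → Ω → Obs d} (hZ : ∀ i, Measurable (Z i))
    (hind : iIndepFun Z P) (hlaw : ∀ i, P.map (Z i) = M.obsLaw) {n : ℕ} (hn : 1 ≤ n) {a b κ : ℝ}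
    (ha : 0 < a) (hb : 0 < b) (hκ : 0 < κ)
    (hab : 12 * C ^ 2 * a ^ 2 + 3 * C ^ 2 * b ^ 2 + 6 * C ^ 3 * b ≤ κ ^ 2) :
    ∫⁻ w, ENNReal.ofReal (A.foldAverage
        (fun ℓ D => M.scoreErr C (A.wTrunc M a n ℓ D) (A.qTrunc M C b n ℓ D)) (sample Z n w)) ∂P
      ≤ ENNReal.ofReal κ := by
  have hC := R.C_pos
  refine A.lintegral_foldAverage_le hZ hind hlaw hn (fun ℓ => ?_)
    (fun ℓ D z => M.scoreErr_nonneg hC.le _ _ z) hκ.le fun ℓ D => ?_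
  · exact M.measurable_scoreErr_param (A.measurable_wTrunc M a n ℓ) (A.measurable_qTrunc M C b n ℓ) C
  · have hcl := A.close_trunc R ha hb n ℓ D
    obtain ⟨h1, h2⟩ := R.scoreErr_sq hcl
    have h3 := integral_abs_le_of_sq h1 hκ (h2.trans hab)
    have hnn := fun z => M.scoreErr_nonneg hC.le (A.wTrunc M a n ℓ D) (A.qTrunc M C b n ℓ D) z
    rw [← ofReal_integral_eq_lintegral_ofReal (h1.integrable one_le_two)
      (Eventually.of_forall hnn)]
    simp only [abs_of_nonneg (hnn _)] at h3
    exact ENNReal.ofReal_le_ofReal h3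

/-- The doubly robust welfare estimator is uniformly consistent. -/
theorem tendsto_measure_drWelfare_sub [StandardBorelSpace Ω₀] [Nonempty Ω₀] (R : M.Regular θs C r)
    (hU : M.Unconfounded) (hΘ : IsCompact M.Θ) {Ω : Type*} [MeasurableSpace Ω] {P : Measure Ω}
    [IsProbabilityMeasure P] {Z : ℕ → Ω → Obs d} (hZ : ∀ i, Measurable (Z i))
    (hind : iIndepFun Z P) (hlaw : ∀ i, P.map (Z i) = M.obsLaw) {ρω ρm : ℝ} (hω : 0 < ρω)
    (hm : 0 < ρm)
    (hw : ∀ ℓ : Fin L, IsLittleOInProb P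
      (fun n w => eLpNorm (fun z => A.ωhatOn (sample Z n w) ℓ z - M.ω z.1 z.2) 2 M.lawTX)
      (fun n => (n : ℝ) ^ (-ρω)))
    (hq : ∀ ℓ : Fin L, IsLittleOInProb P
      (fun n w => eLpNorm (fun z => A.mhatOn (sample Z n w) ℓ z - M.m z.1 z.2) 2 M.lawTX)
      (fun n => (n : ℝ) ^ (-ρm)))
    (hqC : ∀ ℓ, Tendsto (fun n => P {w | ∃ t ∈ M.𝒯, ∃ x ∈ M.𝒳,
      C < |A.mhatOn (sample Z n w) ℓ (t, x)|}) atTop (𝓝 0)) {κ : ℝ} (hκ : 0 < κ) :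
    Tendsto (fun n => P {w | ∃ θ ∈ M.Θ, κ < |A.drWelfare M (sample Z n w) θ - M.welfare θ|})
      atTop (𝓝 0) := by
  have hC := R.C_pos
  have h1 : ∀ n : ℕ, 1 ≤ n → ∀ ρ : ℝ, 0 < 1 * (n : ℝ) ^ (-ρ) := fun n hn ρ => by
    have : (0 : ℝ) < n := by exact_mod_cast hn
    positivity
  have ha := tendsto_const_mul_rpow_neg hω 1
  have hb := tendsto_const_mul_rpow_neg hm 1
  have hbad := A.tendsto_measure_drWelfare_ne hZ hind hlaw (C := C)
    (fun n hn => (h1 n hn ρω).le) ha (fun ℓ => hw ℓ 1 one_pos) (fun ℓ => hq ℓ 1 one_pos) hqC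
  have hlln := R.tendsto_measure_average_score hU hΘ hZ hind hlaw (half_pos hκ)
  set a : ℕ → ℝ := fun n => 1 * (n : ℝ) ^ (-ρω)
  set b : ℕ → ℝ := fun n => 1 * (n : ℝ) ^ (-ρm)
  have hsmall : Tendsto (fun n => 12 * C ^ 2 * a n ^ 2 + 3 * C ^ 2 * b n ^ 2 + 6 * C ^ 3 * b n)
      atTop (𝓝 0) := by
    simpa using (((ha.pow 2).const_mul (12 * C ^ 2)).add ((hb.pow 2).const_mul (3 * C ^ 2))).add
      (hb.const_mul (6 * C ^ 3))
  have hgood : ∀ᵐ w ∂P, ∀ i, |(Z i w).1| ≤ C ∧ (Z i w).2.1 ∈ M.𝒯 ∧ (Z i w).2.2 ∈ M.𝒳 ∧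
      (∀ᵐ t ∂M.ν, |M.m₂ (t, (Z i w).2.2)| ≤ C) := by
    refine ae_sample (Q := fun z => |z.1| ≤ C ∧ z.2.1 ∈ M.𝒯 ∧ z.2.2 ∈ M.𝒳 ∧
      (∀ᵐ t ∂M.ν, |M.m₂ (t, z.2.2)| ≤ C)) hZ hlaw ?_
    filter_upwards [R.ae_good] with z hz
    exact ⟨hz.1, hz.2.1, hz.2.2.1, hz.2.2.2.2.2.1⟩
  have htrunc : Tendsto (fun n => P {w | ∃ θ ∈ M.Θ, κ / 2 < |A.truncWelfare M C (a n) (b n)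
      (sample Z n w) θ - (1 / (n : ℝ)) * ∑ i, M.score M.ω₂ M.m₂ (M.pol₂ θ) (sample Z n w i)|})
      atTop (𝓝 0) := by
    rw [ENNReal.tendsto_nhds_zero]
    intro ε' hε'
    obtain ⟨ε, hε0, hε⟩ : ∃ ε : ℝ, 0 < ε ∧ ENNReal.ofReal ε ≤ ε' := by
      obtain ⟨x, hx0, hx⟩ := ENNReal.lt_iff_exists_nnreal_btwn.1 hε'
      exact ⟨x, by exact_mod_cast hx0, by simpa using hx.le⟩
    set κ' : ℝ := ε * (κ / (2 * C))
    have hκ' : 0 < κ' := by positivity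
    filter_upwards [eventually_ge_atTop 1,
      hsmall.eventually_le_const (by positivity : 0 < κ' ^ 2)] with n hn hab
    refine le_trans ?_ hε
    have hint := A.lintegral_foldAverage_scoreErr_le R hZ hind hlaw hn (h1 n hn ρω) (h1 n hn ρm)
      hκ' hab
    set F := fun w => A.foldAverage (fun ℓ D => M.scoreErr C (A.wTrunc M (a n) n ℓ D)
      (A.qTrunc M C (b n) n ℓ D)) (sample Z n w) with hF
    have hsub : P {w | ∃ θ ∈ M.Θ, κ / 2 < |A.truncWelfare M C (a n) (b n)
      (sample Z n w) θ - (1 / (n : ℝ)) * ∑ i, M.score M.ω₂ M.m₂ (M.pol₂ θ) (sample Z n w i)|}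
        ≤ P {w | ENNReal.ofReal (κ / (2 * C)) ≤ ENNReal.ofReal (F w)} := by
      refine measure_mono_ae ?_
      filter_upwards [hgood] with w hw
      rintro ⟨θ, hθ, h2⟩
      have h3 := A.abs_truncWelfare_sub_le R (s := sample Z n w) (fun i => hw i) (h1 n hn ρω)
        (h1 n hn ρm) hθ
      refine ENNReal.ofReal_le_ofReal ?_
      have h4 : κ / 2 < C * F w := h2.trans_le h3
      rw [div_le_iff₀ (by positivity)]
      linarith
    refine hsub.trans ?_
    have hmk := mul_meas_ge_le_lintegral₀ (μ := P) (f := fun w => ENNReal.ofReal (F w)) ?_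
      (ENNReal.ofReal (κ / (2 * C)))
    · have h5 := hmk.trans hint
      rw [show κ' = κ / (2 * C) * ε from mul_comm _ _, ENNReal.ofReal_mul (by positivity)] at h5
      exact (ENNReal.mul_le_mul_iff_right (ENNReal.ofReal_pos.2 (by positivity)).ne'
        ENNReal.ofReal_ne_top).1 h5
    · have hmeas : Measurable F := by
        simp only [hF]
        refine A.measurable_foldAverage hZ fun ℓ => ?_
        exact M.measurable_scoreErr_param (A.measurable_wTrunc M _ n ℓ)
          (A.measurable_qTrunc M C _ n ℓ) C
      exact hmeas.ennreal_ofReal.aemeasurable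
  have hsum := (hbad.add htrunc).add hlln
  rw [add_zero, add_zero] at hsum
  refine tendsto_of_tendsto_of_tendsto_of_le_of_le tendsto_const_nhds hsum (fun _ => zero_le)
    fun n => ?_
  refine le_trans (measure_mono ?_) ((measure_union_le _ _).trans
    (add_le_add (measure_union_le _ _) le_rfl))
  rintro w ⟨θ, hθ, h2⟩
  by_contra hcon
  simp only [Set.mem_union, Set.mem_ofPred_eq, not_or, not_not, not_exists, not_and, not_lt] at hcon
  obtain ⟨⟨c1, c2⟩, c3⟩ := hcon
  rw [c1 θ hθ] at h2
  have h3 := abs_sub_le (A.truncWelfare M C (a n) (b n) (sample Z n w) θ)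
    ((1 / (n : ℝ)) * ∑ i, M.score M.ω₂ M.m₂ (M.pol₂ θ) (sample Z n w i)) (M.welfare θ)
  linarith [c2 θ hθ, c3 θ hθ]

end CrossFitting

/-! ### Maximizers of stochastically differentiable concave criteria -/

lemma ofReal_le_of_ofReal_le_mul {x y z : ℝ} {T : ℝ≥0∞} (hy : 0 < y) (hzx : z * y ≤ x)
    (h : ENNReal.ofReal x ≤ ENNReal.ofReal y * T) : ENNReal.ofReal z ≤ T := by
  have h1 : ENNReal.ofReal y * ENNReal.ofReal z ≤ ENNReal.ofReal y * T := by
    rw [← ENNReal.ofReal_mul hy.le, mul_comm y]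
    exact (ENNReal.ofReal_le_ofReal hzx).trans h
  exact (ENNReal.mul_le_mul_iff_right (ENNReal.ofReal_pos.2 hy).ne' ENNReal.ofReal_ne_top).1 h1

lemma measure_ofReal_le_le {Ω : Type*} [MeasurableSpace Ω] {P : Measure Ω} {T : Ω → ℝ≥0∞}
    (hT : AEMeasurable T P) {η x : ℝ} (hη : ∫⁻ w, T w ∂P ≤ ENNReal.ofReal η) (hx : 0 < x) :
    P {w | ENNReal.ofReal x ≤ T w} ≤ ENNReal.ofReal (η / x) := by
  have h := (mul_meas_ge_le_lintegral₀ hT (ENNReal.ofReal x)).trans hη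
  have h1 : ENNReal.ofReal x * P {w | ENNReal.ofReal x ≤ T w}
      ≤ ENNReal.ofReal x * ENNReal.ofReal (η / x) := by
    rwa [← ENNReal.ofReal_mul hx.le, mul_div_cancel₀ _ hx.ne']
  exact (ENNReal.mul_le_mul_iff_right (ENNReal.ofReal_pos.2 hx).ne' ENNReal.ofReal_ne_top).1 h1

lemma tendsto_measure_of_forall_eventually_le {Ω : Type*} [MeasurableSpace Ω] {P : Measure Ω}
    {s : ℕ → Set Ω} (h : ∀ η : ℝ, 0 < η → ∀ᶠ n in atTop, P (s n) ≤ ENNReal.ofReal η) :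
    Tendsto (fun n => P (s n)) atTop (𝓝 0) := by
  rw [ENNReal.tendsto_nhds_zero]
  intro ε hε
  obtain ⟨x, hx0, hx⟩ := ENNReal.lt_iff_exists_nnreal_btwn.1 hε
  filter_upwards [h x (by exact_mod_cast hx0)] with n hn
  exact hn.trans (by simpa using hx.le)

lemma tsum_ofReal_geometric {x : ℝ} (hx : 0 ≤ x) :
    ∑' j : ℕ, ENNReal.ofReal (x / 2 ^ j) = ENNReal.ofReal (2 * x) := by
  have h1 : ∀ j : ℕ, x / 2 ^ j = x * (1 / 2) ^ j := fun j => by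
    rw [one_div, inv_pow, div_eq_mul_inv]
  simp_rw [h1]
  rw [← ENNReal.ofReal_tsum_of_nonneg (fun j => by positivity)
    (summable_geometric_two.mul_left x), tsum_mul_left, tsum_geometric_two, mul_comm]

/-- A concave function with a nondegenerate second-order expansion at `θs`: the assumptions on the
limit of the criterion functions. -/
structure QuadraticMax {E : Type*} [NormedAddCommGroup E] [InnerProductSpace ℝ E] (W : E → ℝ)
    (Θ : Set E) (θs : E) (A : E →L[ℝ] E) (c : ℝ) : Prop where
  c_pos : 0 < c
  coercive : ∀ h, c * ‖h‖ ^ 2 ≤ inner ℝ (A h) h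
  expansion : ∀ ε : ℝ, 0 < ε → ∃ δ : ℝ, 0 < δ ∧ ∀ h, ‖h‖ ≤ δ →
    |W (θs + h) - W θs + 1 / 2 * inner ℝ (A h) h| ≤ ε * ‖h‖ ^ 2
  concave : ConcaveOn ℝ Θ W
  mem : θs ∈ Θ

namespace QuadraticMax

variable {E : Type*} [NormedAddCommGroup E] [InnerProductSpace ℝ E] {W : E → ℝ} {Θ : Set E}
  {θs : E} {A : E →L[ℝ] E} {c : ℝ} (Q : QuadraticMax W Θ θs A c)

include Q

lemma exists_decrease : ∃ δ : ℝ, 0 < δ ∧ ∀ h, ‖h‖ ≤ δ →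
    W (θs + h) - W θs ≤ -(c / 4 * ‖h‖ ^ 2) := by
  obtain ⟨δ, hδ, h1⟩ := Q.expansion (c / 4) (by linarith [Q.c_pos])
  refine ⟨δ, hδ, fun h hh => ?_⟩
  have h2 := (abs_le.1 (h1 h hh)).2
  have h3 := Q.coercive h
  linarith

/-- By concavity, the decrease on a sphere bounds the decrease outside of it. -/
lemma decrease_outside {δ : ℝ} (hδ : 0 < δ)
    (hdec : ∀ h, ‖h‖ ≤ δ → W (θs + h) - W θs ≤ -(c / 4 * ‖h‖ ^ 2)) {θ : E} (hθ : θ ∈ Θ)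
    (hθδ : δ ≤ ‖θ - θs‖) : W θ - W θs ≤ -(c / 4 * δ ^ 2) := by
  have hpos : 0 < ‖θ - θs‖ := hδ.trans_le hθδ
  set t := δ / ‖θ - θs‖ with ht
  have ht0 : 0 < t := by positivity
  have ht1 : t ≤ 1 := (div_le_one hpos).2 hθδ
  have h1 := Q.concave.2 Q.mem hθ (by linarith : 0 ≤ 1 - t) ht0.le (by ring)
  have h2 : (1 - t) • θs + t • θ = θs + t • (θ - θs) := by
    rw [smul_sub, sub_smul, one_smul]; abel
  have h3 : ‖t • (θ - θs)‖ = δ := by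
    rw [norm_smul, Real.norm_of_nonneg ht0.le, ht, div_mul_cancel₀ _ hpos.ne']
  have h4 := hdec _ h3.le
  rw [h3] at h4
  rw [h2, smul_eq_mul, smul_eq_mul] at h1
  have h5 : t * (W θ - W θs) ≤ -(c / 4 * δ ^ 2) := by linarith
  have h6 : 0 < c / 4 * δ ^ 2 := by have := Q.c_pos; positivity
  have h7 : W θ - W θs ≤ 0 := by
    by_contra hcon
    have := mul_pos ht0 (not_le.1 hcon)
    linarith
  have h8 : W θ - W θs ≤ t * (W θ - W θs) := by nlinarith
  linarith

variable {Ω : Type*} [MeasurableSpace Ω] {P : Measure Ω} {Wn : ℕ → Ω → E → ℝ} {S : ℕ → Ω → E}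
  {θhat : ℕ → Ω → E}

/-- Uniform consistency of the criterion implies consistency of its maximizers. -/
lemma consistent
    (hmax : Tendsto (fun n => P {w | ¬ (θhat n w ∈ Θ ∧ IsMaxOn (Wn n w) Θ (θhat n w))}) atTop (𝓝 0))
    (hcons : ∀ κ : ℝ, 0 < κ → Tendsto (fun n => P {w | ∃ θ ∈ Θ, κ < |Wn n w θ - W θ|}) atTop (𝓝 0))
    {δ : ℝ} (hδ : 0 < δ) : Tendsto (fun n => P {w | δ ≤ ‖θhat n w - θs‖}) atTop (𝓝 0) := by
  have hc := Q.c_pos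
  obtain ⟨δ₀, hδ₀, hdec⟩ := Q.exists_decrease
  set δ' := min δ δ₀
  have hδ' : 0 < δ' := lt_min hδ hδ₀
  have hlim := hmax.add (hcons (c / 16 * δ' ^ 2) (by positivity))
  rw [add_zero] at hlim
  refine tendsto_of_tendsto_of_tendsto_of_le_of_le tendsto_const_nhds hlim (fun _ => zero_le)
    fun n => ?_
  refine le_trans (measure_mono ?_) (measure_union_le _ _)
  intro w hw
  by_contra hcon
  simp only [Set.mem_union, Set.mem_ofPred_eq, not_or, not_not] at hcon
  obtain ⟨⟨h1, h2⟩, h3'⟩ := hcon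
  have h3 : ∀ θ ∈ Θ, |Wn n w θ - W θ| ≤ c / 16 * δ' ^ 2 := fun θ hθ =>
    not_lt.1 fun h => h3' ⟨θ, hθ, h⟩
  have h4 := Q.decrease_outside hδ' (fun h hh => hdec h (hh.trans (min_le_right _ _))) h1
    ((min_le_left _ _).trans hw)
  have h5 : Wn n w θs ≤ Wn n w (θhat n w) := h2 Q.mem
  have h6 := abs_le.1 (h3 _ h1)
  have h7 := abs_le.1 (h3 _ Q.mem)
  have h8 : 0 < c / 16 * δ' ^ 2 := by positivity
  linarith [h6.2, h7.1]

/-- The rate of convergence, by peeling: in the shell of radius about `2 ^ j r / √n` the curvature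
of the limit dominates the remainder of the expansion, except on an event whose
probability is summable in `j`. -/
lemma rate
    (hmax : Tendsto (fun n => P {w | ¬ (θhat n w ∈ Θ ∧ IsMaxOn (Wn n w) Θ (θhat n w))}) atTop (𝓝 0))
    (hcons : ∀ κ : ℝ, 0 < κ → Tendsto (fun n => P {w | ∃ θ ∈ Θ, κ < |Wn n w θ - W θ|}) atTop (𝓝 0))
    (htight : ∀ η : ℝ, 0 < η → ∃ K : ℝ, 0 < K ∧ ∀ᶠ n in atTop,
      P {w | K < ‖S n w‖} ≤ ENNReal.ofReal η)
    (hSD : StochDiff P Wn W S θs) {η : ℝ} (hη : 0 < η) :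
    ∃ K : ℝ, 0 < K ∧ ∀ᶠ n : ℕ in atTop,
      P {w | K < √(n : ℝ) * ‖θhat n w - θs‖} ≤ ENNReal.ofReal η := by
  have hc := Q.c_pos
  obtain ⟨δ₀, hδ₀, hdec⟩ := Q.exists_decrease
  obtain ⟨K₁, hK₁, hS⟩ := htight (η / 5) (by positivity)
  obtain ⟨δ₁, hδ₁, hsd⟩ := hSD (η / 5) (by positivity)
  set δ₂ := min δ₁ δ₀
  have hδ₂ : 0 < δ₂ := lt_min hδ₁ hδ₀
  -- beyond `8 K₁ / c`, the curvature dominates the linear term; `32 / c` makes `c r / 16` at least `2`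
  set r := 8 * K₁ / c + 32 / c with hr
  have hr0 : 0 < r := by positivity
  have hrc : r * c = 8 * K₁ + 32 := by rw [hr]; field_simp
  have h5 : 0 < ENNReal.ofReal (η / 5) := ENNReal.ofReal_pos.2 (by positivity)
  refine ⟨r, hr0, ?_⟩
  filter_upwards [eventually_ge_atTop 1, hS, hsd, hmax.eventually_le_const h5,
    (Q.consistent hmax hcons hδ₂).eventually_le_const h5] with n hn hS hsd hm hcs
  obtain ⟨B, hB, hT⟩ := hsd
  have hn0 : (0 : ℝ) < n := by exact_mod_cast hn
  have hsn : 0 < √(n : ℝ) := Real.sqrt_pos.2 hn0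
  set ρ : ℕ → ℝ := fun j => min (2 ^ (j + 1) * r / √(n : ℝ)) δ₂ with hρ
  have hρ0 : ∀ j, 0 < ρ j := fun j => lt_min (by positivity) hδ₂
  choose T hTm hT1 hT2 using fun j => hT (ρ j) (hρ0 j) ((min_le_right _ _).trans (min_le_left _ _))
  -- by Markov's inequality, the dominating variable of shell `j` exceeds `2 ^ j c r / 16` with a
  -- probability of order `2 ^ (-j)`
  have hshell : P (⋃ j, {w | ENNReal.ofReal (c * r / 16 * 2 ^ j) ≤ T j w}) ≤ ENNReal.ofReal (η / 5) := by
    refine (measure_iUnion_le _).trans ?_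
    have h1 : ∀ j, P {w | ENNReal.ofReal (c * r / 16 * 2 ^ j) ≤ T j w}
        ≤ ENNReal.ofReal (η / 5 / (c * r / 16) / 2 ^ j) := fun j => by
      rw [div_div]
      exact measure_ofReal_le_le (hTm j) (hT1 j) (by positivity)
    refine (ENNReal.tsum_le_tsum h1).trans ?_
    rw [tsum_ofReal_geometric (by positivity)]
    apply ENNReal.ofReal_le_ofReal
    have h2 : 2 ≤ c * r / 16 := by nlinarith
    rw [← mul_div_assoc, div_le_iff₀ (by positivity), mul_comm (2 : ℝ)]
    gcongr
  set U := (({w | ¬ (θhat n w ∈ Θ ∧ IsMaxOn (Wn n w) Θ (θhat n w))} ∪ {w | δ₂ ≤ ‖θhat n w - θs‖})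
    ∪ {w | K₁ < ‖S n w‖}) ∪ B ∪ ⋃ j, {w | ENNReal.ofReal (c * r / 16 * 2 ^ j) ≤ T j w} with hU
  have hincl : P {w | r < √(n : ℝ) * ‖θhat n w - θs‖}
      ≤ P U := by
    refine measure_mono_ae ?_
    filter_upwards [ae_all_iff.2 hT2] with w hw hwr
    by_contra hcon
    have hcon' : w ∉ U := hcon
    simp only [hU, Set.mem_union, Set.mem_ofPred_eq, not_or, not_not, not_lt, not_le, Set.mem_iUnion,
      not_exists] at hcon'
    obtain ⟨⟨⟨⟨⟨hmem, hM⟩, hδ⟩, hK⟩, hwB⟩, hj⟩ := hcon'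
    have hwr' : r < √(n : ℝ) * ‖θhat n w - θs‖ := hwr
    set h := θhat n w - θs with hh
    have hx1 : 1 ≤ √(n : ℝ) * ‖h‖ / r := by rw [le_div_iff₀ hr0]; linarith
    obtain ⟨j, hj1, hj2⟩ := exists_nat_pow_near hx1 (by norm_num : (1 : ℝ) < 2)
    rw [le_div_iff₀ hr0] at hj1
    rw [div_lt_iff₀ hr0] at hj2
    have hhρ : ‖h‖ ≤ ρ j := by
      refine le_min ?_ hδ.le
      rw [le_div_iff₀ hsn]; linarith
    have hρh : ρ j ≤ 2 * ‖h‖ := by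
      refine (min_le_left _ _).trans ?_
      rw [div_le_iff₀ hsn, pow_succ]; linarith
    have hhpos : 0 < ‖h‖ := by
      by_contra hcon
      have : ‖h‖ = 0 := le_antisymm (not_lt.1 hcon) (norm_nonneg _)
      rw [this, mul_zero] at hwr'
      linarith
    have hrem := hw j hwB h hhρ
    have hθ : θs + h = θhat n w := by rw [hh]; abel
    have hge : Wn n w θs ≤ Wn n w (θs + h) := by rw [hθ]; exact hM Q.mem
    have hd := hdec h (hδ.le.trans (min_le_right _ _))
    have hin : (√(n : ℝ))⁻¹ * inner ℝ (S n w) h ≤ c / 8 * ‖h‖ ^ 2 := by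
      rw [inv_mul_le_iff₀ hsn]
      have h1 : inner ℝ (S n w) h ≤ K₁ * ‖h‖ :=
        (real_inner_le_norm _ _).trans (by gcongr)
      have h2 : K₁ ≤ c / 8 * (√(n : ℝ) * ‖h‖) := by nlinarith
      calc inner ℝ (S n w) h ≤ K₁ * ‖h‖ := h1
        _ ≤ c / 8 * (√(n : ℝ) * ‖h‖) * ‖h‖ := by gcongr
        _ = √(n : ℝ) * (c / 8 * ‖h‖ ^ 2) := by ring
    have hlow : c / 8 * ‖h‖ ^ 2 ≤ |expansionRem Wn W S θs n w h| := by
      refine le_trans ?_ (le_abs_self _)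
      rw [expansionRem]
      linarith
    -- the remainder at the maximizer is as large as the curvature, against the bound on shell `j`
    refine absurd (hj j) (not_lt.2 ?_)
    refine ofReal_le_of_ofReal_le_mul (div_pos (hρ0 j) hsn) ?_
      ((ENNReal.ofReal_le_ofReal hlow).trans hrem)
    rw [← mul_div_assoc, div_le_iff₀ hsn]
    calc c * r / 16 * 2 ^ j * ρ j ≤ c * r / 16 * 2 ^ j * (2 * ‖h‖) := by gcongr
      _ = c / 8 * ‖h‖ * (2 ^ j * r) := by ring
      _ ≤ c / 8 * ‖h‖ * (√(n : ℝ) * ‖h‖) := by gcongr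
      _ = c / 8 * ‖h‖ ^ 2 * √(n : ℝ) := by ring
  refine hincl.trans ?_
  refine (measure_union_le _ _).trans ((add_le_add ((measure_union_le _ _).trans (add_le_add
    ((measure_union_le _ _).trans (add_le_add ((measure_union_le _ _).trans
      (add_le_add hm hcs)) hS)) hB)) hshell).trans (le_of_eq ?_))
  have hη5 : 0 ≤ η / 5 := by positivity
  rw [← ENNReal.ofReal_add hη5 hη5, ← ENNReal.ofReal_add (by positivity) hη5,
    ← ENNReal.ofReal_add (by positivity) hη5, ← ENNReal.ofReal_add (by positivity) hη5]
  congr 1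
  ring

/-- The normalized regret is asymptotically the quadratic form of the normalized error. -/
lemma regret_expansion
    (hrate : ∀ η : ℝ, 0 < η → ∃ K : ℝ, 0 < K ∧ ∀ᶠ n : ℕ in atTop,
      P {w | K < √(n : ℝ) * ‖θhat n w - θs‖} ≤ ENNReal.ofReal η) :
    TendstoInMeasure P (fun (n : ℕ) w => (n : ℝ) * (W θs - W (θhat n w))
      - 1 / 2 * inner ℝ (A (√(n : ℝ) • (θhat n w - θs))) (√(n : ℝ) • (θhat n w - θs))) atTop
      (fun _ => 0) := by
  rw [tendstoInMeasure_iff_norm]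
  intro κ hκ
  refine tendsto_measure_of_forall_eventually_le fun η hη => ?_
  obtain ⟨K, hK, hr⟩ := hrate η hη
  obtain ⟨δ, hδ, hex⟩ := Q.expansion (κ / (2 * K ^ 2)) (by positivity)
  have hlim : Tendsto (fun n : ℕ => √(n : ℝ)) atTop atTop :=
    Real.tendsto_sqrt_atTop.comp tendsto_natCast_atTop_atTop
  filter_upwards [hr, eventually_ge_atTop 1, hlim.eventually_ge_atTop (K / δ)] with n hr hn hnK
  refine (measure_mono fun w hw => ?_).trans hr
  by_contra hcon
  have hcon' : √(n : ℝ) * ‖θhat n w - θs‖ ≤ K := not_lt.1 hcon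
  have hw' : κ ≤ ‖(n : ℝ) * (W θs - W (θhat n w))
      - 1 / 2 * inner ℝ (A (√(n : ℝ) • (θhat n w - θs))) (√(n : ℝ) • (θhat n w - θs)) - 0‖ := hw
  have hn0 : (0 : ℝ) < n := by exact_mod_cast hn
  have hsn : 0 < √(n : ℝ) := Real.sqrt_pos.2 hn0
  have hsq : √(n : ℝ) * √(n : ℝ) = n := Real.mul_self_sqrt hn0.le
  set h := θhat n w - θs with hh
  have hθ : θs + h = θhat n w := by rw [hh]; abel
  have hhδ : ‖h‖ ≤ δ := by
    rw [div_le_iff₀ hδ] at hnK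
    have h1 : √(n : ℝ) * ‖h‖ ≤ √(n : ℝ) * δ := hcon'.trans hnK
    exact le_of_mul_le_mul_left h1 hsn
  have h1 := hex h hhδ
  rw [hθ] at h1
  have h2 : (n : ℝ) * (W θs - W (θhat n w))
      - 1 / 2 * inner ℝ (A (√(n : ℝ) • h)) (√(n : ℝ) • h) - 0
      = -(n : ℝ) * (W (θhat n w) - W θs + 1 / 2 * inner ℝ (A h) h) := by
    rw [map_smul, real_inner_smul_left, real_inner_smul_right, ← mul_assoc (√(n : ℝ)), hsq]
    ring
  rw [h2, Real.norm_eq_abs, abs_mul, abs_neg, abs_of_pos hn0] at hw'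
  have h3 : (n : ℝ) * (κ / (2 * K ^ 2) * ‖h‖ ^ 2) ≤ κ / 2 := by
    calc (n : ℝ) * (κ / (2 * K ^ 2) * ‖h‖ ^ 2) = κ / (2 * K ^ 2) * (√(n : ℝ) * ‖h‖) ^ 2 := by
          rw [mul_pow, sq √(n : ℝ), hsq]; ring
      _ ≤ κ / (2 * K ^ 2) * K ^ 2 := by gcongr
      _ = κ / 2 := by field_simp
  have h4 := mul_le_mul_of_nonneg_left h1 hn0.le
  linarith

/-- The maximizers are asymptotically linear: the normalized error is asymptotically the maximizer
`A' S` of the limiting quadratic criterion. -/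
lemma asymptotically_linear {r : ℝ} (hr : 0 < r) (hball : ∀ h, ‖h‖ ≤ r → θs + h ∈ Θ)
    {A' : E →L[ℝ] E} (hA' : ∀ x, A (A' x) = x) (hsymm : ∀ x y, inner ℝ (A x) y = inner ℝ x (A y))
    (hmax : Tendsto (fun n => P {w | ¬ (θhat n w ∈ Θ ∧ IsMaxOn (Wn n w) Θ (θhat n w))}) atTop (𝓝 0))
    (hrate : ∀ η : ℝ, 0 < η → ∃ K : ℝ, 0 < K ∧ ∀ᶠ n : ℕ in atTop,
      P {w | K < √(n : ℝ) * ‖θhat n w - θs‖} ≤ ENNReal.ofReal η)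
    (htight : ∀ η : ℝ, 0 < η → ∃ K : ℝ, 0 < K ∧ ∀ᶠ n in atTop,
      P {w | K < ‖S n w‖} ≤ ENNReal.ofReal η)
    (hSD : StochDiff P Wn W S θs) :
    TendstoInMeasure P (fun (n : ℕ) w => √(n : ℝ) • (θhat n w - θs) - A' (S n w)) atTop
      (fun _ => 0) := by
  have hc := Q.c_pos
  rw [tendstoInMeasure_iff_norm]
  intro κ hκ
  refine tendsto_measure_of_forall_eventually_le fun η hη => ?_
  have hη5 : 0 < η / 5 := by positivity
  obtain ⟨K, hK, hev1⟩ := hrate (η / 5) hη5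
  obtain ⟨K₁, hK₁, hev2⟩ := htight (η / 5) hη5
  set K₂ := K + ‖A'‖ * K₁ with hK₂
  have hK₂0 : 0 < K₂ := by positivity
  -- the criterion on the ball of radius `K₂ / √n` is quadratic up to an error of order `κ ^ 2`
  set τ := c * κ ^ 2 / (16 * K₂) with hτ
  have hτ0 : 0 < τ := by positivity
  obtain ⟨δ, hδ, hex⟩ := Q.expansion (c * κ ^ 2 / (32 * K₂ ^ 2)) (by positivity)
  set η₂ := min (η / 5) (τ * (η / 5)) with hη₂
  have hη₂0 : 0 < η₂ := by positivity
  obtain ⟨δ₁, hδ₁, hev3⟩ := hSD η₂ hη₂0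
  set δ₂ := min (min δ δ₁) r
  have hδ₂ : 0 < δ₂ := lt_min (lt_min hδ hδ₁) hr
  have hlim : Tendsto (fun n : ℕ => √(n : ℝ)) atTop atTop :=
    Real.tendsto_sqrt_atTop.comp tendsto_natCast_atTop_atTop
  filter_upwards [hev1, hev2, hev3, eventually_ge_atTop 1, hlim.eventually_ge_atTop (K₂ / δ₂),
    hmax.eventually_le_const (ENNReal.ofReal_pos.2 hη5)] with n hev1 hev2 hev3 hn hnK hm
  obtain ⟨B, hB, hT⟩ := hev3
  have hn0 : (0 : ℝ) < n := by exact_mod_cast hn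
  have hsn : 0 < √(n : ℝ) := Real.sqrt_pos.2 hn0
  have hsq : √(n : ℝ) * √(n : ℝ) = n := Real.mul_self_sqrt hn0.le
  set ρ := K₂ / √(n : ℝ) with hρ
  have hρ0 : 0 < ρ := by positivity
  have hρδ : ρ ≤ δ₂ := by
    rw [div_le_iff₀ hδ₂] at hnK
    rw [hρ, div_le_iff₀ hsn]; linarith
  have hρ1 : ρ ≤ δ := hρδ.trans ((min_le_left _ _).trans (min_le_left _ _))
  have hρ2 : ρ ≤ δ₁ := hρδ.trans ((min_le_left _ _).trans (min_le_right _ _))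
  have hρ3 : ρ ≤ r := hρδ.trans (min_le_right _ _)
  obtain ⟨T, hTm, hT1, hT2⟩ := hT ρ hρ0 hρ2
  have hTP : P {w | ENNReal.ofReal τ ≤ T w} ≤ ENNReal.ofReal (η / 5) := by
    refine (measure_ofReal_le_le hTm hT1 hτ0).trans (ENNReal.ofReal_le_ofReal ?_)
    rw [div_le_iff₀ hτ0, mul_comm]
    exact min_le_right _ _
  set U := (({w | ¬ (θhat n w ∈ Θ ∧ IsMaxOn (Wn n w) Θ (θhat n w))}
    ∪ {w | K < √(n : ℝ) * ‖θhat n w - θs‖}) ∪ {w | K₁ < ‖S n w‖}) ∪ B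
    ∪ {w | ENNReal.ofReal τ ≤ T w} with hU
  have hincl : P {w | κ ≤ ‖√(n : ℝ) • (θhat n w - θs) - A' (S n w) - 0‖} ≤ P U := by
    refine measure_mono_ae ?_
    filter_upwards [hT2] with w hw hwκ
    by_contra hcon
    have hcon' : w ∉ U := hcon
    simp only [hU, Set.mem_union, Set.mem_ofPred_eq, not_or, not_not, not_lt, not_le] at hcon'
    obtain ⟨⟨⟨⟨⟨hmem, hM⟩, hbK⟩, hS⟩, hwB⟩, hTτ⟩ := hcon'
    have hκ' : κ ≤ ‖√(n : ℝ) • (θhat n w - θs) - A' (S n w) - 0‖ := hwκ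
    rw [sub_zero] at hκ'
    set s := S n w
    -- uniform quadratic expansion
    have hquad : ∀ u : E, ‖u‖ ≤ K₂ →
        |n * (Wn n w (θs + (√(n : ℝ))⁻¹ • u) - Wn n w θs)
          - (inner ℝ s u - 1 / 2 * inner ℝ (A u) u)| ≤ 3 * c * κ ^ 2 / 32 := by
      intro u hu
      set h := (√(n : ℝ))⁻¹ • u with hh
      have hhn : ‖h‖ = ‖u‖ / √(n : ℝ) := by
        rw [hh, norm_smul, Real.norm_of_nonneg (inv_pos.2 hsn).le, inv_mul_eq_div]
      have hhρ : ‖h‖ ≤ ρ := by rw [hhn, hρ]; gcongr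
      have hrem : |expansionRem Wn W S θs n w h| ≤ ρ / √(n : ℝ) * τ := by
        have h1 := (hw hwB h hhρ).trans (mul_le_mul_right hTτ.le _)
        rw [← ENNReal.ofReal_mul (by positivity)] at h1
        exact (ENNReal.ofReal_le_ofReal_iff (by positivity)).1 h1
      have hpe := hex h (hhρ.trans hρ1)
      have e1 : n * (Wn n w (θs + h) - Wn n w θs) - (inner ℝ s u - 1 / 2 * inner ℝ (A u) u)
          = n * expansionRem Wn W S θs n w h
            + n * (W (θs + h) - W θs + 1 / 2 * inner ℝ (A h) h) := by
        have hu' : u = √(n : ℝ) • h := by rw [hh, smul_smul, mul_inv_cancel₀ hsn.ne', one_smul]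
        have e2 : inner ℝ (A u) u = n * inner ℝ (A h) h := by
          rw [hu', map_smul, real_inner_smul_left, real_inner_smul_right, ← mul_assoc, hsq]
        have e3 : inner ℝ s u = n * ((√(n : ℝ))⁻¹ * inner ℝ s h) := by
          have e4 : (n : ℝ) * (√(n : ℝ))⁻¹ = √(n : ℝ) := by
            rw [mul_inv_eq_iff_eq_mul₀ hsn.ne', hsq]
          rw [hu', real_inner_smul_right, ← mul_assoc, e4]
        rw [expansionRem, e2, e3]
        ring
      rw [e1]
      refine (abs_add_le _ _).trans ?_
      rw [abs_mul, abs_mul, abs_of_pos hn0]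
      have b1 : n * |expansionRem Wn W S θs n w h| ≤ c * κ ^ 2 / 16 := by
        calc n * |expansionRem Wn W S θs n w h| ≤ n * (ρ / √(n : ℝ) * τ) := by gcongr
          _ = n / (√(n : ℝ) * √(n : ℝ)) * (K₂ * τ) := by rw [hρ]; ring
          _ = c * κ ^ 2 / 16 := by rw [hsq, div_self hn0.ne', hτ]; field_simp
      have b2 : n * |W (θs + h) - W θs + 1 / 2 * inner ℝ (A h) h| ≤ c * κ ^ 2 / 32 := by
        calc n * |W (θs + h) - W θs + 1 / 2 * inner ℝ (A h) h|
            ≤ n * (c * κ ^ 2 / (32 * K₂ ^ 2) * ρ ^ 2) := by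
              gcongr
              refine hpe.trans ?_
              gcongr
          _ = c * κ ^ 2 / 32 := by rw [hρ, div_pow, sq √(n : ℝ), hsq]; field_simp
      linarith
    set u := √(n : ℝ) • (θhat n w - θs) with hu
    have hu1 : ‖u‖ ≤ K₂ := by
      rw [hu, norm_smul, Real.norm_of_nonneg hsn.le]
      exact hbK.trans (le_add_of_nonneg_right (by positivity))
    have hv1 : ‖A' s‖ ≤ K₂ := by
      refine (A'.le_opNorm s).trans ?_
      calc ‖A'‖ * ‖s‖ ≤ ‖A'‖ * K₁ := by gcongr
        _ ≤ K₂ := le_add_of_nonneg_left hK.le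
    have hθu : θs + (√(n : ℝ))⁻¹ • u = θhat n w := by
      rw [hu, smul_smul, inv_mul_cancel₀ hsn.ne', one_smul]; abel
    have hvΘ : θs + (√(n : ℝ))⁻¹ • A' s ∈ Θ := by
      refine hball _ (le_trans ?_ hρ3)
      rw [norm_smul, Real.norm_of_nonneg (inv_pos.2 hsn).le, inv_mul_eq_div, hρ]
      gcongr
    have hge : Wn n w (θs + (√(n : ℝ))⁻¹ • A' s) ≤ Wn n w (θs + (√(n : ℝ))⁻¹ • u) := by
      rw [hθu]; exact hM hvΘ
    have q1 := (abs_le.1 (hquad u hu1)).2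
    have q2 := (abs_le.1 (hquad (A' s) hv1)).1
    have q3 := mul_le_mul_of_nonneg_left (sub_le_sub_right hge (Wn n w θs)) hn0.le
    -- the quadratic criterion is maximal at `A' s`
    have q4 : inner ℝ s (A' s) - 1 / 2 * inner ℝ (A (A' s)) (A' s)
        - (inner ℝ s u - 1 / 2 * inner ℝ (A u) u)
        = 1 / 2 * inner ℝ (A (u - A' s)) (u - A' s) := by
      have e1 : inner ℝ (A u) (A' s) = inner ℝ s u := by rw [hsymm, hA', real_inner_comm]
      have e2 : inner ℝ (A' s) u = inner ℝ u (A' s) := real_inner_comm _ _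
      rw [map_sub, inner_sub_left, inner_sub_right, inner_sub_right, hA', e1]
      ring
    have q5 := Q.coercive (u - A' s)
    have q6 : κ ^ 2 ≤ ‖u - A' s‖ ^ 2 := by gcongr
    have q7 : c * κ ^ 2 ≤ c * ‖u - A' s‖ ^ 2 := by gcongr
    have q8 : 0 < c * κ ^ 2 := by positivity
    linarith
  refine hincl.trans ?_
  refine (measure_union_le _ _).trans ((add_le_add ((measure_union_le _ _).trans (add_le_add
    ((measure_union_le _ _).trans (add_le_add ((measure_union_le _ _).trans
      (add_le_add hm hev1)) hev2)) (hB.trans (ENNReal.ofReal_le_ofReal (min_le_left _ _))))) hTP).trans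
      (le_of_eq ?_))
  rw [← ENNReal.ofReal_add hη5.le hη5.le, ← ENNReal.ofReal_add (by positivity) hη5.le,
    ← ENNReal.ofReal_add (by positivity) hη5.le, ← ENNReal.ofReal_add (by positivity) hη5.le]
  congr 1
  ring

end QuadraticMax

/-! ### Second-order expansion of the welfare and the limiting covariance matrix -/

/-- Second-order Taylor expansion with Peano remainder at a critical point of a function that is
differentiable nearby and whose derivative is differentiable at the point. -/
lemma exists_second_order_expansion {E : Type*} [NormedAddCommGroup E] [NormedSpace ℝ E]
    {f : E → ℝ} {x : E} (hf : ∀ᶠ y in 𝓝 x, DifferentiableAt ℝ f y)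
    (hf2 : DifferentiableAt ℝ (fderiv ℝ f) x) (h0 : fderiv ℝ f x = 0) {ε : ℝ} (hε : 0 < ε) :
    ∃ δ : ℝ, 0 < δ ∧ ∀ h, ‖h‖ ≤ δ →
      |f (x + h) - f x - 1 / 2 * fderiv ℝ (fderiv ℝ f) x h h| ≤ ε * ‖h‖ ^ 2 := by
  set F := fderiv ℝ (fderiv ℝ f) x with hF
  have hsymm : ∀ v w, F v w = F w v := fun v w =>
    second_derivative_symmetric_of_eventually (hf.mono fun y hy => hy.hasFDerivAt)
      hf2.hasFDerivAt v w
  have hlin := hf2.hasFDerivAt.isLittleO.def hε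
  obtain ⟨r, hr, hball⟩ := Metric.eventually_nhds_iff_ball.1 (hf.and hlin)
  have hmem : ∀ h : E, ‖h‖ < r → x + h ∈ Metric.ball x r := fun h hh => mem_ball_add hh
  refine ⟨r / 2, half_pos hr, fun h hh => ?_⟩
  have hhr : ‖h‖ < r := by linarith
  set φ : E → ℝ := fun y => f (x + y) - 1 / 2 * F y y with hφ
  have hder : ∀ y ∈ Metric.closedBall (0 : E) ‖h‖,
      HasFDerivWithinAt φ (fderiv ℝ f (x + y) - F y) (Metric.closedBall (0 : E) ‖h‖) y := by
    intro y hy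
    have hy' : ‖y‖ < r := by
      rw [mem_closedBall_zero_iff] at hy; linarith
    have h1 : HasFDerivAt (fun y => f (x + y)) (fderiv ℝ f (x + y)) y :=
      (hasFDerivAt_comp_add_left x).2 (hball _ (hmem y hy')).1.hasFDerivAt
    have h2 : HasFDerivAt (fun y => F y y) (F y + F.flip y) y := by
      have := (F.hasFDerivAt (x := y)).clm_apply (hasFDerivAt_id y)
      convert! this using 1
    have h3 := h1.sub (h2.const_mul (1 / 2 : ℝ))
    refine HasFDerivAt.hasFDerivWithinAt ?_
    convert! h3 using 1
    ext v
    simp [hsymm v y]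
    ring
  have hbound : ∀ y ∈ Metric.closedBall (0 : E) ‖h‖, ‖fderiv ℝ f (x + y) - F y‖ ≤ ε * ‖h‖ := by
    intro y hy
    rw [mem_closedBall_zero_iff] at hy
    have h1 := (hball _ (hmem y (by linarith))).2
    rw [h0, sub_zero, add_sub_cancel_left] at h1
    exact h1.trans (by gcongr)
  have hmv := (convex_closedBall (0 : E) ‖h‖).norm_image_sub_le_of_norm_hasFDerivWithin_le hder hbound
    (Metric.mem_closedBall_self (norm_nonneg h)) (mem_closedBall_zero_iff.2 le_rfl)
  simp only [hφ, add_zero, map_zero, mul_zero, sub_zero, Real.norm_eq_abs] at hmv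
  calc |f (x + h) - f x - 1 / 2 * F h h| = |f (x + h) - 1 / 2 * F h h - f x| := by congr 1; ring
    _ ≤ ε * ‖h‖ * ‖h‖ := hmv
    _ = ε * ‖h‖ ^ 2 := by ring

lemma exists_coercive_of_posDef {p : ℕ} {H : Matrix (Fin p) (Fin p) ℝ} (hH : H.PosDef) :
    ∃ c : ℝ, 0 < c ∧ ∀ h : Par p, c * ‖h‖ ^ 2 ≤ inner ℝ (toEuclideanCLM (𝕜 := ℝ) H h) h := by
  set A := toEuclideanCLM (𝕜 := ℝ) H
  have hpos : ∀ h : Par p, h ≠ 0 → 0 < inner ℝ (A h) h := fun h hh => by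
    rw [real_inner_comm, inner_toEuclideanCLM]
    have := hH.dotProduct_mulVec_pos (x := h.ofLp) (by simpa using hh)
    simpa using this
  rcases (Metric.sphere (0 : Par p) 1).eq_empty_or_nonempty with he | hne
  · refine ⟨1, one_pos, fun h => ?_⟩
    have h0 : h = 0 := by
      by_contra hcon
      have : ‖h‖⁻¹ • h ∈ Metric.sphere (0 : Par p) 1 := by
        simp [norm_smul, hcon]
      rw [he] at this
      exact this
    simp [h0]
  · obtain ⟨x, hx, hmin⟩ := (isCompact_sphere (0 : Par p) 1).exists_isMinOn hne
      (f := fun h => inner ℝ (A h) h) (by fun_prop)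
    have hx0 : x ≠ 0 := by
      rintro rfl
      simp at hx
    refine ⟨_, hpos x hx0, fun h => ?_⟩
    by_cases hh : h = 0
    · simp [hh]
    · have hn : 0 < ‖h‖ := norm_pos_iff.2 hh
      have h1 : ‖h‖⁻¹ • h ∈ Metric.sphere (0 : Par p) 1 := by simp [norm_smul, hh]
      have h2 : inner ℝ (A x) x ≤ inner ℝ (A (‖h‖⁻¹ • h)) (‖h‖⁻¹ • h) := hmin h1
      rw [map_smul, real_inner_smul_left, real_inner_smul_right] at h2
      calc inner ℝ (A x) x * ‖h‖ ^ 2 ≤ ‖h‖⁻¹ * (‖h‖⁻¹ * inner ℝ (A h) h) * ‖h‖ ^ 2 := by gcongr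
        _ = inner ℝ (A h) h := by field_simp

/-- Sequences that converge in distribution are bounded in probability. -/
lemma exists_tight_bound {p : ℕ} {Ω Ω' : Type*} [MeasurableSpace Ω] [MeasurableSpace Ω']
    {P : Measure Ω} [IsProbabilityMeasure P] {γ : Measure Ω'} [IsProbabilityMeasure γ]
    {U : ℕ → Ω → Par p} {G : Ω' → Par p}
    (h : TendstoInDistribution U atTop G (fun _ => P) γ) {η : ℝ} (hη : 0 < η) :
    ∃ K : ℝ, 0 < K ∧ ∀ᶠ n in atTop, P {w | K < ‖U n w‖} ≤ ENNReal.ofReal η := by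
  have hprob : IsProbabilityMeasure (γ.map G) := Measure.isProbabilityMeasure_map h.aemeasurable_limit
  have ht := tendsto_measure_norm_gt_of_isTightMeasureSet (isTightMeasureSet_singleton (μ := γ.map G))
  simp only [Set.mem_singleton_iff, iSup_iSup_eq_left] at ht
  obtain ⟨K, hK, hK0⟩ := ((ht.eventually_lt_const (ENNReal.ofReal_pos.2 hη)).and
    (eventually_gt_atTop 0)).exists
  refine ⟨K + 1, by linarith, ?_⟩
  have hcl : IsClosed {x : Par p | K + 1 ≤ ‖x‖} := isClosed_le continuous_const continuous_norm
  have hle := ProbabilityMeasure.limsup_measure_closed_le_of_tendsto h.tendsto hcl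
  have hlt : (γ.map G) {x : Par p | K + 1 ≤ ‖x‖} < ENNReal.ofReal η :=
    (measure_mono fun x (hx : K + 1 ≤ ‖x‖) => (by
      change K < ‖x‖; linarith)).trans_lt hK
  filter_upwards [eventually_lt_of_limsup_lt (hle.trans_lt hlt)] with n hn
  refine le_trans ?_ hn.le
  refine le_trans ?_ (Measure.le_map_apply (h.forall_aemeasurable n) _)
  exact measure_mono fun w hw => show K + 1 ≤ ‖U n w‖ from le_of_lt hw

namespace PolicyModel

variable {d p : ℕ} {Ω₀ : Type*} [MeasurableSpace Ω₀] {M : PolicyModel d p Ω₀}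
  {θs : Par p}

/-- The matrix `H` as a quadratic form is minus the second derivative of the welfare. -/
lemma inner_H_self (h : Par p) : inner ℝ (toEuclideanCLM (𝕜 := ℝ) (M.H θs) h) h
    = -(fderiv ℝ (fderiv ℝ M.welfare) θs h h) := by
  rw [real_inner_comm, inner_toEuclideanCLM]
  set F := fderiv ℝ (fderiv ℝ M.welfare) θs with hF
  have hrep : h = ∑ i, h i • EuclideanSpace.single i (1 : ℝ) := by
    have := (EuclideanSpace.basisFun (Fin p) ℝ).sum_repr h
    simpa using this.symm
  have h1 : F h h = ∑ i, ∑ j, h i * (h j * F (EuclideanSpace.single i 1)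
      (EuclideanSpace.single j 1)) := by
    conv_lhs => rw [hrep]
    simp only [map_sum, map_smul, _root_.sum_apply, _root_.smul_apply,
      smul_eq_mul, Finset.mul_sum]
    rw [Finset.sum_comm]
    refine Finset.sum_congr rfl fun i _ => Finset.sum_congr rfl fun j _ => by ring
  rw [h1]
  simp only [dotProduct, mulVec, H, Matrix.of_apply, Finset.mul_sum, ← Finset.sum_neg_distrib]
  refine Finset.sum_congr rfl fun i _ => Finset.sum_congr rfl fun j _ => ?_
  rw [← hF]
  ring

lemma ConcaveUnique.exists_quadraticMax (h : M.ConcaveUnique θs) :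
    ∃ c, QuadraticMax M.welfare M.Θ θs (toEuclideanCLM (𝕜 := ℝ) (M.H θs)) c := by
  obtain ⟨c, hc, hcoer⟩ := exists_coercive_of_posDef h.posDef
  have hd := h.twice_differentiable.self_of_nhds
  have h0 : fderiv ℝ M.welfare θs = 0 := by
    have := h.gradient_eq_zero
    rwa [gradient, LinearIsometryEquiv.map_eq_zero_iff] at this
  refine ⟨c, hc, hcoer, fun ε hε => ?_, h.concave, interior_subset h.mem_interior⟩
  obtain ⟨δ, hδ, hex⟩ := exists_second_order_expansion
    (h.twice_differentiable.mono fun y hy => hy.1) hd.2 h0 hε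
  refine ⟨δ, hδ, fun v hv => ?_⟩
  rw [inner_H_self, mul_neg, ← sub_eq_add_neg]
  exact hex v hv

lemma isHermitian_varPhiDot (M : PolicyModel d p Ω₀) (θs : Par p) :
    (M.varPhiDot θs).IsHermitian := by
  ext i j
  simp only [varPhiDot, conjTranspose_apply, of_apply, star_trivial]
  exact covariance_comm _ _

namespace Regular

variable {C r : ℝ} (R : M.Regular θs C r) {g : ℝ × Cov d → Par p} (G : M.GradVersion θs C g)

include R G

lemma memLp_influence : MemLp (M.influence g) 2 M.obsLaw := by
  refine MemLp.of_bound (measurable_influence G.measurable).aestronglyMeasurable (3 * C ^ 3) ?_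
  filter_upwards [R.ae_influence G] with z hz using hz.2.1

/-- The influence function with a measurable version of the gradient has the covariance matrix
`Var(φ̇(Z))`. -/
lemma variance_inner_influence (s : Par p) :
    Var[fun z => inner ℝ (M.influence g z) s; M.obsLaw]
      = s.ofLp ⬝ᵥ M.varPhiDot θs *ᵥ s.ofLp := by
  have hm := R.memLp_influence G
  have hmi : ∀ i, MemLp (fun z => M.influence g z i) 2 M.obsLaw := fun i => by
    have := hm.inner_const (𝕜 := ℝ) (EuclideanSpace.single i (1 : ℝ))
    simpa [EuclideanSpace.inner_single_right] using this
  have hcov : ∀ i j, cov[fun z => M.influence g z i, fun z => M.influence g z j; M.obsLaw]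
      = M.varPhiDot θs i j := by
    intro i j
    rw [obsLaw, covariance_map_fun (hmi i).1 (hmi j).1 M.measurable_Z.aemeasurable, varPhiDot,
      of_apply]
    have hae : ∀ᵐ u ∂M.law, M.influence g (M.Z u) = M.phiDot θs (M.Z u) := by
      refine ae_of_ae_map (p := fun z => M.influence g z = M.phiDot θs z)
        M.measurable_Z.aemeasurable ?_
      filter_upwards [R.ae_influence G] with z hz using hz.1
    have hc : ∀ k, (fun u => M.influence g (M.Z u) k) =ᵐ[M.law] fun u => M.phiDot θs (M.Z u) k :=
      fun k => hae.mono fun u hu => by simp only [hu]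
    simp only [covariance]
    rw [integral_congr_ae (hc i), integral_congr_ae (hc j)]
    refine integral_congr_ae ?_
    filter_upwards [hae] with u hu
    rw [hu]
  have hexp : (fun z => inner ℝ (M.influence g z) s) = fun z => ∑ i, s i * M.influence g z i := by
    funext z
    simp [PiLp.inner_apply]
  rw [← covariance_self, hexp, covariance_fun_sum_fun_sum (fun i => (hmi i).const_mul _)
    (fun i => (hmi i).const_mul _)]
  · simp only [dotProduct, mulVec, Finset.mul_sum]
    refine Finset.sum_congr rfl fun i _ => Finset.sum_congr rfl fun j _ => ?_
    rw [covariance_const_mul_left, covariance_const_mul_right, hcov]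
    ring
  · exact (hm.inner_const s).1.aemeasurable

lemma posSemidef_varPhiDot : (M.varPhiDot θs).PosSemidef := by
  refine .of_dotProduct_mulVec_nonneg (M.isHermitian_varPhiDot θs) fun x => ?_
  have := R.variance_inner_influence G (WithLp.toLp 2 x)
  rw [star_trivial]
  simp only at this
  rw [← this]
  exact variance_nonneg _ _

end Regular

end PolicyModel

/-! ### The limiting distribution of the estimator and of its regret -/

lemma inner_toEuclideanCLM_left {p : ℕ} {B : Matrix (Fin p) (Fin p) ℝ} (hB : B.IsHermitian)
    (x y : Par p) : inner ℝ (toEuclideanCLM (𝕜 := ℝ) B x) y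
      = inner ℝ x (toEuclideanCLM (𝕜 := ℝ) B y) := by
  rw [real_inner_comm, inner_toEuclideanCLM, inner_toEuclideanCLM,
    dotProduct_mulVec, ← mulVec_transpose, dotProduct_comm]
  have : Bᵀ = B := by simpa [IsHermitian, conjTranspose_eq_transpose_of_trivial] using hB
  rw [this]

/-- The constant of the regularity conditions can be increased. -/
lemma PolicyModel.Regular.mono {d p : ℕ} {Ω₀ : Type*} [MeasurableSpace Ω₀]
    {M : PolicyModel d p Ω₀} {θs : Par p} {C C' r : ℝ} (R : M.Regular θs C r) (h : C ≤ C') :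
    M.Regular θs C' r where
  one_le := R.one_le.trans h
  r_pos := R.r_pos
  outcome t ht u := (R.outcome t ht u).trans h
  density t ht x hx :=
    (inv_anti₀ (zero_lt_one.trans_le R.one_le) h).trans (R.density t ht x hx)
  pol_le θ hθ t ht x hx := (R.pol_le θ hθ t ht x hx).trans h
  ball_subset := R.ball_subset
  continuous := R.continuous
  diff := R.diff.mono fun _ hz θ hθ => ⟨(hz θ hθ).1, (hz θ hθ).2.trans h⟩

theorem theorem6 {d p L : ℕ} (hL : 2 ≤ L)
    {Ω₀ : Type*} [MeasurableSpace Ω₀] [StandardBorelSpace Ω₀] [Nonempty Ω₀]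
    (M : PolicyModel d p Ω₀) (θs : Par p)
    (h_unconf : M.Unconfounded) (h_concave : M.ConcaveUnique θs) (h_smooth : M.PolicySmooth θs)
    (h_bdd : M.BoundedOutcomesOverlap)
    {Ω : Type*} [MeasurableSpace Ω] (P : Measure Ω) [IsProbabilityMeasure P]
    (Z : ℕ → Ω → Obs d) (hZ_meas : ∀ i, Measurable (Z i)) (hZ_indep : iIndepFun Z P)
    (hZ_law : ∀ i, P.map (Z i) = M.law.map M.Z)
    (A : CrossFitting d L) (h_nuis : NuisanceRates M A P Z)
    (θhat : ℕ → Ω → Par p) (hθ_meas : ∀ n, Measurable (θhat n))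
    (hθ_argmax : Tendsto (fun n => P {w | ¬ (θhat n w ∈ M.Θ ∧
      IsMaxOn (A.drWelfare M (sample Z n w)) M.Θ (θhat n w))}) atTop (𝓝 0)) :
    (M.Veff θs).PosSemidef ∧
    TendstoInDistribution (fun (n : ℕ) (w : Ω) => √(n : ℝ) • (θhat n w - θs)) atTop
      (fun g : Par p => g) (fun _ => P) (multivariateGaussian 0 (M.Veff θs)) ∧
    TendstoInDistribution (fun (n : ℕ) (w : Ω) => (n : ℝ) * M.regret θs (θhat n w)) atTop
      (fun g : Par p => (1 / 2 : ℝ) * (g.ofLp ⬝ᵥ (M.H θs) *ᵥ g.ofLp)) (fun _ => P)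
      (multivariateGaussian 0 (M.Veff θs)) := by
  -- One constant bounds the model and, with probability tending to one, the estimators of `m`.
  obtain ⟨C₀, r, R₀⟩ := PolicyModel.exists_regular h_concave.mem_interior h_smooth h_bdd
  obtain ⟨C₁, hC₁⟩ := h_nuis.bounded
  obtain ⟨ρω, ρm, hω, hm, hρ, hw, hq⟩ := h_nuis.rates
  have R := R₀.mono (le_max_left C₀ C₁)
  have hqC : ∀ ℓ, Tendsto (fun n => P {w | ∃ t ∈ M.𝒯, ∃ x ∈ M.𝒳,
      max C₀ C₁ < |A.mhatOn (sample Z n w) ℓ (t, x)|}) atTop (𝓝 0) := fun ℓ =>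
    tendsto_of_tendsto_of_tendsto_of_le_of_le tendsto_const_nhds (hC₁ ℓ) (fun _ => zero_le)
      fun n => measure_mono fun w ⟨t, ht, x, hx, h⟩ => ⟨t, ht, x, hx, (le_max_right _ _).trans_lt h⟩
  have hlaw : ∀ i, P.map (Z i) = M.obsLaw := hZ_law
  have hd := h_concave.twice_differentiable.self_of_nhds.1
  have h0 := h_concave.gradient_eq_zero
  obtain ⟨g, G⟩ := R.exists_gradVersion
  have hSD := A.stochDiff_drWelfare R G h_unconf hd h0 hZ_meas hZ_indep hlaw hω hm hρ hw hq hqC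
  have hcons : ∀ κ : ℝ, 0 < κ → Tendsto (fun n => P {w | ∃ θ ∈ M.Θ,
      κ < |A.drWelfare M (sample Z n w) θ - M.welfare θ|}) atTop (𝓝 0) := fun κ hκ =>
    A.tendsto_measure_drWelfare_sub R h_unconf h_concave.isCompact hZ_meas hZ_indep hlaw hω hm
      hw hq hqC hκ
  obtain ⟨c, Q⟩ := h_concave.exists_quadraticMax
  -- The central limit theorem for the influence functions, and for their images under `H⁻¹`.
  have hHinv : (M.H θs)⁻¹.IsHermitian := h_concave.posDef.isHermitian.inv
  have hV := R.posSemidef_varPhiDot G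
  have hVeff : (M.Veff θs).PosSemidef := by
    have := hV.conjTranspose_mul_mul_same (M.H θs)⁻¹
    rwa [hHinv.eq] at this
  set H' := toEuclideanCLM (𝕜 := ℝ) (M.H θs) with hH'
  set K := toEuclideanCLM (𝕜 := ℝ) (M.H θs)⁻¹ with hK
  have hHK : ∀ x, H' (K x) = x := fun x => by
    have h1 : M.H θs * (M.H θs)⁻¹ = 1 :=
      mul_nonsing_inv _ ((isUnit_iff_isUnit_det _).1 h_concave.posDef.isUnit)
    have h2 : H' * K = 1 := by rw [hH', hK, ← map_mul, h1, map_one]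
    exact congrArg (fun f : Par p →L[ℝ] Par p => f x) h2
  have hmean : ∀ t, ∫ z, inner ℝ (M.influence g z) t ∂M.obsLaw = 0 := fun t =>
    R.integral_inner_influence G h_unconf hd h0 t
  have hinf := PolicyModel.measurable_influence (M := M) G.measurable
  have hcltS := tendstoInDistribution_multivariate hZ_meas hZ_indep hlaw hinf
    (R.memLp_influence G) hmean hV (R.variance_inner_influence G)
  have hcltK : TendstoInDistribution (fun (n : ℕ) w => (√(n : ℝ))⁻¹ • ∑ k ∈ Finset.range n,
      K (M.influence g (Z k w))) atTop (fun g : Par p => g) (fun _ => P)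
      (multivariateGaussian 0 (M.Veff θs)) := by
    have hinner : ∀ t z, inner ℝ (K (M.influence g z)) t = inner ℝ (M.influence g z) (K t) :=
      fun t z => inner_toEuclideanCLM_left hHinv _ _
    refine tendstoInDistribution_multivariate (ψ := fun z => K (M.influence g z))
      hZ_meas hZ_indep hlaw
      (K.continuous.measurable.comp hinf) (K.comp_memLp' (R.memLp_influence G)) (fun t => ?_) hVeff
      fun t => ?_
    · simp only [hinner]
      exact hmean _
    · simp only [hinner]
      rw [R.variance_inner_influence G]
      have hT : ((M.H θs)⁻¹)ᵀ = (M.H θs)⁻¹ := by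
        simpa [IsHermitian, conjTranspose_eq_transpose_of_trivial] using hHinv
      have hKt : (K t).ofLp = (M.H θs)⁻¹ *ᵥ t.ofLp := by simp [hK]
      rw [hKt, PolicyModel.Veff, ← mulVec_mulVec, ← mulVec_mulVec, dotProduct_mulVec t.ofLp,
        ← mulVec_transpose, hT]
  have htight : ∀ η : ℝ, 0 < η → ∃ K : ℝ, 0 < K ∧ ∀ᶠ n : ℕ in atTop,
      P {w | K < ‖(√(n : ℝ))⁻¹ • ∑ k ∈ Finset.range n, M.influence g (Z k w)‖}
        ≤ ENNReal.ofReal η := fun η hη => exists_tight_bound hcltS hη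
  have hrate : ∀ η : ℝ, 0 < η → ∃ K : ℝ, 0 < K ∧ ∀ᶠ n : ℕ in atTop,
      P {w | K < √(n : ℝ) * ‖θhat n w - θs‖} ≤ ENNReal.ofReal η := fun η hη =>
    Q.rate hθ_argmax hcons htight hSD hη
  have hlin := Q.asymptotically_linear (half_pos R.r_pos)
    (fun h hh => R.ball_subset (mem_ball_add (hh.trans_lt (half_lt_self R.r_pos))))
    hHK (inner_toEuclideanCLM_left h_concave.posDef.isHermitian) hθ_argmax hrate htight hSD
  have hmeas : ∀ n : ℕ, Measurable fun w => √(n : ℝ) • (θhat n w - θs) := fun n =>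
    ((hθ_meas n).sub_const θs).const_smul (√(n : ℝ))
  have hfirst : TendstoInDistribution (fun (n : ℕ) (w : Ω) => √(n : ℝ) • (θhat n w - θs)) atTop
      (fun g : Par p => g) (fun _ => P) (multivariateGaussian 0 (M.Veff θs)) := by
    refine tendstoInDistribution_of_tendstoInMeasure_sub _ _ hcltK ?_
      fun n => (hmeas n).aemeasurable
    convert! hlin using 1
    funext n w
    simp [map_sum]
  refine ⟨hVeff, hfirst, ?_⟩
  have hquad : ∀ x : Par p, 1 / 2 * inner ℝ (H' x) x
      = (1 / 2 : ℝ) * (x.ofLp ⬝ᵥ (M.H θs) *ᵥ x.ofLp) := fun x => by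
    rw [real_inner_comm, inner_toEuclideanCLM]
  have hcont : Continuous fun x : Par p => (1 / 2 : ℝ) * (x.ofLp ⬝ᵥ (M.H θs) *ᵥ x.ofLp) := by
    simp only [← hquad]
    fun_prop
  refine tendstoInDistribution_of_tendstoInMeasure_sub _ _
    (hfirst.continuous_comp (g := fun x : Par p => (1 / 2 : ℝ) * (x.ofLp ⬝ᵥ (M.H θs) *ᵥ x.ofLp))
      hcont) ?_
    fun n => ?_
  · convert! Q.regret_expansion hrate using 1
  · exact (measurable_const.sub (M.measurable_welfare.comp (hθ_meas n))).const_mul _ |>.aemeasurable
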